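/- Computations are carried out on a deterministic real RAM: a program uses finitely many registers and arrays whose cells hold real numbers or integer words; at unit cost it can move data, perform exact real arithmetic $+,-,\times,/$, compare two reals, perform integer arithmetic ($+$, truncated $-$, $\times$, quotient and remainder) and comparison, access an array cell, or read the next number of a one-way read-only input tape. Integer words are limited to $O(\log m)$ bits, where $m$ is the size of the instance, and space is the number of memory cells used, not counting the input tapes. Let $\mathrm{Sort}:\mathbb N\to\mathbb N$ with $\mathrm{Sort}(k)\ge k$ for all $k$ bound the running time of some linear-space sorting program of this model: given $k$ real numbers, the program computes, in at most $\mathrm{Sort}(k)$ steps and with $O(k+1)$ memory cells and words of $O(\log (k+2))$ bits, a permutation that puts them in nondecreasing order. Then there are two programs, $\mathrm{Build}$ and $\mathrm{Query}$, and a constant $K$ (depending only on the sorting program and $\mathrm{Sort}$) such that for all integers $n,b\ge 1$ and all matrices $A,B\in\mathbb R^{n\times n}$ with nonnegative entries, with $C=AB$ and $\|C\|_{E1}=\sum_{i,j}|C_{ij}|$, the following holds. (1) Given $n$ and $b$, with $A$ in column-major order on one input tape and $B$ in row-major order on the other, $\mathrm{Build}$ makes a single pass over the two tapes and halts after at most $K\,(nb+n\,\mathrm{Sort}(n))$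 steps, using at most $K(b+n)$ cells in each of its finitely many arrays and only integers of size at most $(b+n)^K$; that is, it runs in time $O(nb+n\,\mathrm{Sort}(n))$ and space $O(b+n)$. (2) There are numbers $\widehat C_{ij}$ with $$\max\left(C_{ij}-\frac{\|C\|_{E1}}{b},\,0\right)\le \widehat C_{ij}\le C_{ij}\qquad (1\le i,j\le n)$$ (so every entry of $C$ is approximated within additive error $\|C\|_{E1}/b$), such that afterwards, within the same memory and word bounds and without any access to the input tapes, $\mathrm{Query}$ answers every finite sequence of queries $(i,j)$ one after the other, returning $\widehat C_{ij}$ after at most $K$ steps for each query. -/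

import Mathlib

/-!
A small imperative language for a real RAM: unit-cost exact arithmetic and comparisons on real
numbers, integer words used for indexing, finitely many registers and arrays (every program
mentions only finitely many of them), and two one-way read-only input tapes of real numbers.
There is no way to turn a real number into an integer other than branching on comparisons.
-/

namespace RealRAM

/-- A machine state. `nreg`, `rreg` are the integer and real registers, `narr`, `rarr` the integer
and real arrays (array name, then index), and `tape` holds the unread part of the two inputs. -/
structure State where
  nreg : ℕ → ℕ
  rreg : ℕ → ℝ
  narr : ℕ → ℕ → ℕ
  rarr : ℕ → ℕ → ℝ
  tape : Bool → List ℝ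

/-- The state with all registers and arrays zero and both tapes empty. -/
noncomputable def State.blank : State where
  nreg := fun _ => 0
  rreg := fun _ => 0
  narr := fun _ _ => 0
  rarr := fun _ _ => 0
  tape := fun _ => []

/-- Integer expressions; the names of registers and arrays are fixed in the program text. -/
inductive NExp where
  | lit (c : ℕ)
  | reg (x : ℕ)
  | arr (a : ℕ) (i : NExp)
  | add (e f : NExp)
  | sub (e f : NExp)
  | mul (e f : NExp)
  | div (e f : NExp)
  | mod (e f : NExp)

/-- The value of an integer expression (subtraction is truncated at zero). -/
def NExp.eval (s : State) : NExp → ℕ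
  | .lit c => c
  | .reg x => s.nreg x
  | .arr a i => s.narr a (i.eval s)
  | .add e f => e.eval s + f.eval s
  | .sub e f => e.eval s - f.eval s
  | .mul e f => e.eval s * f.eval s
  | .div e f => e.eval s / f.eval s
  | .mod e f => e.eval s % f.eval s

/-- The evaluation is legal: array indices are below the memory limit `M`, no integer that is
produced exceeds the word limit `W`, and there is no division by zero. -/
def NExp.Ok (M W : ℕ) (s : State) : NExp → Prop
  | .lit c => c ≤ W
  | .reg _ => True
  | .arr _ i => i.Ok M W s ∧ i.eval s < M
  | .add e f => e.Ok M W s ∧ f.Ok M W s ∧ e.eval s + f.eval s ≤ W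
  | .sub e f => e.Ok M W s ∧ f.Ok M W s
  | .mul e f => e.Ok M W s ∧ f.Ok M W s ∧ e.eval s * f.eval s ≤ W
  | .div e f => e.Ok M W s ∧ f.Ok M W s ∧ f.eval s ≠ 0
  | .mod e f => e.Ok M W s ∧ f.Ok M W s ∧ f.eval s ≠ 0

/-- The number of elementary operations in an integer expression. -/
def NExp.cost : NExp → ℕ
  | .lit _ => 1
  | .reg _ => 1
  | .arr _ i => i.cost + 1
  | .add e f => e.cost + f.cost + 1
  | .sub e f => e.cost + f.cost + 1
  | .mul e f => e.cost + f.cost + 1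
  | .div e f => e.cost + f.cost + 1
  | .mod e f => e.cost + f.cost + 1

/-- Real expressions; the only real constants in a program text are `0` and `1`. -/
inductive RExp where
  | zero
  | one
  | reg (x : ℕ)
  | arr (a : ℕ) (i : NExp)
  | add (e f : RExp)
  | sub (e f : RExp)
  | mul (e f : RExp)
  | div (e f : RExp)

/-- The value of a real expression. -/
noncomputable def RExp.eval (s : State) : RExp → ℝ
  | .zero => 0
  | .one => 1
  | .reg x => s.rreg x
  | .arr a i => s.rarr a (i.eval s)
  | .add e f => e.eval s + f.eval s
  | .sub e f => e.eval s - f.eval s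
  | .mul e f => e.eval s * f.eval s
  | .div e f => e.eval s / f.eval s

/-- The evaluation is legal: array indices are legal and below the memory limit, and there is no
division by zero. -/
def RExp.Ok (M W : ℕ) (s : State) : RExp → Prop
  | .zero => True
  | .one => True
  | .reg _ => True
  | .arr _ i => i.Ok M W s ∧ i.eval s < M
  | .add e f => e.Ok M W s ∧ f.Ok M W s
  | .sub e f => e.Ok M W s ∧ f.Ok M W s
  | .mul e f => e.Ok M W s ∧ f.Ok M W s
  | .div e f => e.Ok M W s ∧ f.Ok M W s ∧ f.eval s ≠ 0

/-- The number of elementary operations in a real expression. -/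
def RExp.cost : RExp → ℕ
  | .zero => 1
  | .one => 1
  | .reg _ => 1
  | .arr _ i => i.cost + 1
  | .add e f => e.cost + f.cost + 1
  | .sub e f => e.cost + f.cost + 1
  | .mul e f => e.cost + f.cost + 1
  | .div e f => e.cost + f.cost + 1

/-- Tests: comparisons of integers and of reals, negation and conjunction. -/
inductive BExp where
  | nle (e f : NExp)
  | rle (e f : RExp)
  | not (p : BExp)
  | and (p q : BExp)

/-- The truth value of a test. -/
def BExp.Holds (s : State) : BExp → Prop
  | .nle e f => e.eval s ≤ f.eval s
  | .rle e f => e.eval s ≤ f.eval s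
  | .not p => ¬ p.Holds s
  | .and p q => p.Holds s ∧ q.Holds s

/-- The evaluation of a test is legal (a conjunction is evaluated from left to right, and its
second part only if the first part holds). -/
def BExp.Ok (M W : ℕ) (s : State) : BExp → Prop
  | .nle e f => e.Ok M W s ∧ f.Ok M W s
  | .rle e f => e.Ok M W s ∧ f.Ok M W s
  | .not p => p.Ok M W s
  | .and p q => p.Ok M W s ∧ (p.Holds s → q.Ok M W s)

/-- The number of elementary operations in a test. -/
def BExp.cost : BExp → ℕ
  | .nle e f => e.cost + f.cost + 1
  | .rle e f => e.cost + f.cost + 1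
  | .not p => p.cost + 1
  | .and p q => p.cost + q.cost + 1

/-- Programs. `read d x` moves the next number of input tape `d` into real register `x`. -/
inductive Cmd where
  | skip
  | setN (x : ℕ) (e : NExp)
  | setR (x : ℕ) (e : RExp)
  | storeN (a : ℕ) (i : NExp) (e : NExp)
  | storeR (a : ℕ) (i : NExp) (e : RExp)
  | read (d : Bool) (x : ℕ)
  | seq (c d : Cmd)
  | ite (p : BExp) (c d : Cmd)
  | loop (p : BExp) (c : Cmd)

/-- `Exec M W c s t s'`: on a machine whose arrays have the cells `0, …, M - 1` and whose integer
words hold the numbers `0, …, W`, program `c` started in state `s` halts after `t` elementary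
steps in state `s'`. Running out of bounds, overflowing a word, dividing by zero, or reading from
an exhausted tape is not a legal execution: the relation then has no matching rule. -/
inductive Exec (M W : ℕ) : Cmd → State → ℕ → State → Prop
  | skip (s : State) : Exec M W .skip s 1 s
  | setN (s : State) (x : ℕ) (e : NExp) (he : e.Ok M W s) :
      Exec M W (.setN x e) s (e.cost + 1)
        { s with nreg := Function.update s.nreg x (e.eval s) }
  | setR (s : State) (x : ℕ) (e : RExp) (he : e.Ok M W s) :
      Exec M W (.setR x e) s (e.cost + 1)
        { s with rreg := Function.update s.rreg x (e.eval s) }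
  | storeN (s : State) (a : ℕ) (i e : NExp) (hi : i.Ok M W s) (hM : i.eval s < M)
      (he : e.Ok M W s) :
      Exec M W (.storeN a i e) s (i.cost + e.cost + 1)
        { s with
          narr := Function.update s.narr a
            (Function.update (s.narr a) (i.eval s) (e.eval s)) }
  | storeR (s : State) (a : ℕ) (i : NExp) (e : RExp) (hi : i.Ok M W s) (hM : i.eval s < M)
      (he : e.Ok M W s) :
      Exec M W (.storeR a i e) s (i.cost + e.cost + 1)
        { s with
          rarr := Function.update s.rarr a
            (Function.update (s.rarr a) (i.eval s) (e.eval s)) }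
  | read (s : State) (d : Bool) (x : ℕ) (r : ℝ) (l : List ℝ) (h : s.tape d = r :: l) :
      Exec M W (.read d x) s 1
        { s with rreg := Function.update s.rreg x r, tape := Function.update s.tape d l }
  | seq {c d : Cmd} {s s₁ s₂ : State} {t₁ t₂ : ℕ} (h₁ : Exec M W c s t₁ s₁)
      (h₂ : Exec M W d s₁ t₂ s₂) :
      Exec M W (.seq c d) s (t₁ + t₂) s₂
  | iteTrue {p : BExp} {c d : Cmd} {s s' : State} {t : ℕ} (hp : p.Ok M W s) (h : p.Holds s)
      (hc : Exec M W c s t s') :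
      Exec M W (.ite p c d) s (p.cost + 1 + t) s'
  | iteFalse {p : BExp} {c d : Cmd} {s s' : State} {t : ℕ} (hp : p.Ok M W s) (h : ¬ p.Holds s)
      (hd : Exec M W d s t s') :
      Exec M W (.ite p c d) s (p.cost + 1 + t) s'
  | loopTrue {p : BExp} {c : Cmd} {s s₁ s₂ : State} {t₁ t₂ : ℕ} (hp : p.Ok M W s)
      (h : p.Holds s) (h₁ : Exec M W c s t₁ s₁) (h₂ : Exec M W (.loop p c) s₁ t₂ s₂) :
      Exec M W (.loop p c) s (p.cost + 1 + t₁ + t₂) s₂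
  | loopFalse {p : BExp} {c : Cmd} {s : State} (hp : p.Ok M W s) (h : ¬ p.Holds s) :
      Exec M W (.loop p c) s (p.cost + 1) s

/-- The machine is deterministic: running time and final state are determined by the program and
the initial state. -/
theorem Exec.det {M W : ℕ} {c : Cmd} {s : State} {t t' : ℕ} {u u' : State}
    (h : Exec M W c s t u) (h' : Exec M W c s t' u') : t = t' ∧ u = u' := by
  induction h generalizing t' u' with
  | skip => cases h'; exact ⟨rfl, rfl⟩
  | setN => cases h'; exact ⟨rfl, rfl⟩
  | setR => cases h'; exact ⟨rfl, rfl⟩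
  | storeN => cases h'; exact ⟨rfl, rfl⟩
  | storeR => cases h'; exact ⟨rfl, rfl⟩
  | read s d x r l h =>
    cases h' with
    | read _ _ _ r' l' h₂ =>
      rw [h] at h₂
      injection h₂ with hr hl
      subst hr hl
      exact ⟨rfl, rfl⟩
  | seq _ _ ih₁ ih₂ =>
    cases h' with
    | seq a b =>
      obtain ⟨rfl, rfl⟩ := ih₁ a
      obtain ⟨rfl, rfl⟩ := ih₂ b
      exact ⟨rfl, rfl⟩
  | iteTrue _ hp _ ih =>
    cases h' with
    | iteTrue _ _ a => obtain ⟨rfl, rfl⟩ := ih a; exact ⟨rfl, rfl⟩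
    | iteFalse _ hn _ => exact absurd hp hn
  | iteFalse _ hp _ ih =>
    cases h' with
    | iteTrue _ hn _ => exact absurd hn hp
    | iteFalse _ _ a => obtain ⟨rfl, rfl⟩ := ih a; exact ⟨rfl, rfl⟩
  | loopTrue _ hp _ _ ih₁ ih₂ =>
    cases h' with
    | loopTrue _ _ a b =>
      obtain ⟨rfl, rfl⟩ := ih₁ a
      obtain ⟨rfl, rfl⟩ := ih₂ b
      exact ⟨rfl, rfl⟩
    | loopFalse _ hn => exact absurd hp hn
  | loopFalse _ hp =>
    cases h' with
    | loopTrue _ hn _ _ => exact absurd hn hp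
    | loopFalse _ _ => exact ⟨rfl, rfl⟩

/-- Initial state of a sorting program: `k` in integer register `0`, the numbers
`x 0, …, x (k - 1)` in the first `k` cells of real array `0`, everything else zero. -/
noncomputable def sortStart (k : ℕ) (x : Fin k → ℝ) : State :=
  { State.blank with
    nreg := Function.update State.blank.nreg 0 k
    rarr := Function.update State.blank.rarr 0 (fun i => if h : i < k then x ⟨i, h⟩ else 0) }

/-- `sorter` is a linear-space sorting program with running time at most `sortTime k` on `k` real
numbers. It leaves in integer array `0` a permutation of the positions `0, …, k - 1` that lists
the numbers in nondecreasing order. Its arrays use a linear number of cells, and its words have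
`O(log k)` bits. -/
def IsLinearSpaceSorter (sorter : Cmd) (sortTime : ℕ → ℕ) : Prop :=
  ∃ c : ℕ, ∀ (k : ℕ) (x : Fin k → ℝ), ∃ (t : ℕ) (s : State),
    Exec (c * (k + 1)) ((k + 2) ^ c) sorter (sortStart k x) t s ∧
    t ≤ sortTime k ∧
    ∃ σ : Equiv.Perm (Fin k), Monotone (x ∘ σ) ∧ ∀ i : Fin k, s.narr 0 i = σ i

/-- The entries of a square matrix, row after row. -/
def rowMajor {n : ℕ} (B : Matrix (Fin n) (Fin n) ℝ) : List ℝ :=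
  (List.finRange n).flatMap fun i => (List.finRange n).map fun j => B i j

/-- The entries of a square matrix, column after column. -/
def colMajor {n : ℕ} (A : Matrix (Fin n) (Fin n) ℝ) : List ℝ :=
  (List.finRange n).flatMap fun j => (List.finRange n).map fun i => A i j

/-- Initial state of a streaming program for the product `A * B`: `n` and `b` in the integer
registers `0` and `1`, `A` on tape `false` in column-major order, `B` on tape `true` in row-major
order, everything else zero. -/
noncomputable def productStart (n b : ℕ) (A B : Matrix (Fin n) (Fin n) ℝ) : State :=
  { State.blank with
    nreg := Function.update (Function.update State.blank.nreg 0 n) 1 b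
    tape := fun d => if d then rowMajor B else colMajor A }

/-- The state in which a query for the entry `(i, j)` starts: `i` and `j` are put into the integer
registers `0` and `1`; the input tapes are no longer available. -/
def State.withQuery (s : State) (i j : ℕ) : State :=
  { s with
    nreg := Function.update (Function.update s.nreg 0 i) 1 j
    tape := fun _ => [] }

/-- Started in `s`, the program `query` answers the queries in the list one after the other, each
within `T` steps, by leaving `est i j` in real register `0`. -/
def AnswersQueries (M W T : ℕ) (query : Cmd) {n : ℕ} (est : Matrix (Fin n) (Fin n) ℝ) :
    State → List (Fin n × Fin n) → Prop
  | _, [] => True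
  | s, q :: qs => ∃ (t : ℕ) (s' : State),
      Exec M W query (s.withQuery q.1 q.2) t s' ∧ t ≤ T ∧ s'.rreg 0 = est q.1 q.2 ∧
      AnswersQueries M W T query est s' qs

end RealRAM

/-- The entrywise 1-norm of a matrix. -/
def entrywiseL1 {n : ℕ} (C : Matrix (Fin n) (Fin n) ℝ) : ℝ :=
  ∑ i, ∑ j, |C i j|

/-!
# Approximate products of nonnegative matrices from one pass over their outer products

The product `A * B` is the sum of the outer products of the columns of `A` with the rows of `B`,
and with `A` in column-major and `B` in row-major order these can be formed one after the other.
The streaming program keeps a summary of the partial sum in the style of Misra and Gries: with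
`D = 8 * (n + b)`, a list of `O(D)` integer counters, each for one entry, in units of `N / D ^ 2`,
where `N` is the sum of all entries of the partial sum (`Summary`).

* A new outer product `a * bᵀ` has the mass `(∑ a) * (∑ b)`. Both vectors are rounded down to
  multiples of their sums divided by `D`. The integers `l i` and `r j` that result have sums at
  most `D`, and only pairs with `l i * r j ≥ D` receive counters; there are at most `D` of them
  because `∑ l * ∑ r ≤ D ^ 2` (`appendOuter`). They are found by going through the `r j` in
  decreasing order for every `i`. As the `r j` are integers of size at most `D`, a bucket sort
  orders them in time `O(D)`.
* The growth of `N` changes the unit, and the old counters are multiplied by the ratio of the two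
  units, rounded down (`rescale`). This ratio is a real number, which the machine can turn into an
  integer only by comparisons: `ratioCmd` finds its two digits in base `D` by counting, and the
  quantized vectors are found by counting, too, in `O(D)` steps because their sums are bounded.
* Counters for the same entry are merged (`dedupe`). Then a common amount is subtracted from all
  counters and those that vanish are dropped (`prune`). At least `2 * D` times the subtracted
  amount disappears from the counted mass, so that all the prunings together cost an entry at most
  `N / (2 * D)`.

One step takes time `O(D)` (`runs_processOuter`). Each of the `n` steps loses `O(1)` units to
rescaling, which is small because `D ≥ 8 * n`; the rounding of the vectors costs every entry at most
`3 * N / D` in all. The total error is at most `4 * N / D ≤ N / b`.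

The queries must take constant time in the worst case on a deterministic machine. After the pass,
a static dictionary with two levels of hash tables sends every counted entry `(i, j)` to its
counter (`runs_buildDictionary`). The first level has for every row `i` a table of linear size, the
second level has for every cell of the first level a table of quadratic size without collisions.
The hash functions are `j ↦ (a * j mod p) mod m` with a prime `p` between `n` and `2 * n`. All
multipliers `a` can be tried, since for `L` keys this takes time `O(n * L)`, and by averaging one of
them has few collisions (`exists_multiplier`). Space is linear because the number of pairs of keys
in common first-level cells is linear (`IsLayer.pairs`).
-/

/-! ### A total-correctness logic with running times -/

namespace RealRAM

variable {M W : ℕ}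

/-- The state `s` with the value `v` put into integer register `x`. -/
def State.setN (s : State) (x v : ℕ) : State := { s with nreg := Function.update s.nreg x v }

/-- The state `s` with the value `v` put into real register `x`. -/
noncomputable def State.setR (s : State) (x : ℕ) (v : ℝ) : State :=
  { s with rreg := Function.update s.rreg x v }

/-- The state `s` with the value `v` put into cell `i` of integer array `a`. -/
def State.storeN (s : State) (a i v : ℕ) : State :=
  { s with narr := Function.update s.narr a (Function.update (s.narr a) i v) }

/-- The state `s` with the value `v` put into cell `i` of real array `a`. -/
noncomputable def State.storeR (s : State) (a i : ℕ) (v : ℝ) : State :=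
  { s with rarr := Function.update s.rarr a (Function.update (s.rarr a) i v) }

/-- The state `s` with `l` as the unread part of tape `d`. -/
noncomputable def State.setTape (s : State) (d : Bool) (l : List ℝ) : State :=
  { s with tape := Function.update s.tape d l }

section Projections

variable (s : State) (x a i v y : ℕ) (r : ℝ) (d d' : Bool) (l : List ℝ)

@[simp] theorem State.nreg_setN :
    (s.setN x v).nreg y = if y = x then v else s.nreg y := by
  simp [State.setN, Function.update_apply]
@[simp] theorem State.rreg_setN : (s.setN x v).rreg = s.rreg := rfl
@[simp] theorem State.narr_setN : (s.setN x v).narr = s.narr := rfl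
@[simp] theorem State.rarr_setN : (s.setN x v).rarr = s.rarr := rfl
@[simp] theorem State.tape_setN : (s.setN x v).tape = s.tape := rfl

@[simp] theorem State.rreg_setR :
    (s.setR x r).rreg y = if y = x then r else s.rreg y := by
  simp [State.setR, Function.update_apply]
@[simp] theorem State.nreg_setR : (s.setR x r).nreg = s.nreg := rfl
@[simp] theorem State.narr_setR : (s.setR x r).narr = s.narr := rfl
@[simp] theorem State.rarr_setR : (s.setR x r).rarr = s.rarr := rfl
@[simp] theorem State.tape_setR : (s.setR x r).tape = s.tape := rfl

@[simp] theorem State.narr_storeN :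
    (s.storeN a i v).narr y = if y = a then Function.update (s.narr a) i v else s.narr y := by
  simp [State.storeN, Function.update_apply]
@[simp] theorem State.nreg_storeN : (s.storeN a i v).nreg = s.nreg := rfl
@[simp] theorem State.rreg_storeN : (s.storeN a i v).rreg = s.rreg := rfl
@[simp] theorem State.rarr_storeN : (s.storeN a i v).rarr = s.rarr := rfl
@[simp] theorem State.tape_storeN : (s.storeN a i v).tape = s.tape := rfl

@[simp] theorem State.rarr_storeR :
    (s.storeR a i r).rarr y = if y = a then Function.update (s.rarr a) i r else s.rarr y := by
  simp [State.storeR, Function.update_apply]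
@[simp] theorem State.nreg_storeR : (s.storeR a i r).nreg = s.nreg := rfl
@[simp] theorem State.rreg_storeR : (s.storeR a i r).rreg = s.rreg := rfl
@[simp] theorem State.narr_storeR : (s.storeR a i r).narr = s.narr := rfl
@[simp] theorem State.tape_storeR : (s.storeR a i r).tape = s.tape := rfl

@[simp] theorem State.tape_setTape :
    (s.setTape d l).tape d' = if d' = d then l else s.tape d' := by
  simp [State.setTape, Function.update_apply]
@[simp] theorem State.nreg_setTape : (s.setTape d l).nreg = s.nreg := rfl
@[simp] theorem State.rreg_setTape : (s.setTape d l).rreg = s.rreg := rfl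
@[simp] theorem State.narr_setTape : (s.setTape d l).narr = s.narr := rfl
@[simp] theorem State.rarr_setTape : (s.setTape d l).rarr = s.rarr := rfl

end Projections

/-! Arithmetic notation for expressions. -/

instance : Add NExp := ⟨.add⟩
instance : Sub NExp := ⟨.sub⟩
instance : Mul NExp := ⟨.mul⟩
instance : Div NExp := ⟨.div⟩
instance : Mod NExp := ⟨.mod⟩
instance : Add RExp := ⟨.add⟩
instance : Sub RExp := ⟨.sub⟩
instance : Mul RExp := ⟨.mul⟩
instance : Div RExp := ⟨.div⟩

section Expressions

variable (s : State) (e f : NExp) (g h : RExp) (c : ℕ)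

@[simp] theorem NExp.eval_lit : (NExp.lit c).eval s = c := rfl
@[simp] theorem NExp.eval_add : (e + f).eval s = e.eval s + f.eval s := rfl
@[simp] theorem NExp.eval_sub : (e - f).eval s = e.eval s - f.eval s := rfl
@[simp] theorem NExp.eval_mul : (e * f).eval s = e.eval s * f.eval s := rfl
@[simp] theorem NExp.eval_div : (e / f).eval s = e.eval s / f.eval s := rfl
@[simp] theorem NExp.eval_mod : (e % f).eval s = e.eval s % f.eval s := rfl
@[simp] theorem NExp.eval_reg (x : ℕ) : (NExp.reg x).eval s = s.nreg x := rfl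
@[simp] theorem NExp.eval_arr (a : ℕ) : (NExp.arr a e).eval s = s.narr a (e.eval s) := rfl
@[simp] theorem NExp.ok_lit : (NExp.lit c).Ok M W s ↔ c ≤ W := Iff.rfl
@[simp] theorem NExp.ok_add :
    (e + f).Ok M W s ↔ e.Ok M W s ∧ f.Ok M W s ∧ e.eval s + f.eval s ≤ W := Iff.rfl
@[simp] theorem NExp.ok_sub : (e - f).Ok M W s ↔ e.Ok M W s ∧ f.Ok M W s := Iff.rfl
@[simp] theorem NExp.ok_mul :
    (e * f).Ok M W s ↔ e.Ok M W s ∧ f.Ok M W s ∧ e.eval s * f.eval s ≤ W := Iff.rfl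
@[simp] theorem NExp.ok_div :
    (e / f).Ok M W s ↔ e.Ok M W s ∧ f.Ok M W s ∧ f.eval s ≠ 0 := Iff.rfl
@[simp] theorem NExp.ok_mod :
    (e % f).Ok M W s ↔ e.Ok M W s ∧ f.Ok M W s ∧ f.eval s ≠ 0 := Iff.rfl
@[simp] theorem NExp.ok_reg (x : ℕ) : (NExp.reg x).Ok M W s ↔ True := Iff.rfl
@[simp] theorem NExp.ok_arr (a : ℕ) :
    (NExp.arr a e).Ok M W s ↔ e.Ok M W s ∧ e.eval s < M := Iff.rfl
@[simp] theorem NExp.cost_lit : (NExp.lit c).cost = 1 := rfl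
@[simp] theorem NExp.cost_add : (e + f).cost = e.cost + f.cost + 1 := rfl
@[simp] theorem NExp.cost_sub : (e - f).cost = e.cost + f.cost + 1 := rfl
@[simp] theorem NExp.cost_mul : (e * f).cost = e.cost + f.cost + 1 := rfl
@[simp] theorem NExp.cost_div : (e / f).cost = e.cost + f.cost + 1 := rfl
@[simp] theorem NExp.cost_mod : (e % f).cost = e.cost + f.cost + 1 := rfl
@[simp] theorem NExp.cost_reg (x : ℕ) : (NExp.reg x).cost = 1 := rfl
@[simp] theorem NExp.cost_arr (a : ℕ) : (NExp.arr a e).cost = e.cost + 1 := rfl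

@[simp] theorem RExp.eval_zero : RExp.zero.eval s = 0 := rfl
@[simp] theorem RExp.eval_one : RExp.one.eval s = 1 := rfl
@[simp] theorem RExp.eval_add : (g + h).eval s = g.eval s + h.eval s := rfl
@[simp] theorem RExp.eval_sub : (g - h).eval s = g.eval s - h.eval s := rfl
@[simp] theorem RExp.eval_mul : (g * h).eval s = g.eval s * h.eval s := rfl
@[simp] theorem RExp.eval_div : (g / h).eval s = g.eval s / h.eval s := rfl
@[simp] theorem RExp.eval_reg (x : ℕ) : (RExp.reg x).eval s = s.rreg x := rfl
@[simp] theorem RExp.eval_arr (a : ℕ) : (RExp.arr a e).eval s = s.rarr a (e.eval s) := rfl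
@[simp] theorem RExp.ok_zero : RExp.zero.Ok M W s ↔ True := Iff.rfl
@[simp] theorem RExp.ok_one : RExp.one.Ok M W s ↔ True := Iff.rfl
@[simp] theorem RExp.ok_add : (g + h).Ok M W s ↔ g.Ok M W s ∧ h.Ok M W s := Iff.rfl
@[simp] theorem RExp.ok_sub : (g - h).Ok M W s ↔ g.Ok M W s ∧ h.Ok M W s := Iff.rfl
@[simp] theorem RExp.ok_mul : (g * h).Ok M W s ↔ g.Ok M W s ∧ h.Ok M W s := Iff.rfl
@[simp] theorem RExp.ok_div :
    (g / h).Ok M W s ↔ g.Ok M W s ∧ h.Ok M W s ∧ h.eval s ≠ 0 := Iff.rfl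
@[simp] theorem RExp.ok_reg (x : ℕ) : (RExp.reg x).Ok M W s ↔ True := Iff.rfl
@[simp] theorem RExp.ok_arr (a : ℕ) :
    (RExp.arr a e).Ok M W s ↔ e.Ok M W s ∧ e.eval s < M := Iff.rfl
@[simp] theorem RExp.cost_zero : RExp.zero.cost = 1 := rfl
@[simp] theorem RExp.cost_one : RExp.one.cost = 1 := rfl
@[simp] theorem RExp.cost_add : (g + h).cost = g.cost + h.cost + 1 := rfl
@[simp] theorem RExp.cost_sub : (g - h).cost = g.cost + h.cost + 1 := rfl
@[simp] theorem RExp.cost_mul : (g * h).cost = g.cost + h.cost + 1 := rfl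
@[simp] theorem RExp.cost_div : (g / h).cost = g.cost + h.cost + 1 := rfl
@[simp] theorem RExp.cost_reg (x : ℕ) : (RExp.reg x).cost = 1 := rfl
@[simp] theorem RExp.cost_arr (a : ℕ) : (RExp.arr a e).cost = e.cost + 1 := rfl

end Expressions

attribute [simp] BExp.Holds BExp.Ok BExp.cost

/-- The test `e < f`. -/
@[reducible] def BExp.nlt (e f : NExp) : BExp := .not (.nle f e)

/-- The test `e = f`. -/
@[reducible] def BExp.neq (e f : NExp) : BExp := .and (.nle e f) (.nle f e)

/-- Sequential composition of programs. -/
infixr:60 " ;; " => Cmd.seq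

/-! The registers, arrays and tapes that a program may change, read off its text. -/

/-- Whether the program may change integer register `y`. -/
def Cmd.wN : Cmd → ℕ → Bool
  | .skip, _ => false
  | .setN x _, y => decide (x = y)
  | .setR _ _, _ => false
  | .storeN _ _ _, _ => false
  | .storeR _ _ _, _ => false
  | .read _ _, _ => false
  | .seq c d, y => c.wN y || d.wN y
  | .ite _ c d, y => c.wN y || d.wN y
  | .loop _ c, y => c.wN y

/-- Whether the program may change real register `y`. -/
def Cmd.wR : Cmd → ℕ → Bool
  | .skip, _ => false
  | .setN _ _, _ => false
  | .setR x _, y => decide (x = y)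
  | .storeN _ _ _, _ => false
  | .storeR _ _ _, _ => false
  | .read _ x, y => decide (x = y)
  | .seq c d, y => c.wR y || d.wR y
  | .ite _ c d, y => c.wR y || d.wR y
  | .loop _ c, y => c.wR y

/-- Whether the program may change integer array `y`. -/
def Cmd.wA : Cmd → ℕ → Bool
  | .skip, _ => false
  | .setN _ _, _ => false
  | .setR _ _, _ => false
  | .storeN a _ _, y => decide (a = y)
  | .storeR _ _ _, _ => false
  | .read _ _, _ => false
  | .seq c d, y => c.wA y || d.wA y
  | .ite _ c d, y => c.wA y || d.wA y
  | .loop _ c, y => c.wA y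

/-- Whether the program may change real array `y`. -/
def Cmd.wB : Cmd → ℕ → Bool
  | .skip, _ => false
  | .setN _ _, _ => false
  | .setR _ _, _ => false
  | .storeN _ _ _, _ => false
  | .storeR a _ _, y => decide (a = y)
  | .read _ _, _ => false
  | .seq c d, y => c.wB y || d.wB y
  | .ite _ c d, y => c.wB y || d.wB y
  | .loop _ c, y => c.wB y

/-- Whether the program may read from tape `y`. -/
def Cmd.wT : Cmd → Bool → Bool
  | .skip, _ => false
  | .setN _ _, _ => false
  | .setR _ _, _ => false
  | .storeN _ _ _, _ => false
  | .storeR _ _ _, _ => false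
  | .read d _, y => decide (d = y)
  | .seq c d, y => c.wT y || d.wT y
  | .ite _ c d, y => c.wT y || d.wT y
  | .loop _ c, y => c.wT y

/-- The states `s` and `s'` agree on everything that the program `c` cannot change. -/
structure Frame (c : Cmd) (s s' : State) : Prop where
  n : ∀ y, c.wN y = false → s'.nreg y = s.nreg y
  r : ∀ y, c.wR y = false → s'.rreg y = s.rreg y
  a : ∀ y, c.wA y = false → s'.narr y = s.narr y
  b : ∀ y, c.wB y = false → s'.rarr y = s.rarr y
  t : ∀ y, c.wT y = false → s'.tape y = s.tape y

theorem Frame.refl (c : Cmd) (s : State) : Frame c s s :=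
  ⟨fun _ _ => rfl, fun _ _ => rfl, fun _ _ => rfl, fun _ _ => rfl, fun _ _ => rfl⟩

theorem Frame.trans {c : Cmd} {s s' s'' : State} (h : Frame c s s') (h' : Frame c s' s'') :
    Frame c s s'' :=
  ⟨fun y hy => (h'.n y hy).trans (h.n y hy), fun y hy => (h'.r y hy).trans (h.r y hy),
   fun y hy => (h'.a y hy).trans (h.a y hy), fun y hy => (h'.b y hy).trans (h.b y hy),
   fun y hy => (h'.t y hy).trans (h.t y hy)⟩

/-- A program whose write sets are smaller changes less. -/
theorem Frame.mono {c d : Cmd} {s s' : State} (h : Frame c s s')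
    (hn : ∀ y, d.wN y = false → c.wN y = false) (hr : ∀ y, d.wR y = false → c.wR y = false)
    (ha : ∀ y, d.wA y = false → c.wA y = false) (hb : ∀ y, d.wB y = false → c.wB y = false)
    (ht : ∀ y, d.wT y = false → c.wT y = false) : Frame d s s' :=
  ⟨fun y hy => h.n y (hn y hy), fun y hy => h.r y (hr y hy), fun y hy => h.a y (ha y hy),
   fun y hy => h.b y (hb y hy), fun y hy => h.t y (ht y hy)⟩

theorem Frame.loop {p : BExp} {c : Cmd} {s s' : State} (h : Frame c s s') :
    Frame (.loop p c) s s' :=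
  h.mono (fun _ h => h) (fun _ h => h) (fun _ h => h) (fun _ h => h) (fun _ h => h)

theorem Exec.frame {c : Cmd} {s s' : State} {t : ℕ} (h : Exec M W c s t s') :
    Frame c s s' := by
  induction h with
  | skip s => exact .refl _ _
  | setN s x e he =>
    refine ⟨fun y hy => ?_, fun _ _ => rfl, fun _ _ => rfl, fun _ _ => rfl, fun _ _ => rfl⟩
    simp only [Cmd.wN, decide_eq_false_iff_not] at hy
    exact Function.update_of_ne (Ne.symm hy) _ _
  | setR s x e he =>
    refine ⟨fun _ _ => rfl, fun y hy => ?_, fun _ _ => rfl, fun _ _ => rfl, fun _ _ => rfl⟩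
    simp only [Cmd.wR, decide_eq_false_iff_not] at hy
    exact Function.update_of_ne (Ne.symm hy) _ _
  | storeN s a i e hi hM he =>
    refine ⟨fun _ _ => rfl, fun _ _ => rfl, fun y hy => ?_, fun _ _ => rfl, fun _ _ => rfl⟩
    simp only [Cmd.wA, decide_eq_false_iff_not] at hy
    exact Function.update_of_ne (Ne.symm hy) _ _
  | storeR s a i e hi hM he =>
    refine ⟨fun _ _ => rfl, fun _ _ => rfl, fun _ _ => rfl, fun y hy => ?_, fun _ _ => rfl⟩
    simp only [Cmd.wB, decide_eq_false_iff_not] at hy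
    exact Function.update_of_ne (Ne.symm hy) _ _
  | read s d x r l h =>
    refine ⟨fun _ _ => rfl, fun y hy => ?_, fun _ _ => rfl, fun _ _ => rfl, fun y hy => ?_⟩
    · simp only [Cmd.wR, decide_eq_false_iff_not] at hy
      exact Function.update_of_ne (Ne.symm hy) _ _
    · simp only [Cmd.wT, decide_eq_false_iff_not] at hy
      exact Function.update_of_ne (Ne.symm hy) _ _
  | seq _ _ ih₁ ih₂ =>
    refine (ih₁.mono ?_ ?_ ?_ ?_ ?_).trans (ih₂.mono ?_ ?_ ?_ ?_ ?_) <;>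
      simp +contextual [Cmd.wN, Cmd.wR, Cmd.wA, Cmd.wB, Cmd.wT]
  | iteTrue _ _ _ ih =>
    refine ih.mono ?_ ?_ ?_ ?_ ?_ <;>
      simp +contextual [Cmd.wN, Cmd.wR, Cmd.wA, Cmd.wB, Cmd.wT]
  | iteFalse _ _ _ ih =>
    refine ih.mono ?_ ?_ ?_ ?_ ?_ <;>
      simp +contextual [Cmd.wN, Cmd.wR, Cmd.wA, Cmd.wB, Cmd.wT]
  | loopTrue _ _ _ _ ih₁ ih₂ => exact (ih₁.loop).trans ih₂
  | loopFalse _ _ => exact .refl _ _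

/-- Started in `s`, program `c` halts within the memory and word limits, after a time and in a
state that satisfy `Q`. -/
def Runs (M W : ℕ) (c : Cmd) (s : State) (Q : ℕ → State → Prop) : Prop :=
  ∃ t s', Exec M W c s t s' ∧ Q t s'

section Rules

variable {s : State} {Q : ℕ → State → Prop}

theorem Runs.mono {c : Cmd} {Q' : ℕ → State → Prop} (h : Runs M W c s Q)
    (hQ : ∀ t s', Frame c s s' → Q t s' → Q' t s') : Runs M W c s Q' := by
  obtain ⟨t, s', h, hq⟩ := h
  exact ⟨t, s', h, hQ t s' h.frame hq⟩

@[simp] theorem runs_skip : Runs M W .skip s Q ↔ Q 1 s :=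
  ⟨fun ⟨_, _, h, hq⟩ => by cases h; exact hq, fun h => ⟨_, _, .skip s, h⟩⟩

@[simp] theorem runs_setN {x : ℕ} {e : NExp} :
    Runs M W (.setN x e) s Q ↔ e.Ok M W s ∧ Q (e.cost + 1) (s.setN x (e.eval s)) :=
  ⟨fun ⟨_, _, h, hq⟩ => by cases h; exact ⟨‹_›, hq⟩, fun h => ⟨_, _, .setN s x e h.1, h.2⟩⟩

@[simp] theorem runs_setR {x : ℕ} {e : RExp} :
    Runs M W (.setR x e) s Q ↔ e.Ok M W s ∧ Q (e.cost + 1) (s.setR x (e.eval s)) :=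
  ⟨fun ⟨_, _, h, hq⟩ => by cases h; exact ⟨‹_›, hq⟩, fun h => ⟨_, _, .setR s x e h.1, h.2⟩⟩

@[simp] theorem runs_storeN {a : ℕ} {i e : NExp} :
    Runs M W (.storeN a i e) s Q ↔ (i.Ok M W s ∧ i.eval s < M ∧ e.Ok M W s) ∧
      Q (i.cost + e.cost + 1) (s.storeN a (i.eval s) (e.eval s)) :=
  ⟨fun ⟨_, _, h, hq⟩ => by cases h; exact ⟨⟨‹_›, ‹_›, ‹_›⟩, hq⟩,
   fun h => ⟨_, _, .storeN s a i e h.1.1 h.1.2.1 h.1.2.2, h.2⟩⟩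

@[simp] theorem runs_storeR {a : ℕ} {i : NExp} {e : RExp} :
    Runs M W (.storeR a i e) s Q ↔ (i.Ok M W s ∧ i.eval s < M ∧ e.Ok M W s) ∧
      Q (i.cost + e.cost + 1) (s.storeR a (i.eval s) (e.eval s)) :=
  ⟨fun ⟨_, _, h, hq⟩ => by cases h; exact ⟨⟨‹_›, ‹_›, ‹_›⟩, hq⟩,
   fun h => ⟨_, _, .storeR s a i e h.1.1 h.1.2.1 h.1.2.2, h.2⟩⟩

theorem Runs.read {d : Bool} {x : ℕ} {r : ℝ} {l : List ℝ} (h : s.tape d = r :: l)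
    (hQ : Q 1 ((s.setR x r).setTape d l)) : Runs M W (.read d x) s Q :=
  ⟨_, _, .read s d x r l h, hQ⟩

@[simp] theorem runs_seq {c d : Cmd} :
    Runs M W (c ;; d) s Q ↔
      Runs M W c s fun t s' => Runs M W d s' fun t' s'' => Q (t + t') s'' :=
  ⟨fun ⟨_, _, h, hq⟩ => by
    cases h with
    | seq h₁ h₂ => exact ⟨_, _, h₁, _, _, h₂, hq⟩,
   fun ⟨_, _, h₁, _, _, h₂, hq⟩ => ⟨_, _, .seq h₁ h₂, hq⟩⟩

theorem Runs.ite {p : BExp} {c d : Cmd} (hp : p.Ok M W s)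
    (ht : p.Holds s → Runs M W c s fun t s' => Q (p.cost + 1 + t) s')
    (hf : ¬ p.Holds s → Runs M W d s fun t s' => Q (p.cost + 1 + t) s') :
    Runs M W (.ite p c d) s Q := by
  by_cases h : p.Holds s
  · obtain ⟨t, s', h₁, hq⟩ := ht h
    exact ⟨_, _, .iteTrue hp h h₁, hq⟩
  · obtain ⟨t, s', h₁, hq⟩ := hf h
    exact ⟨_, _, .iteFalse hp h h₁, hq⟩

/-- The rule for loops: `I` is an invariant, and the potential `Φ` pays for the iterations. -/
theorem Runs.loop {p : BExp} {c : Cmd} (I : State → Prop) (Φ : State → ℕ) (h0 : I s)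
    (hI : ∀ s', Frame (.loop p c) s s' → I s' → p.Ok M W s' ∧ (p.Holds s' →
      Runs M W c s' fun t s'' => I s'' ∧ p.cost + 1 + t + Φ s'' ≤ Φ s')) :
    Runs M W (.loop p c) s fun t s' =>
      I s' ∧ ¬ p.Holds s' ∧ t + Φ s' ≤ Φ s + p.cost + 1 ∧ Frame (.loop p c) s s' := by
  have key : ∀ N s', Φ s' ≤ N → Frame (.loop p c) s s' → I s' →
      Runs M W (.loop p c) s' fun t s'' =>
        I s'' ∧ ¬ p.Holds s'' ∧ t + Φ s'' ≤ Φ s' + p.cost + 1 ∧ Frame (.loop p c) s s'' := by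
    intro N
    induction N with
    | zero =>
      intro s' hN hF h
      obtain ⟨hp, hb⟩ := hI s' hF h
      by_cases hh : p.Holds s'
      · obtain ⟨t, s'', -, -, hle⟩ := hb hh
        omega
      · exact ⟨_, _, .loopFalse hp hh, h, hh, by omega, hF⟩
    | succ N ih =>
      intro s' hN hF h
      obtain ⟨hp, hb⟩ := hI s' hF h
      by_cases hh : p.Holds s'
      · obtain ⟨t, s'', he, hi, hle⟩ := hb hh
        obtain ⟨t', s₃, he', hi', hn', hle', hF'⟩ :=
          ih s'' (by omega) (hF.trans he.frame.loop) hi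
        exact ⟨_, _, .loopTrue hp hh he he', hi', hn', by omega, hF'⟩
      · exact ⟨_, _, .loopFalse hp hh, h, hh, by omega, hF⟩
  exact key _ _ le_rfl (.refl _ _) h0

/-- `for x = 0, …, l - 1 do c`, with the bound in integer register `l`. -/
def Cmd.forN (x l : ℕ) (c : Cmd) : Cmd :=
  .setN x (.lit 0) ;; .loop (.nlt (.reg x) (.reg l)) (c ;; .setN x (.reg x + .lit 1))

/-- The rule for counted loops: `I k` holds before the round with number `k`, and this round
takes at most `f k` steps. -/
theorem Runs.forN {x l n : ℕ} {c : Cmd} (f : ℕ → ℕ) (I : ℕ → State → Prop) (hxl : l ≠ x)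
    (hcx : c.wN x = false) (hcl : c.wN l = false) (hn : s.nreg l = n) (hW : n ≤ W) (hW1 : 1 ≤ W)
    (h0 : I 0 (s.setN x 0))
    (hI : ∀ k s', k < n → s'.nreg x = k → s'.nreg l = n → Frame (.forN x l c) s s' → I k s' →
      Runs M W c s' fun t s'' => t ≤ f k ∧ I (k + 1) (s''.setN x (k + 1))) :
    Runs M W (.forN x l c) s fun t s' =>
      t ≤ ∑ k ∈ Finset.range n, (f k + 9) + 7 ∧ I n s' := by
  have hmono : ∀ {s₁ s₂ : State}, Frame (.loop (.nlt (.reg x) (.reg l)) (c ;; .setN x (.reg x + .lit 1)))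
      s₁ s₂ → Frame (.forN x l c) s₁ s₂ := fun h => by
    refine h.mono ?_ ?_ ?_ ?_ ?_ <;>
      simp +contextual [Cmd.forN, Cmd.wN, Cmd.wR, Cmd.wA, Cmd.wB, Cmd.wT]
  have h00 : Frame (.forN x l c) s (s.setN x 0) := by
    refine ⟨fun y hy => ?_, fun _ _ => rfl, fun _ _ => rfl, fun _ _ => rfl, fun _ _ => rfl⟩
    simp only [Cmd.forN, Cmd.wN, Bool.or_eq_false_iff, decide_eq_false_iff_not] at hy
    simp [Ne.symm hy.1]
  unfold Cmd.forN
  simp only [runs_seq, runs_setN]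
  refine ⟨by simp, Runs.mono (Runs.loop (I := fun s' => s'.nreg x ≤ n ∧ s'.nreg l = n ∧
    I (s'.nreg x) s') (Φ := fun s' => ∑ k ∈ Finset.Ico (s'.nreg x) n, (f k + 9)) ?_ ?_) ?_⟩
  · simpa [hxl, hn] using h0
  · rintro s' hF ⟨hx, hl, hi⟩
    refine ⟨by simp, fun hp => ?_⟩
    simp only [BExp.Holds, NExp.eval_reg, not_le, hl] at hp
    simp only [runs_seq, runs_setN]
    refine (hI _ s' hp rfl hl (h00.trans (hmono hF)) hi).mono ?_
    rintro t s'' hF'' ⟨ht, hi''⟩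
    have hx'' : s''.nreg x = s'.nreg x := hF''.n _ hcx
    have hl'' : s''.nreg l = s'.nreg l := hF''.n _ hcl
    simp only [NExp.ok_add, NExp.ok_reg, NExp.eval_reg, NExp.eval_add, NExp.eval_lit,
      NExp.ok_lit, hx'', State.nreg_setN, if_true, hxl, if_false, hl'', hl,
      NExp.cost_add, NExp.cost_reg, NExp.cost_lit, BExp.cost]
    rw [Finset.sum_eq_sum_Ico_succ_bot hp]
    exact ⟨⟨trivial, by omega, by omega⟩, ⟨by omega, trivial, hi''⟩, by omega⟩
  · rintro t s' - ⟨⟨hx, hl, hi⟩, hp, ht, hF⟩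
    simp only [BExp.Holds, NExp.eval_reg, not_le, hl, not_lt] at hp
    have hxn : s'.nreg x = n := le_antisymm hx hp
    rw [hxn] at hi
    refine ⟨?_, hi⟩
    simp only [hxn, Finset.Ico_self, Finset.sum_empty, State.nreg_setN, if_true, NExp.eval_lit,
      BExp.cost, NExp.cost_reg, NExp.cost_lit] at ht ⊢
    rw [Finset.range_eq_Ico]
    omega

end Rules

end RealRAM

/-! ### Bucket sort -/

namespace RealRAM

variable {M W : ℕ}

/-! Names of the integer registers: `rN` holds the size `n` of the matrices, `rD` the parameter `D`,
`rE` the number of counters, and `rP` the prime number of the hash functions. The others hold loop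
variables and intermediate results. -/

notation "rN" => (2 : ℕ)
notation "rD" => (3 : ℕ)
notation "rP" => (4 : ℕ)
notation "rE" => (5 : ℕ)
notation "rK" => (6 : ℕ)
notation "rI" => (7 : ℕ)
notation "rC" => (8 : ℕ)
notation "rTh" => (9 : ℕ)
notation "rPh" => (10 : ℕ)
notation "rF" => (11 : ℕ)
notation "rG" => (12 : ℕ)
notation "rM" => (13 : ℕ)
notation "rX" => (14 : ℕ)
notation "rJ" => (15 : ℕ)
notation "rY" => (16 : ℕ)
notation "rT" => (17 : ℕ)
notation "rQ" => (18 : ℕ)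
notation "rL" => (19 : ℕ)
notation "rS" => (20 : ℕ)
notation "rA" => (21 : ℕ)
notation "rH" => (22 : ℕ)
notation "rB" => (23 : ℕ)
notation "rU" => (24 : ℕ)

/-! Names of the integer arrays: `aRow`, `aCol`, `aVal` hold the positions and the values of the
counters, `aA`, `aB` the quantized vectors, `aKey`, `aHead`, `aNext`, `aOrd` belong to the bucket
sort, `aPos` to the merging of counters, `aGid` gives the groups of the counters in the dictionary,
`aMul`, `aMod`, `aBase` describe its hash tables, `aCnt` counts collisions, and `aLink` leads from
the cells to the counters. -/

notation "aA" => (0 : ℕ)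
notation "aB" => (1 : ℕ)
notation "aRow" => (2 : ℕ)
notation "aCol" => (3 : ℕ)
notation "aVal" => (4 : ℕ)
notation "aKey" => (5 : ℕ)
notation "aHead" => (6 : ℕ)
notation "aNext" => (7 : ℕ)
notation "aOrd" => (8 : ℕ)
notation "aPos" => (9 : ℕ)
notation "aGid" => (10 : ℕ)
notation "aMul" => (11 : ℕ)
notation "aMod" => (12 : ℕ)
notation "aBase" => (13 : ℕ)
notation "aCnt" => (14 : ℕ)
notation "aLink" => (15 : ℕ)

/-- The numbers `ord 0, …, ord (F - 1)` are a permutation of the positions below `F` along which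
`key` is nondecreasing. -/
structure IsSorting (F : ℕ) (key ord : ℕ → ℕ) : Prop where
  lt : ∀ x, x < F → ord x < F
  inj : ∀ x y, x < F → y < F → ord x = ord y → x = y
  mono : ∀ x y, x ≤ y → y < F → key (ord x) ≤ key (ord y)

theorem IsSorting.surj {F : ℕ} {key ord : ℕ → ℕ} (h : IsSorting F key ord) {z : ℕ} (hz : z < F) :
    ∃ x < F, ord x = z := by
  have : Finset.image ord (Finset.range F) = Finset.range F := by
    apply Finset.eq_of_subset_of_card_le
    · intro y hy
      obtain ⟨x, hx, rfl⟩ := Finset.mem_image.1 hy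
      exact Finset.mem_range.2 (h.lt x (Finset.mem_range.1 hx))
    · rw [Finset.card_image_of_injOn]
      intro x hx y hy hxy
      exact h.inj x y (by simpa using hx) (by simpa using hy) hxy
  have hz' := Finset.mem_range.2 hz
  rw [← this] at hz'
  obtain ⟨x, hx, rfl⟩ := Finset.mem_image.1 hz'
  exact ⟨x, Finset.mem_range.1 hx, rfl⟩

/-- The linked list that starts at `h` (the number `x + 1` points to `x`, and `0` is the null
pointer) consists of the cells in the list. -/
def Chain (next : ℕ → ℕ) : ℕ → List ℕ → Prop
  | h, [] => h = 0
  | h, x :: L => h = x + 1 ∧ Chain next (next x) L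

theorem Chain.update {next : ℕ → ℕ} {x v : ℕ} : ∀ {L : List ℕ} {h : ℕ}, x ∉ L → Chain next h L →
    Chain (Function.update next x v) h L
  | [], _, _, hc => hc
  | y :: L, h, hx, hc => by
    simp only [List.mem_cons, not_or] at hx
    refine ⟨hc.1, ?_⟩
    rw [Function.update_of_ne (Ne.symm hx.1)]
    exact hc.2.update hx.2

/-- The positions below `k` with key `g`, in decreasing order. -/
def bucket (key : ℕ → ℕ) : ℕ → ℕ → List ℕ
  | 0, _ => []
  | k + 1, g => if key k = g then k :: bucket key k g else bucket key k g

theorem mem_bucket {key : ℕ → ℕ} {k g x : ℕ} : x ∈ bucket key k g ↔ x < k ∧ key x = g := by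
  induction k with
  | zero => simp [bucket]
  | succ k ih =>
    unfold bucket
    by_cases hg : key k = g
    · rw [if_pos hg, List.mem_cons, ih]
      constructor
      · rintro (rfl | h)
        · exact ⟨by omega, hg⟩
        · exact ⟨by omega, h.2⟩
      · rintro ⟨h, h'⟩
        rcases Nat.lt_succ_iff_lt_or_eq.1 h with h | rfl
        · exact Or.inr ⟨h, h'⟩
        · exact Or.inl rfl
    · rw [if_neg hg, ih]
      constructor
      · rintro h
        exact ⟨by omega, h.2⟩
      · rintro ⟨h, h'⟩
        rcases Nat.lt_succ_iff_lt_or_eq.1 h with h | rfl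
        · exact ⟨h, h'⟩
        · exact absurd h' hg

theorem nodup_bucket (key : ℕ → ℕ) (k g : ℕ) : (bucket key k g).Nodup := by
  induction k with
  | zero => simp [bucket]
  | succ k ih =>
    unfold bucket
    split_ifs
    · refine List.nodup_cons.2 ⟨fun h => ?_, ih⟩
      exact absurd (mem_bucket.1 h).1 (lt_irrefl _)
    · exact ih

/-- The buckets with numbers `j, …, G - 1`, one after the other. -/
def bucketsFrom (key : ℕ → ℕ) (F G j : ℕ) : List ℕ :=
  (List.range' j (G - j)).flatMap (bucket key F)

theorem bucketsFrom_of_le {key : ℕ → ℕ} {F G j : ℕ} (hkey : ∀ x < F, key x < G) (hj : j ≤ G) :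
    bucketsFrom key F G j = bucket key F j ++ bucketsFrom key F G (j + 1) := by
  rcases hj.lt_or_eq with hj | rfl
  · unfold bucketsFrom
    obtain ⟨d, hd⟩ : ∃ d, G - j = d + 1 := ⟨G - j - 1, by omega⟩
    have hd' : G - (j + 1) = d := by omega
    rw [hd, hd', List.range'_succ, List.flatMap_cons]
  · have : bucket key F j = [] := by
      rw [List.eq_nil_iff_forall_not_mem]
      intro x hx
      obtain ⟨h, h'⟩ := mem_bucket.1 hx
      have := hkey x h
      omega
    simp [bucketsFrom, this]

theorem mem_bucketsFrom {key : ℕ → ℕ} {F G x : ℕ} (hkey : ∀ x < F, key x < G) :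
    x ∈ bucketsFrom key F G 0 ↔ x < F := by
  simp only [bucketsFrom, List.mem_flatMap, List.mem_range'_1, mem_bucket]
  constructor
  · rintro ⟨_, _, h, _⟩
    exact h
  · intro h
    exact ⟨key x, ⟨by omega, by have := hkey x h; omega⟩, h, rfl⟩

theorem nodup_bucketsFrom (key : ℕ → ℕ) (F G : ℕ) : (bucketsFrom key F G 0).Nodup := by
  unfold bucketsFrom
  rw [List.nodup_flatMap]
  refine ⟨fun g _ => nodup_bucket _ _ _, ?_⟩
  refine (List.nodup_range' (step := 1)).imp ?_
  intro g g' hg x hx hx'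
  exact hg ((mem_bucket.1 hx).2.symm.trans (mem_bucket.1 hx').2)

theorem length_bucketsFrom {key : ℕ → ℕ} {F G : ℕ} (hkey : ∀ x < F, key x < G) :
    (bucketsFrom key F G 0).length = F := by
  have : (bucketsFrom key F G 0).Perm (List.range F) :=
    (List.perm_ext_iff_of_nodup (nodup_bucketsFrom _ _ _) List.nodup_range).2 fun x => by
      rw [mem_bucketsFrom hkey, List.mem_range]
  rw [this.length_eq, List.length_range]

theorem isSorting_of_map_eq {key ord : ℕ → ℕ} {F G m : ℕ} (hkey : ∀ x < F, key x < G)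
    (h : (List.range m).map ord = bucketsFrom key F G 0) : IsSorting F key ord := by
  have hm : m = F := by
    have := congrArg List.length h
    rwa [length_bucketsFrom hkey, List.length_map, List.length_range] at this
  subst hm
  refine ⟨fun x hx => ?_, fun x y hx hy hxy => ?_, fun x y hxy hy => ?_⟩
  · rw [← mem_bucketsFrom hkey, ← h]
    exact List.mem_map.2 ⟨x, List.mem_range.2 hx, rfl⟩
  · have hn := nodup_bucketsFrom key m G
    rw [← h] at hn
    exact List.inj_on_of_nodup_map hn (List.mem_range.2 hx) (List.mem_range.2 hy) hxy
  · have hp : (bucketsFrom key m G 0).Pairwise fun x y => key x ≤ key y := by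
      unfold bucketsFrom
      rw [List.pairwise_flatMap]
      constructor
      · intro g _
        refine List.Pairwise.imp_of_mem (R := fun _ _ => True) ?_
          (List.pairwise_of_forall (fun _ _ => trivial))
        intro x y hx hy _
        rw [(mem_bucket.1 hx).2, (mem_bucket.1 hy).2]
      · refine (List.pairwise_lt_range' (step := 1)).imp ?_
        intro g g' hg x hx y hy
        rw [(mem_bucket.1 hx).2, (mem_bucket.1 hy).2]
        exact hg.le
    rw [← h, List.pairwise_map] at hp
    rcases hxy.lt_or_eq with hlt | rfl
    · have := List.pairwise_iff_getElem.1 hp x y (by simp; omega) (by simpa using hy) hlt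
      simpa using this
    · exact le_rfl

/-- Sorts the positions below `rF` by the keys in array `a`, which are below `rG`, into the array
`aOrd`: the positions are pushed onto one linked list for each key, and then the lists are emptied
in the order of the keys. -/
def bucketSort (a : ℕ) : Cmd :=
  .forN rX rF (.storeN aNext (.reg rX) (.arr aHead (.arr a (.reg rX))) ;;
    .storeN aHead (.arr a (.reg rX)) (.reg rX + .lit 1)) ;;
  .setN rJ (.lit 0) ;; .setN rM (.lit 0) ;;
  .loop (.nlt (.reg rJ) (.reg rG))
    (.ite (.nle (.arr aHead (.reg rJ)) (.lit 0)) (.setN rJ (.reg rJ + .lit 1))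
      (.setN rX (.arr aHead (.reg rJ) - .lit 1) ;; .storeN aOrd (.reg rM) (.reg rX) ;;
        .setN rM (.reg rM + .lit 1) ;; .storeN aHead (.reg rJ) (.arr aNext (.reg rX))))

theorem runs_bucketSort {a F G : ℕ} {s : State} (ha6 : a ≠ aHead) (ha7 : a ≠ aNext)
    (hF : s.nreg rF = F) (hG : s.nreg rG = G) (hFM : F ≤ M) (hGM : G ≤ M)
    (hFW : F ≤ W) (hGW : G ≤ W) (hW : 1 ≤ W) (hkey : ∀ x < F, s.narr a x < G)
    (hhead : ∀ g, s.narr aHead g = 0) :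
    Runs M W (bucketSort a) s fun t s' => t ≤ 60 * (F + G) + 30 ∧
      IsSorting F (s.narr a) (s'.narr aOrd) ∧ ∀ g, s'.narr aHead g = 0 := by
  set key := s.narr a with hkeydef
  unfold bucketSort
  rw [runs_seq]
  refine (Runs.forN (n := F) (f := fun _ => 20) (I := fun k s' =>
    ∀ g, Chain (s'.narr aNext) (s'.narr aHead g) (bucket key k g))
    (by decide) rfl rfl hF (by omega) (by omega) ?_ ?_).mono ?_
  · intro g
    simpa [Chain, bucket] using hhead g
  · intro k s₁ hk hX hFF hfr hI
    have hak : s₁.narr a k = key k := by rw [hfr.a a ?_]; simp [Cmd.forN, Cmd.wA, ha6.symm, ha7.symm]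
    simp only [runs_seq, runs_storeN]
    simp [hX, hak, ha7]
    have := hkey k hk
    refine ⟨by omega, by omega, fun g => ?_⟩
    have hnot : ∀ g, k ∉ bucket key k g := fun g h => by
      have := (mem_bucket.1 h).1
      omega
    rw [bucket]
    by_cases hg : key k = g
    · subst hg
      rw [if_pos rfl, Function.update_self]
      refine ⟨rfl, ?_⟩
      rw [Function.update_self]
      exact (hI _).update (hnot _)
    · rw [if_neg hg, Function.update_of_ne (Ne.symm hg)]
      exact (hI _).update (hnot _)
  rintro t₁ s₁ hfr ⟨ht₁, hch⟩
  have hG₁ : s₁.nreg rG = G := by rw [hfr.n _ rfl, hG]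
  simp only [runs_seq, runs_setN]
  refine ⟨by simp, by simp, (Runs.loop (I := fun s' => s'.nreg rJ ≤ G ∧
    (∀ g < s'.nreg rJ, s'.narr aHead g = 0) ∧
    (∀ g, s'.nreg rJ < g → Chain (s'.narr aNext) (s'.narr aHead g) (bucket key F g)) ∧
    ∃ L, L <:+ bucket key F (s'.nreg rJ) ∧
      Chain (s'.narr aNext) (s'.narr aHead (s'.nreg rJ)) L ∧
      (List.range (s'.nreg rM)).map (s'.narr aOrd) ++ L ++
        bucketsFrom key F G (s'.nreg rJ + 1) = bucketsFrom key F G 0)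
    (Φ := fun s' => 30 * ((F - s'.nreg rM) + (G - s'.nreg rJ))) ?_ ?_).mono ?_⟩
  · refine ⟨by simp, by simp, fun g _ => by simpa using hch g, bucket key F 0, by simp,
      by simpa using hch 0, ?_⟩
    simpa using (bucketsFrom_of_le hkey (Nat.zero_le G)).symm
  · rintro s₂ hfr₂ ⟨hJ, hz, hrest, L, hL, hLc, hO⟩
    have hG₂ : s₂.nreg rG = G := by
      rw [hfr₂.n _ rfl]
      simpa using hG₁
    refine ⟨by simp, fun hp => ?_⟩
    simp [hG₂] at hp
    refine Runs.ite (by simp; omega) (fun h => ?_) (fun h => ?_)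
    · simp at h
      rw [h] at hLc
      obtain rfl : L = [] := by
        cases L with
        | nil => rfl
        | cons x L => exact absurd hLc.1 (by simp)
      simp
      refine ⟨⟨by omega, by omega⟩, ⟨by omega, fun g hg => ?_, fun g hg => hrest g (by omega),
        bucket key F (s₂.nreg rJ + 1), by simp, hrest _ (by omega), ?_⟩, by omega⟩
      · rcases Nat.le_iff_lt_or_eq.1 hg with hg | rfl
        · exact hz g hg
        · exact h
      · rw [← hO, List.append_assoc, ← bucketsFrom_of_le hkey hp]
        simp
    · simp at h
      obtain ⟨x, L', rfl⟩ : ∃ x L', L = x :: L' := by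
        cases L with
        | nil => exact absurd hLc h
        | cons x L => exact ⟨x, L, rfl⟩
      obtain ⟨hx, hLc'⟩ := hLc
      have hxF : x < F := (mem_bucket.1 (hL.subset (List.mem_cons_self))).1
      have hmF : s₂.nreg rM < F := by
        have := congrArg List.length hO
        rw [length_bucketsFrom hkey] at this
        simp at this
        omega
      simp [hx]
      refine ⟨⟨by omega, by omega⟩, by omega, by omega, ⟨by omega, by omega⟩, ⟨by omega,
        fun g hg => ?_, fun g hg => ?_, L', ?_, hLc', ?_⟩, by omega⟩
      · rw [Function.update_of_ne (by omega)]
        exact hz g hg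
      · rw [Function.update_of_ne (by omega)]
        exact hrest g hg
      · exact (List.suffix_cons _ _).trans hL
      · rw [← hO, List.range_succ, List.map_append]
        have : List.map (Function.update (s₂.narr aOrd) (s₂.nreg rM) x) (List.range (s₂.nreg rM))
            = List.map (s₂.narr aOrd) (List.range (s₂.nreg rM)) := by
          apply List.map_congr_left
          intro y hy
          rw [Function.update_of_ne]
          have := List.mem_range.1 hy
          omega
        rw [this]
        simp
  · rintro t₂ s₂ hfr₂ ⟨⟨hJ, hz, hrest, L, hL, hLc, hO⟩, hp, ht₂, -⟩
    have hG₂ : s₂.nreg rG = G := by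
      rw [hfr₂.n _ rfl]
      simpa using hG₁
    simp [hG₂] at hp
    have hJG : s₂.nreg rJ = G := le_antisymm hJ hp
    have hLnil : L = [] := by
      rw [List.eq_nil_iff_forall_not_mem]
      intro x hx
      obtain ⟨h, h'⟩ := mem_bucket.1 (hL.subset hx)
      have := hkey x h
      omega
    subst hLnil
    have hrest' : bucketsFrom key F G (G + 1) = [] := by simp [bucketsFrom]
    rw [hJG, hrest', List.append_nil, List.append_nil] at hO
    refine ⟨?_, isSorting_of_map_eq hkey hO, fun g => ?_⟩
    · simp at ht₁ ht₂ ⊢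
      omega
    · rcases lt_trichotomy g G with hg | rfl | hg
      · exact hz g (by omega)
      · rw [← hJG]
        exact hLc
      · have := hrest g (by omega)
        have hnil : bucket key F g = [] := by
          rw [List.eq_nil_iff_forall_not_mem]
          intro x hx
          obtain ⟨h, h'⟩ := mem_bucket.1 hx
          have := hkey x h
          omega
        rw [hnil] at this
        exact this

end RealRAM

/-! ### Reading and quantizing vectors -/

namespace RealRAM

variable {M W : ℕ}

/-! Names of the real registers and arrays: `fN` holds the mass of the processed outer products, `fM`
this mass with the next one included, `fA` and `fB` the sums of the two vectors in the arrays `bA`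
and `bB`, and `bT` is the table with `bT x = x`. Register `0` is reserved for the answers. -/

notation "fA" => (1 : ℕ)
notation "fB" => (2 : ℕ)
notation "fN" => (3 : ℕ)
notation "fY" => (4 : ℕ)
notation "fM" => (5 : ℕ)
notation "bA" => (0 : ℕ)
notation "bB" => (1 : ℕ)
notation "bT" => (2 : ℕ)

/-- Splits the nonnegative number in `fY` into its integer part, put into `rC`, and its fractional
part, left in `fY`. -/
def floorCmd : Cmd :=
  .setN rC (.lit 0) ;;
  .loop (.rle .one (.reg fY)) (.setR fY (.reg fY - .one) ;; .setN rC (.reg rC + .lit 1))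

theorem runs_floorCmd {s : State} {y : ℝ} (hy : s.rreg fY = y) (hy0 : 0 ≤ y) (hW1 : 1 ≤ W)
    (hW : ⌊y⌋₊ ≤ W) :
    Runs M W floorCmd s fun t s' => t ≤ 12 * ⌊y⌋₊ + 6 ∧ s'.nreg rC = ⌊y⌋₊ ∧
      s'.rreg fY = y - ⌊y⌋₊ := by
  unfold floorCmd
  simp only [runs_seq, runs_setN]
  refine ⟨by simp, (Runs.loop (I := fun s' => s'.nreg rC + s'.rreg fY = y ∧ 0 ≤ s'.rreg fY)
    (Φ := fun s' => 12 * ⌊s'.rreg fY⌋₊) ?_ ?_).mono ?_⟩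
  · simp [hy, hy0]
  · rintro s₁ - ⟨hsum, h0⟩
    refine ⟨by simp, fun hp => ?_⟩
    simp only [BExp.Holds, RExp.eval_one, RExp.eval_reg] at hp
    have hfl : ⌊s₁.rreg fY⌋₊ = ⌊s₁.rreg fY - 1⌋₊ + 1 := by
      have := Nat.floor_pos.2 hp
      rw [Nat.floor_sub_one]
      omega
    have hc : s₁.nreg rC + 1 ≤ ⌊y⌋₊ := by
      apply Nat.le_floor
      push_cast
      linarith
    simp
    refine ⟨by omega, ⟨by linarith, by linarith⟩, by omega⟩
  · rintro t s₁ - ⟨⟨hsum, h0⟩, hp, ht, -⟩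
    simp only [BExp.Holds, RExp.eval_one, RExp.eval_reg, not_le] at hp
    have hc : ⌊y⌋₊ = s₁.nreg rC := by
      rw [Nat.floor_eq_iff hy0]
      constructor <;> linarith
    refine ⟨?_, hc.symm, ?_⟩
    · simp [hy] at ht ⊢
      omega
    · rw [hc]
      linarith

/-- Moves the next `rN` numbers of tape `d` into the real array `a`, and their sum into the real
register `x`. -/
def loadVector (d : Bool) (a x : ℕ) : Cmd :=
  .setR x .zero ;;
  .forN rI rN (.read d fY ;; .storeR a (.reg rI) (.reg fY) ;; .setR x (.reg x + .reg fY))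

theorem runs_loadVector {d : Bool} {a x n : ℕ} {s : State} {f : ℕ → ℝ} {rest : List ℝ}
    (hx : x ≠ fY) (hn : s.nreg rN = n) (htape : s.tape d = (List.range n).map f ++ rest)
    (hM : n ≤ M) (hW : n ≤ W) (hW1 : 1 ≤ W) :
    Runs M W (loadVector d a x) s fun t s' => t ≤ 30 * n + 20 ∧ (∀ i < n, s'.rarr a i = f i) ∧
      s'.rreg x = ∑ i ∈ Finset.range n, f i ∧ s'.tape d = rest := by
  unfold loadVector
  simp only [runs_seq, runs_setR]
  refine ⟨by simp, (Runs.forN (n := n) (f := fun _ => 20) (I := fun k s' =>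
    (∀ i < k, s'.rarr a i = f i) ∧ s'.rreg x = ∑ i ∈ Finset.range k, f i ∧
      s'.tape d = (List.range' k (n - k)).map f ++ rest)
    (by decide) rfl rfl (by simpa using hn) hW hW1 ?_ ?_).mono ?_⟩
  · simp [htape, List.range_eq_range']
  · rintro k s₁ hk hI - hfr ⟨harr, hsum, ht⟩
    obtain ⟨m, hm⟩ : ∃ m, n - k = m + 1 := ⟨n - k - 1, by omega⟩
    have hm' : n - (k + 1) = m := by omega
    rw [hm, List.range'_succ, List.map_cons, List.cons_append] at ht
    rw [runs_seq]
    refine Runs.read ht ?_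
    simp [hI, hx]
    refine ⟨by omega, fun i hi => ?_, ?_, ?_⟩
    · rcases Nat.lt_succ_iff_lt_or_eq.1 (Nat.lt_succ_of_le hi) with hi | rfl
      · rw [Function.update_of_ne (by omega)]
        exact harr i hi
      · simp
    · rw [Finset.sum_range_succ, hsum]
    · rw [hm']
  · rintro t s₁ - ⟨ht, harr, hsum, htp⟩
    refine ⟨?_, harr, hsum, by simpa using htp⟩
    simp at ht ⊢
    omega

/-- Divides the vector in the real array `a` by the number in real register `x`, multiplies by
`rD`, rounds down to integers, and puts the result into integer array `o`. -/
def quantize (a x o : ℕ) : Cmd :=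
  .forN rI rN (.setR fY (.arr a (.reg rI) * .arr bT (.reg rD) / .reg x) ;; floorCmd ;;
    .storeN o (.reg rI) (.reg rC))

/-- The integer part of `f i * D / (∑ i, f i)`. -/
noncomputable def quant (n D : ℕ) (f : ℕ → ℝ) (i : ℕ) : ℕ :=
  ⌊f i * D / ∑ i ∈ Finset.range n, f i⌋₊

theorem sum_quant_le {n D : ℕ} {f : ℕ → ℝ} (hf : ∀ i < n, 0 ≤ f i)
    (hpos : 0 < ∑ i ∈ Finset.range n, f i) : ∑ i ∈ Finset.range n, quant n D f i ≤ D := by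
  have h : ((∑ i ∈ Finset.range n, quant n D f i : ℕ) : ℝ) ≤ D := by
    push_cast
    calc ∑ i ∈ Finset.range n, (quant n D f i : ℝ)
        ≤ ∑ i ∈ Finset.range n, f i * D / ∑ i ∈ Finset.range n, f i := by
          refine Finset.sum_le_sum fun i hi => Nat.floor_le ?_
          have := hf i (Finset.mem_range.1 hi)
          positivity
      _ = D := by
          rw [← Finset.sum_div, ← Finset.sum_mul]
          field_simp
  exact_mod_cast h

theorem quant_le {n D i : ℕ} {f : ℕ → ℝ} (hf : ∀ i < n, 0 ≤ f i)
    (hpos : 0 < ∑ i ∈ Finset.range n, f i) (hi : i < n) : quant n D f i ≤ D :=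
  (Finset.single_le_sum (f := quant n D f) (fun _ _ => Nat.zero_le _)
    (Finset.mem_range.2 hi)).trans (sum_quant_le hf hpos)

theorem runs_quantize {a x o n D : ℕ} {s : State} {f : ℕ → ℝ} (hx : x ≠ fY)
    (hn : s.nreg rN = n) (hD : s.nreg rD = D) (hT : s.rarr bT D = D)
    (hf : ∀ i < n, 0 ≤ f i) (hpos : 0 < ∑ i ∈ Finset.range n, f i)
    (hsa : ∀ i < n, s.rarr a i = f i) (hsx : s.rreg x = ∑ i ∈ Finset.range n, f i)
    (hM : n ≤ M) (hMD : D < M) (hW : n ≤ W) (hDW : D ≤ W) (hW1 : 1 ≤ W) :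
    Runs M W (quantize a x o) s fun t s' => t ≤ 12 * D + 60 * n + 10 ∧
      ∀ i < n, s'.narr o i = quant n D f i := by
  unfold quantize
  refine (Runs.forN (n := n) (f := fun i => 12 * quant n D f i + 40) (I := fun k s' =>
    ∀ i < k, s'.narr o i = quant n D f i) (by decide) rfl rfl hn hW hW1 ?_ ?_).mono ?_
  · simp
  · rintro k s₁ hk hI - hfr hv
    have hD₁ : s₁.nreg rD = D := by rw [hfr.n _ rfl, hD]
    have hT₁ : s₁.rarr bT D = D := by rw [hfr.b _ rfl, hT]
    have ha₁ : s₁.rarr a k = f k := by rw [hfr.b _ rfl, hsa k hk]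
    have hx₁ : s₁.rreg x = ∑ i ∈ Finset.range n, f i := by
      rw [hfr.r x ?_, hsx]
      simp [Cmd.forN, Cmd.wR, floorCmd, hx.symm]
    have hq := quant_le (D := D) hf hpos hk
    have h0 := hf k hk
    simp only [runs_seq, runs_setR]
    refine ⟨by simp [hI, hD₁, hx₁, hpos.ne']; omega, (runs_floorCmd
      (y := f k * D / ∑ i ∈ Finset.range n, f i) ?_ (by positivity) hW1 (hq.trans hDW)).mono ?_⟩
    · simp [hI, hD₁, hx₁, ha₁, hT₁]
    · rintro t s₂ hfr₂ ⟨ht, hc, -⟩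
      have hI₂ : s₂.nreg rI = k := by rw [hfr₂.n _ rfl]; simpa using hI
      have ho₂ : s₂.narr o = s₁.narr o := by rw [hfr₂.a _ rfl]; simp
      simp [hI₂, hc, ho₂]
      refine ⟨by omega, ?_, fun i hi => ?_⟩
      · unfold quant
        omega
      · rcases Nat.lt_succ_iff_lt_or_eq.1 (Nat.lt_succ_of_le hi) with hi | rfl
        · rw [Function.update_of_ne (by omega)]
          exact hv i hi
        · simp [quant]
  · rintro t s₁ - ⟨ht, hv⟩
    refine ⟨ht.trans ?_, hv⟩
    have := sum_quant_le (D := D) hf hpos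
    simp only [Finset.sum_add_distrib, ← Finset.mul_sum, Finset.sum_const, Finset.card_range,
      smul_eq_mul]
    omega

/-- Puts the integer part of `fN / fM * rD ^ 2` into `rTh`, and the rest of `rD ^ 2`, diminished
by one, into `rPh`. The two digits of the integer part in base `rD` are found one by one. -/
def ratioCmd : Cmd :=
  .setR fY (.reg fN / .reg fM * .arr bT (.reg rD)) ;; floorCmd ;;
  .setN rTh (.reg rC * .reg rD) ;; .setR fY (.reg fY * .arr bT (.reg rD)) ;; floorCmd ;;
  .setN rTh (.reg rTh + .reg rC) ;; .setN rPh (.reg rD * .reg rD - .reg rTh - .lit 1)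

theorem runs_ratioCmd {D : ℕ} {s : State} {θ : ℝ} (hD : s.nreg rD = D) (hT : s.rarr bT D = D)
    (hM0 : s.rreg fM ≠ 0) (hθ : s.rreg fN / s.rreg fM = θ) (hθ0 : 0 ≤ θ) (hθ1 : θ ≤ 1)
    (hMD : D < M) (hDW : D * D + D ≤ W) (hW1 : 1 ≤ W) :
    Runs M W ratioCmd s fun t s' => t ≤ 24 * D + 60 ∧
      (s'.nreg rTh : ℝ) ≤ θ * D ^ 2 ∧ θ * D ^ 2 < s'.nreg rTh + 1 ∧
      s'.nreg rPh = D * D - s'.nreg rTh - 1 := by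
  have hθD : θ * D ≤ D := mul_le_of_le_one_left (Nat.cast_nonneg _) hθ1
  have hfl : ⌊θ * D⌋₊ ≤ D := Nat.floor_le_of_le hθD
  have hfl0 := Nat.floor_le (a := θ * D) (by positivity)
  have hfl1 := Nat.lt_floor_add_one (θ * D)
  set h := ⌊θ * D⌋₊ with hh
  have hz0 : 0 ≤ (θ * D - h) * D := mul_nonneg (by linarith) (Nat.cast_nonneg _)
  have hz1 : (θ * D - h) * D ≤ D := mul_le_of_le_one_left (Nat.cast_nonneg _) (by linarith)
  have hg : ⌊(θ * D - h) * D⌋₊ ≤ D := Nat.floor_le_of_le hz1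
  have hg0 := Nat.floor_le hz0
  have hg1 := Nat.lt_floor_add_one ((θ * D - h) * D)
  set g := ⌊(θ * D - h) * D⌋₊ with hgg
  have hhD : h * D ≤ D * D := Nat.mul_le_mul_right _ hfl
  have hDD : D ≤ D * D + D := Nat.le_add_left _ _
  unfold ratioCmd
  simp only [runs_seq, runs_setR]
  refine ⟨by simp [hD, hM0, hMD], (runs_floorCmd (y := θ * D) (by simp [hD, hT, hθ]) (by positivity)
    hW1 (by omega)).mono ?_⟩
  rintro t₁ s₁ hfr₁ ⟨ht₁, hc₁, hy₁⟩
  replace hc₁ : s₁.nreg rC = h := hc₁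
  replace hy₁ : s₁.rreg fY = θ * D - h := hy₁
  have hD₁ : s₁.nreg rD = D := by rw [hfr₁.n _ rfl]; simpa using hD
  have hT₁ : s₁.rarr bT D = D := by rw [hfr₁.b _ rfl]; simpa using hT
  simp only [runs_setN]
  refine ⟨by simp [hc₁, hD₁]; omega, by simp [hD₁, hMD], (runs_floorCmd
    (y := (θ * D - h) * D) (by simp [hD₁, hT₁, hy₁]) hz0 hW1 (by omega)).mono ?_⟩
  rintro t₂ s₂ hfr₂ ⟨ht₂, hc₂, -⟩
  replace hc₂ : s₂.nreg rC = g := hc₂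
  have hD₂ : s₂.nreg rD = D := by rw [hfr₂.n _ rfl]; simpa using hD₁
  have hTh₂ : s₂.nreg rTh = h * D := by rw [hfr₂.n _ rfl]; simp [hc₁, hD₁]
  simp [hD₂, hTh₂, hc₂]
  refine ⟨by omega, by omega, by omega, ?_, ?_⟩ <;> nlinarith

end RealRAM

/-! ### The list of counters -/

namespace RealRAM

variable {M W : ℕ}

/-- The counter of the position `(i, j)` in a list of `E` triples (row, column, value): the sum of
the values of all triples for this position. -/
def cnt (E : ℕ) (row col val : ℕ → ℕ) (i j : ℕ) : ℕ :=
  ∑ x ∈ Finset.range E, if row x = i ∧ col x = j then val x else 0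

theorem cnt_succ (E : ℕ) (row col val : ℕ → ℕ) (i j : ℕ) :
    cnt (E + 1) row col val i j =
      cnt E row col val i j + if row E = i ∧ col E = j then val E else 0 :=
  Finset.sum_range_succ _ _

theorem cnt_congr {E : ℕ} {row col val row' col' val' : ℕ → ℕ} {i j : ℕ}
    (hr : ∀ x < E, row x = row' x) (hc : ∀ x < E, col x = col' x) (hv : ∀ x < E, val x = val' x) :
    cnt E row col val i j = cnt E row' col' val' i j := by
  refine Finset.sum_congr rfl fun x hx => ?_
  have := Finset.mem_range.1 hx
  rw [hr x this, hc x this, hv x this]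

theorem cnt_push (E : ℕ) (row col val : ℕ → ℕ) (r c v i j : ℕ) :
    cnt (E + 1) (Function.update row E r) (Function.update col E c) (Function.update val E v) i j =
      cnt E row col val i j + if r = i ∧ c = j then v else 0 := by
  rw [cnt_succ]
  congr 1
  · apply cnt_congr <;> intro x hx <;> rw [Function.update_of_ne (by omega)]
  · simp

/-- Different triples in the list are for different positions. -/
def Keyed (E : ℕ) (row col : ℕ → ℕ) : Prop :=
  ∀ x y, x < E → y < E → row x = row y → col x = col y → x = y

theorem Keyed.cnt_eq {E : ℕ} {row col val : ℕ → ℕ} (h : Keyed E row col) {x : ℕ} (hx : x < E) :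
    cnt E row col val (row x) (col x) = val x := by
  unfold cnt
  rw [Finset.sum_eq_single x]
  · simp
  · intro y hy hyx
    rw [if_neg]
    rintro ⟨hr, hc⟩
    exact hyx (h y x (Finset.mem_range.1 hy) hx hr hc)
  · intro hx'
    exact absurd (Finset.mem_range.2 hx) hx'

theorem cnt_eq_zero {E : ℕ} {row col val : ℕ → ℕ} {i j : ℕ}
    (h : ∀ x < E, row x = i → col x ≠ j) : cnt E row col val i j = 0 := by
  refine Finset.sum_eq_zero fun x hx => ?_
  rw [if_neg]
  rintro ⟨hr, hc⟩
  exact h x (Finset.mem_range.1 hx) hr hc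

/-- If every position has only one triple, then a change of the values that fixes zero is a change
of the counters. -/
theorem Keyed.cnt_map {E : ℕ} {row col val val' : ℕ → ℕ} (h : Keyed E row col) (f : ℕ → ℕ)
    (hf : f 0 = 0) (hv : ∀ x < E, val' x = f (val x)) (i j : ℕ) :
    cnt E row col val' i j = f (cnt E row col val i j) := by
  by_cases hx : ∃ x < E, row x = i ∧ col x = j
  · obtain ⟨x, hx, rfl, rfl⟩ := hx
    rw [h.cnt_eq hx, h.cnt_eq hx, hv x hx]
  · push Not at hx
    rw [cnt_eq_zero hx, cnt_eq_zero hx, hf]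

theorem sum_cnt {E n : ℕ} {row col val : ℕ → ℕ} (hr : ∀ x < E, row x < n)
    (hc : ∀ x < E, col x < n) :
    ∑ i ∈ Finset.range n, ∑ j ∈ Finset.range n, cnt E row col val i j =
      ∑ x ∈ Finset.range E, val x := by
  simp only [cnt]
  rw [Finset.sum_congr rfl fun i _ => Finset.sum_comm, Finset.sum_comm]
  refine Finset.sum_congr rfl fun x hx => ?_
  have hx := Finset.mem_range.1 hx
  rw [Finset.sum_eq_single (row x), Finset.sum_eq_single (col x)]
  · simp
  · intro j _ hj
    simp [hj.symm]
  · intro h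
    exact absurd (Finset.mem_range.2 (hc x hx)) h
  · intro i _ hi
    simp [hi.symm]
  · intro h
    exact absurd (Finset.mem_range.2 (hr x hx)) h

/-- Multiplies all counters by `rTh / rD ^ 2` and rounds down. -/
def rescale : Cmd :=
  .forN rX rE (.storeN aVal (.reg rX) (.arr aVal (.reg rX) * .reg rTh / (.reg rD * .reg rD)))

theorem runs_rescale {s : State} {E D Θ : ℕ} (hE : s.nreg rE = E) (hD : s.nreg rD = D)
    (hΘ : s.nreg rTh = Θ) (hD0 : 0 < D) (hval : ∀ x < E, s.narr aVal x ≤ D * D)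
    (hΘD : Θ ≤ D * D) (hM : E ≤ M) (hE' : E ≤ W) (hW : D * D * (D * D) ≤ W) :
    Runs M W rescale s fun t s' => t ≤ 30 * E + 10 ∧
      ∀ x < E, s'.narr aVal x = s.narr aVal x * Θ / (D * D) := by
  have hDD : 0 < D * D := Nat.mul_pos hD0 hD0
  have hDW : D * D ≤ W := (Nat.le_mul_of_pos_right _ hDD).trans hW
  unfold rescale
  refine (Runs.forN (n := E) (f := fun _ => 20) (I := fun k s' =>
    (∀ x < k, s'.narr aVal x = s.narr aVal x * Θ / (D * D)) ∧
      ∀ x, k ≤ x → s'.narr aVal x = s.narr aVal x) (by decide) rfl rfl hE hE' (by omega)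
      ?_ ?_).mono ?_
  · simp
  · rintro k s₁ hk hX - hfr ⟨h1, h2⟩
    have hD₁ : s₁.nreg rD = D := by rw [hfr.n _ rfl, hD]
    have hΘ₁ : s₁.nreg rTh = Θ := by rw [hfr.n _ rfl, hΘ]
    have hv : s₁.narr aVal k * Θ ≤ W := by
      rw [h2 k le_rfl]
      exact (Nat.mul_le_mul (hval k hk) hΘD).trans hW
    simp [hX, hD₁, hΘ₁]
    refine ⟨⟨by omega, ⟨by omega, by omega⟩, hDW, by omega⟩, fun x hx => ?_, fun x hx => ?_⟩
    · rcases hx.lt_or_eq with hx | rfl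
      · rw [Function.update_of_ne (by omega)]
        exact h1 x hx
      · rw [Function.update_self, h2 x le_rfl]
    · rw [Function.update_of_ne (by omega)]
      exact h2 x (by omega)
  · rintro t s₁ - ⟨ht, h, -⟩
    refine ⟨?_, h⟩
    simp at ht
    omega

/-- Appends to the list, with the values `l * r * rPh / rD ^ 2`, all positions for which the
product of the quantized entries `l` and `r` is at least `rD`. The array `aOrd` lists the columns
in the order of their quantized entries, and every row stops at the first product that is too
small. -/
def appendOuter : Cmd :=
  .setN rF (.reg rE) ;;
  .forN rI rN (.setN rX (.reg rN) ;;
    .loop (.and (.nlt (.lit 0) (.reg rX))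
        (.nle (.reg rD) (.arr aA (.reg rI) * .arr aB (.arr aOrd (.reg rX - .lit 1)))))
      (.setN rX (.reg rX - .lit 1) ;;
        .storeN aRow (.reg rF) (.reg rI) ;;
        .storeN aCol (.reg rF) (.arr aOrd (.reg rX)) ;;
        .storeN aVal (.reg rF) (.arr aA (.reg rI) * .arr aB (.arr aOrd (.reg rX)) * .reg rPh /
          (.reg rD * .reg rD)) ;;
        .setN rF (.reg rF + .lit 1)))

/-- A row with quantized entry `l` has at most `l` partners, since these have total weight at
most `D`. -/
theorem sub_le_of_sorted_products {n D l X : ℕ} {r ord : ℕ → ℕ} (hD0 : 0 < D)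
    (hs : IsSorting n r ord) (hr : ∑ j ∈ Finset.range n, r j ≤ D)
    (hX : ∀ z, X ≤ z → z < n → D ≤ l * r (ord z)) : n - X ≤ l := by
  have h1 : (n - X) * D ≤ ∑ z ∈ Finset.Ico X n, l * r (ord z) := by
    rw [← Nat.card_Ico, ← smul_eq_mul]
    exact Finset.card_nsmul_le_sum _ _ _ fun z hz =>
      hX z (Finset.mem_Ico.1 hz).1 (Finset.mem_Ico.1 hz).2
  have h2 : ∑ z ∈ Finset.Ico X n, r (ord z) ≤ ∑ j ∈ Finset.range n, r j := by
    rw [← Finset.sum_image (f := r) (s := Finset.Ico X n) (g := ord)]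
    · refine Finset.sum_le_sum_of_subset fun j hj => ?_
      obtain ⟨z, hz, rfl⟩ := Finset.mem_image.1 hj
      exact Finset.mem_range.2 (hs.lt z (Finset.mem_Ico.1 hz).2)
    · intro x hx y hy hxy
      exact hs.inj x y (Finset.mem_Ico.1 hx).2 (Finset.mem_Ico.1 hy).2 hxy
  rw [← Finset.mul_sum] at h1
  refine Nat.le_of_mul_le_mul_right (h1.trans ?_) hD0
  exact Nat.mul_le_mul_left _ (h2.trans hr)

theorem runs_appendOuter {s : State} {n E D Φ : ℕ} {l r : ℕ → ℕ} (hn : s.nreg rN = n)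
    (hE : s.nreg rE = E) (hD : s.nreg rD = D) (hΦ : s.nreg rPh = Φ) (hD0 : 0 < D)
    (hl : ∀ i < n, s.narr aA i = l i) (hr : ∀ j < n, s.narr aB j = r j)
    (hs : IsSorting n (s.narr aB) (s.narr aOrd)) (hlD : ∑ i ∈ Finset.range n, l i ≤ D)
    (hrD : ∑ j ∈ Finset.range n, r j ≤ D)
    (hΦD : Φ ≤ D * D) (hrow : ∀ x < E, s.narr aRow x < n) (hcol : ∀ x < E, s.narr aCol x < n)
    (hnM : n ≤ M) (hEM : E + D ≤ M) (hnW : n ≤ W) (hEW : E + D ≤ W)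
    (hW : D * D * (D * D) ≤ W) :
    Runs M W appendOuter s fun t s' => t ≤ 70 * D + 40 * n + 20 ∧ s'.nreg rF ≤ E + D ∧
      (∀ x < s'.nreg rF, s'.narr aRow x < n) ∧ (∀ x < s'.nreg rF, s'.narr aCol x < n) ∧
      ∀ i j, i < n → j < n → cnt (s'.nreg rF) (s'.narr aRow) (s'.narr aCol) (s'.narr aVal) i j =
        cnt E (s.narr aRow) (s.narr aCol) (s.narr aVal) i j +
          if D ≤ l i * r j then l i * r j * Φ / (D * D) else 0 := by
  classical
  have hDD : 0 < D * D := Nat.mul_pos hD0 hD0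
  have hDW : D * D ≤ W := (Nat.le_mul_of_pos_right _ hDD).trans hW
  have hlle : ∀ i < n, l i ≤ D := fun i hi => (Finset.single_le_sum (f := l)
    (fun _ _ => Nat.zero_le _) (Finset.mem_range.2 hi)).trans hlD
  have hrle : ∀ i < n, r i ≤ D := fun i hi => (Finset.single_le_sum (f := r)
    (fun _ _ => Nat.zero_le _) (Finset.mem_range.2 hi)).trans hrD
  have hs' : IsSorting n r (s.narr aOrd) := ⟨hs.lt, hs.inj, fun x y hxy hy => by
    have := hs.mono x y hxy hy
    rwa [hr _ (hs.lt x (by omega)), hr _ (hs.lt y hy)] at this⟩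
  set ord := s.narr aOrd with hord
  set c₀ := cnt E (s.narr aRow) (s.narr aCol) (s.narr aVal) with hc₀
  unfold appendOuter
  simp only [runs_seq, runs_setN]
  refine ⟨by simp, (Runs.forN (n := n) (f := fun i => 60 * l i + 25) (I := fun k s' =>
    s'.nreg rF ≤ E + ∑ i ∈ Finset.range k, l i ∧
    (∀ x < s'.nreg rF, s'.narr aRow x < n) ∧ (∀ x < s'.nreg rF, s'.narr aCol x < n) ∧
    ∀ i j, j < n → cnt (s'.nreg rF) (s'.narr aRow) (s'.narr aCol) (s'.narr aVal) i j =
      c₀ i j + if i < k ∧ D ≤ l i * r j then l i * r j * Φ / (D * D) else 0)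
    (by decide) rfl rfl (by simpa using hn) (by omega) (by omega) ?_ ?_).mono ?_⟩
  · simp [hE, hc₀]
    exact ⟨hrow, hcol⟩
  · rintro k s₁ hk hI hN hfr ⟨hF, hro, hco, hcnt⟩
    have hlk := hlle k hk
    have hsum : ∑ i ∈ Finset.range (k + 1), l i ≤ D :=
      (Finset.sum_le_sum_of_subset (Finset.range_mono (by omega))).trans hlD
    rw [Finset.sum_range_succ] at hsum
    set S := ∑ i ∈ Finset.range k, l i with hS
    have hD₁ : s₁.nreg rD = D := by rw [hfr.n _ rfl]; simpa using hD
    have hΦ₁ : s₁.nreg rPh = Φ := by rw [hfr.n _ rfl]; simpa using hΦ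
    have hA₁ : s₁.narr aA k = l k := by rw [hfr.a _ rfl]; simpa using hl k hk
    have hB₁ : ∀ j < n, s₁.narr aB j = r j := by rw [hfr.a _ rfl]; simpa using hr
    have ho₁ : s₁.narr aOrd = ord := by rw [hfr.a _ rfl]; simp [hord]
    simp only [runs_seq, runs_setN]
    refine ⟨by simp, (Runs.loop (I := fun s' => s'.nreg rX ≤ n ∧
      s'.nreg rF + s'.nreg rX ≤ E + S + n ∧
      (∀ x < s'.nreg rF, s'.narr aRow x < n) ∧ (∀ x < s'.nreg rF, s'.narr aCol x < n) ∧
      (∀ z, s'.nreg rX ≤ z → z < n → D ≤ l k * r (ord z)) ∧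
      ∀ i j, j < n → cnt (s'.nreg rF) (s'.narr aRow) (s'.narr aCol) (s'.narr aVal) i j =
        c₀ i j + if (i < k ∧ D ≤ l i * r j) ∨ (i = k ∧ ∃ z, s'.nreg rX ≤ z ∧ z < n ∧ ord z = j)
          then l i * r j * Φ / (D * D) else 0)
      (Φ := fun s' => 60 * (l k - (n - s'.nreg rX))) ?_ ?_).mono ?_⟩
    · simp [hN]
      refine ⟨by omega, hro, hco, fun z hz hz' => by omega, fun i j hj => ?_⟩
      rw [hcnt i j hj]
      congr 1
      refine if_congr ?_ rfl rfl
      constructor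
      · exact fun h => Or.inl h
      · rintro (h | ⟨-, z, hz, hz', -⟩)
        · exact h
        · omega
    · rintro s₂ hfr₂ ⟨hX, hFX, hro₂, hco₂, hz, hcnt₂⟩
      have hD₂ : s₂.nreg rD = D := by rw [hfr₂.n _ rfl]; simpa using hD₁
      have hI₂ : s₂.nreg rI = k := by rw [hfr₂.n _ rfl]; simpa using hI
      have hΦ₂ : s₂.nreg rPh = Φ := by rw [hfr₂.n _ rfl]; simpa using hΦ₁
      have hA₂ : s₂.narr aA k = l k := by rw [hfr₂.a _ rfl]; simpa using hA₁
      have hB₂ : ∀ j < n, s₂.narr aB j = r j := by rw [hfr₂.a _ rfl]; simpa using hB₁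
      have ho₂ : s₂.narr aOrd = ord := by rw [hfr₂.a _ rfl]; simpa using ho₁
      by_cases hX0 : s₂.nreg rX = 0
      · exact ⟨by simp [hX0], fun hp => absurd hp (by simp [hX0])⟩
      obtain ⟨x, hx⟩ : ∃ x, s₂.nreg rX = x + 1 := ⟨s₂.nreg rX - 1, by omega⟩
      have hxn : x < n := by omega
      have hox := hs.lt x hxn
      have hBx := hB₂ _ hox
      have hrx := hrle _ hox
      have hprod : l k * r (ord x) ≤ D * D := Nat.mul_le_mul hlk hrx
      refine ⟨by simp [hx, hI₂, ho₂, hA₂, hBx]; omega, fun hp => ?_⟩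
      simp [hx, hI₂, ho₂, hA₂, hBx, hD₂] at hp
      have hz' : ∀ z, x ≤ z → z < n → D ≤ l k * r (ord z) := fun z hxz hzn => by
        rcases hxz.lt_or_eq with h | rfl
        · exact hz z (by omega) hzn
        · exact hp
      have hnx := sub_le_of_sorted_products hD0 hs' hrD hz'
      have hprod' : l k * r (ord x) * Φ ≤ W := (Nat.mul_le_mul hprod hΦD).trans hW
      simp [hx, hI₂, ho₂, hA₂, hBx, hD₂, hΦ₂, cnt_push]
      refine ⟨by omega, by omega, by omega, ⟨by omega, ⟨by omega, hDW, by omega⟩⟩, by omega,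
        ⟨by omega, by omega, fun y hy => ?_, fun y hy => ?_, hz', fun i j hj => ?_⟩, by omega⟩
      · rcases hy.lt_or_eq with hy | rfl
        · rw [Function.update_of_ne (by omega)]
          exact hro₂ y hy
        · simpa using hk
      · rcases hy.lt_or_eq with hy | rfl
        · rw [Function.update_of_ne (by omega)]
          exact hco₂ y hy
        · simpa using hox
      · rw [hcnt₂ i j hj, hx]
        by_cases hij : k = i ∧ ord x = j
        · obtain ⟨rfl, rfl⟩ := hij
          have h1 : ¬ (k < k ∧ D ≤ l k * r (ord x) ∨
              k = k ∧ ∃ z, x + 1 ≤ z ∧ z < n ∧ ord z = ord x) := by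
            rintro (⟨h, -⟩ | ⟨-, z, hxz, hzn, hzx⟩)
            · omega
            · have := hs.inj z x hzn hxn hzx
              omega
          have h2 : k < k ∧ D ≤ l k * r (ord x) ∨ k = k ∧ ∃ z, x ≤ z ∧ z < n ∧ ord z = ord x :=
            Or.inr ⟨rfl, x, le_rfl, hxn, rfl⟩
          rw [if_neg h1, if_pos h2, if_pos (c := k = k ∧ ord x = ord x) ⟨rfl, rfl⟩, add_zero]
        · rw [if_neg hij, add_zero]
          congr 1
          refine if_congr (or_congr_right (and_congr_right fun hik => ?_)) rfl rfl
          constructor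
          · rintro ⟨z, hxz, hzn, hzx⟩
            exact ⟨z, by omega, hzn, hzx⟩
          · rintro ⟨z, hxz, hzn, hzx⟩
            refine ⟨z, ?_, hzn, hzx⟩
            by_contra hlt
            obtain rfl : z = x := by omega
            exact hij ⟨hik.symm, hzx⟩
    · rintro t s₂ hfr₂ ⟨⟨hX, hFX, hro₂, hco₂, hz, hcnt₂⟩, hp, ht, -⟩
      have hD₂ : s₂.nreg rD = D := by rw [hfr₂.n _ rfl]; simpa using hD₁
      have hI₂ : s₂.nreg rI = k := by rw [hfr₂.n _ rfl]; simpa using hI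
      have hA₂ : s₂.narr aA k = l k := by rw [hfr₂.a _ rfl]; simpa using hA₁
      have hB₂ : ∀ j < n, s₂.narr aB j = r j := by rw [hfr₂.a _ rfl]; simpa using hB₁
      have ho₂ : s₂.narr aOrd = ord := by rw [hfr₂.a _ rfl]; simpa using ho₁
      have hnx := sub_le_of_sorted_products hD0 hs' hrD hz
      simp [hN] at ht ⊢
      refine ⟨by omega, ?_, hro₂, hco₂, fun i j hj => ?_⟩
      · rw [Finset.sum_range_succ]
        omega
      · rw [hcnt₂ i j hj]
        congr 1
        refine if_congr ?_ rfl rfl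
        obtain ⟨z, hzn, rfl⟩ := hs'.surj hj
        constructor
        · rintro (⟨h1, h2⟩ | ⟨rfl, z', hz', hzn', hzz⟩)
          · exact ⟨by omega, h2⟩
          · rw [← hzz]
            exact ⟨by omega, hz z' hz' hzn'⟩
        · rintro ⟨h1, h2⟩
          rcases Nat.lt_succ_iff_lt_or_eq.1 (Nat.lt_succ_of_le h1) with h1 | rfl
          · exact Or.inl ⟨h1, h2⟩
          · refine Or.inr ⟨rfl, z, ?_, hzn, rfl⟩
            by_contra hlt
            obtain ⟨x, hx⟩ : ∃ x, s₂.nreg rX = x + 1 := ⟨s₂.nreg rX - 1, by omega⟩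
            simp [hx, hI₂, ho₂, hA₂, hB₂ _ (hs.lt x (by omega)), hD₂] at hp
            have hm := hs'.mono z x (by omega) (by omega)
            have := Nat.mul_le_mul_left (l i) hm
            omega
  · rintro t s₁ - ⟨ht, hF, hro, hco, hcnt⟩
    refine ⟨?_, by omega, hro, hco, fun i j hi hj => ?_⟩
    · simp [Finset.sum_add_distrib, ← Finset.mul_sum] at ht ⊢
      omega
    · rw [hcnt i j hj]
      simp [hi]

end RealRAM

/-! ### Merging and pruning the counters -/

namespace RealRAM

variable {M W : ℕ}

/-- Different triples of the list with nonzero values are for different positions. -/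
def NzKeyed (E : ℕ) (row col val : ℕ → ℕ) : Prop :=
  ∀ x y, x < E → y < E → val x ≠ 0 → val y ≠ 0 → row x = row y → col x = col y → x = y

/-- Moving the value of a triple to another triple for the same position changes no counter. -/
theorem cnt_merge {E : ℕ} {row col val : ℕ → ℕ} {x y : ℕ} (hx : x < E) (hy : y < E) (hxy : y ≠ x)
    (hr : row y = row x) (hc : col y = col x) (i j : ℕ) :
    cnt E row col (Function.update (Function.update val y (val y + val x)) x 0) i j =
      cnt E row col val i j := by
  unfold cnt
  rw [← Finset.add_sum_erase _ _ (Finset.mem_range.2 hx),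
    ← Finset.add_sum_erase _ _ (Finset.mem_range.2 hx),
    ← Finset.add_sum_erase _ _ (Finset.mem_erase.2 ⟨hxy, Finset.mem_range.2 hy⟩),
    ← Finset.add_sum_erase _ _ (Finset.mem_erase.2 ⟨hxy, Finset.mem_range.2 hy⟩)]
  have : ∀ z ∈ ((Finset.range E).erase x).erase y,
      Function.update (Function.update val y (val y + val x)) x 0 z = val z := fun z hz => by
    simp only [Finset.mem_erase] at hz
    rw [Function.update_of_ne hz.2.1, Function.update_of_ne hz.1]
  rw [Finset.sum_congr rfl fun z hz => by rw [this z hz]]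
  simp only [Function.update_self, Function.update_of_ne hxy, hr, hc]
  split_ifs <;> ring

/-- Collects the values of all triples for the same position in one of these triples. The triples
are visited row by row, and `aPos` holds for every column of the row the triple that collects. What
`aPos` contains at the beginning does not matter, since every entry is checked before it is
used. -/
def dedupe : Cmd :=
  .setN rG (.reg rN) ;; bucketSort aRow ;;
  .forN rQ rF (.setN rX (.arr aOrd (.reg rQ)) ;; .setN rY (.arr aPos (.arr aCol (.reg rX))) ;;
    .ite (.and (.nlt (.reg rY) (.reg rF)) (.and (.neq (.arr aRow (.reg rY)) (.arr aRow (.reg rX)))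
        (.and (.neq (.arr aCol (.reg rY)) (.arr aCol (.reg rX)))
          (.not (.neq (.reg rY) (.reg rX))))))
      (.storeN aVal (.reg rY) (.arr aVal (.reg rY) + .arr aVal (.reg rX)) ;;
        .storeN aVal (.reg rX) (.lit 0))
      (.storeN aPos (.arr aCol (.reg rX)) (.reg rX)))

theorem runs_dedupe {s : State} {n F V : ℕ} (hn : s.nreg rN = n) (hF : s.nreg rF = F)
    (hrow : ∀ x < F, s.narr aRow x < n) (hcol : ∀ x < F, s.narr aCol x < n)
    (hV : ∑ x ∈ Finset.range F, s.narr aVal x = V)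
    (hhead : ∀ g, s.narr aHead g = 0) (hFM : F ≤ M) (hnM : n ≤ M) (hFW : F ≤ W) (hnW : n ≤ W)
    (hVW : V ≤ W) (hW : 1 ≤ W) :
    Runs M W dedupe s fun t s' => t ≤ 160 * (F + n) + 60 ∧ (∀ g, s'.narr aHead g = 0) ∧
      (∀ i j, cnt F (s'.narr aRow) (s'.narr aCol) (s'.narr aVal) i j =
        cnt F (s.narr aRow) (s.narr aCol) (s.narr aVal) i j) ∧
      NzKeyed F (s'.narr aRow) (s'.narr aCol) (s'.narr aVal) := by
  set row := s.narr aRow with hrowdef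
  set col := s.narr aCol with hcoldef
  unfold dedupe
  simp only [runs_seq, runs_setN]
  refine ⟨by simp, (runs_bucketSort (F := F) (G := n) (by decide) (by decide) (by simpa using hF)
    (by simpa using hn) hFM hnM hFW hnW hW (by simpa using hrow) (by simpa using hhead)).mono ?_⟩
  rintro t₁ s₁ hfr₁ ⟨ht₁, hs, hhead₁⟩
  have hF₁ : s₁.nreg rF = F := by rw [hfr₁.n _ rfl]; simpa using hF
  have hR₁ : s₁.narr aRow = row := by rw [hfr₁.a _ rfl]; simp [hrowdef]
  have hC₁ : s₁.narr aCol = col := by rw [hfr₁.a _ rfl]; simp [hcoldef]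
  have hV₁ : s₁.narr aVal = s.narr aVal := by rw [hfr₁.a _ rfl]; simp
  replace hs : IsSorting F row (s₁.narr aOrd) := by simpa [hrowdef] using hs
  set ord := s₁.narr aOrd with hord
  refine (Runs.forN (n := F) (f := fun _ => 80) (I := fun p s' =>
    (∀ i j, cnt F row col (s'.narr aVal) i j = cnt F row col (s.narr aVal) i j) ∧
    (∑ x ∈ Finset.range F, s'.narr aVal x = V) ∧
    (∀ q q', q < p → q' < p → s'.narr aVal (ord q) ≠ 0 → s'.narr aVal (ord q') ≠ 0 →
      row (ord q) = row (ord q') → col (ord q) = col (ord q') → ord q = ord q') ∧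
    (∀ q p', q < p → p ≤ p' → p' < F → s'.narr aVal (ord q) ≠ 0 → row (ord p') = row (ord q) →
      s'.narr aPos (col (ord q)) = ord q))
    (by decide) rfl rfl hF₁ hFW hW ?_ ?_).mono ?_
  · simp [hV₁, hV]
  · rintro p s₂ hp hQ hF₂ hfr₂ ⟨hcnt, hsum, hkey, hpos⟩
    have hR₂ : s₂.narr aRow = row := by rw [hfr₂.a _ rfl, hR₁]
    have hC₂ : s₂.narr aCol = col := by rw [hfr₂.a _ rfl, hC₁]
    have ho₂ : s₂.narr aOrd = ord := by rw [hfr₂.a _ rfl]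
    have hx := hs.lt p hp
    set x := ord p with hxdef
    have hcx := hcol x hx
    set y := s₂.narr aPos (col x) with hydef
    simp only [runs_seq, runs_setN]
    simp only [NExp.eval_arr, NExp.eval_reg, State.nreg_setN, State.narr_setN, hQ, hC₂, ho₂,
      NExp.ok_arr, NExp.ok_reg, ← hxdef, ← hydef, if_true]
    refine ⟨⟨trivial, by omega⟩, ⟨⟨trivial, by omega⟩, by omega⟩, Runs.ite ?_ ?_ ?_⟩
    · simp [hR₂, hC₂]
      omega
    · intro h
      simp [hR₂, hC₂, hF₂] at h
      obtain ⟨hyF, ⟨hr1, hr2⟩, ⟨hc1, hc2⟩, hne⟩ := h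
      have hr := le_antisymm hr1 hr2
      have hc := le_antisymm hc1 hc2
      have hyx : y ≠ x := fun h => by
        have := hne h.le
        omega
      have hle : s₂.narr aVal y + s₂.narr aVal x ≤ V := by
        rw [← hsum, ← Finset.sum_pair (f := s₂.narr aVal) hyx]
        refine Finset.sum_le_sum_of_subset fun z hz => ?_
        simp only [Finset.mem_insert, Finset.mem_singleton] at hz
        rcases hz with rfl | rfl
        · exact Finset.mem_range.2 hyF
        · exact Finset.mem_range.2 hx
      simp
      refine ⟨⟨by omega, by omega, by omega⟩, by omega, fun i j => ?_, ?_, ?_, ?_⟩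
      · rw [cnt_merge hx hyF hyx hr hc]
        exact hcnt i j
      · rw [← hsum, ← sum_cnt (row := row) (col := col) (n := n) hrow hcol,
          ← sum_cnt (row := row) (col := col) (n := n) hrow hcol]
        simp only [cnt_merge hx hyF hyx hr hc]
      · -- Whoever has the key of `x` and a nonzero value is the collecting triple `y`.
        have huniq : ∀ q, q < p → s₂.narr aVal (ord q) ≠ 0 → row (ord q) = row x →
            col (ord q) = col x → ord q = y := fun q hq hv hrq hcq => by
          rw [hydef, ← hcq]
          exact (hpos q p hq le_rfl hp hv hrq.symm).symm
        intro q q' hq hq' hv hv' hrq hcq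
        have hqx : ord q ≠ x := fun h => hv (by simp [h])
        have hqx' : ord q' ≠ x := fun h => hv' (by simp [h])
        have hqp : q < p := by
          rcases hq.lt_or_eq with h | rfl
          · exact h
          · exact absurd rfl hqx
        have hqp' : q' < p := by
          rcases hq'.lt_or_eq with h | rfl
          · exact h
          · exact absurd rfl hqx'
        rw [Function.update_of_ne hqx] at hv
        rw [Function.update_of_ne hqx'] at hv'
        by_cases h1 : ord q = y
        · by_cases h2 : ord q' = y
          · rw [h1, h2]
          · rw [Function.update_of_ne h2] at hv'
            rw [h1, huniq q' hqp' hv' (by rw [← hrq, h1, hr]) (by rw [← hcq, h1, hc])]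
        · rw [Function.update_of_ne h1] at hv
          by_cases h2 : ord q' = y
          · rw [h2, huniq q hqp hv (by rw [hrq, h2, hr]) (by rw [hcq, h2, hc])]
          · rw [Function.update_of_ne h2] at hv'
            exact hkey q q' hqp hqp' hv hv' hrq hcq
      · intro q p' hq hpp hpF hv hrq
        have hqx : ord q ≠ x := fun h => hv (by simp [h])
        have hqp : q < p := by
          rcases hq.lt_or_eq with h | rfl
          · exact h
          · exact absurd rfl hqx
        rw [Function.update_of_ne hqx] at hv
        by_cases h1 : ord q = y
        · rw [h1, hc]
        · rw [Function.update_of_ne h1] at hv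
          exact hpos q p' hqp (by omega) hpF hv hrq
    · intro h
      simp [hR₂, hC₂, hF₂] at h
      simp [hC₂]
      -- No triple visited before has the key of `x` and a nonzero value.
      have hnew : ∀ q, q < p → s₂.narr aVal (ord q) ≠ 0 → row (ord q) = row x →
          col (ord q) = col x → False := fun q hq hv hrq hcq => by
        have hy : y = ord q := by
          rw [hydef, ← hcq]
          exact hpos q p hq le_rfl hp hv hrq.symm
        have h3 := h (by rw [hy]; exact hs.lt q (by omega)) (by rw [hy]; exact hrq.le)
          (by rw [hy]; exact hrq.ge) (by rw [hy]; exact hcq.le) (by rw [hy]; exact hcq.ge)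
        have := hs.inj q p (by omega) hp (by rw [← hy]; omega)
        omega
      refine ⟨⟨by omega, by omega⟩, hcnt, hsum, fun q q' hq hq' hv hv' hrq hcq => ?_,
        fun q p' hq hpp hpF hv hrq => ?_⟩
      · rcases hq.lt_or_eq with h1 | rfl
        · rcases hq'.lt_or_eq with h2 | rfl
          · exact hkey q q' h1 h2 hv hv' hrq hcq
          · exact (hnew q h1 hv hrq hcq).elim
        · rcases hq'.lt_or_eq with h2 | rfl
          · exact (hnew q' h2 hv' hrq.symm hcq.symm).elim
          · rfl
      · rcases hq.lt_or_eq with h1 | rfl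
        · by_cases hcq : col (ord q) = col x
          · have hrx : row x = row (ord q) := by
              have h2 := hs.mono q p h1.le hp
              have h3 := hs.mono p p' (by omega) hpF
              rw [← hxdef] at h2 h3
              omega
            exact (hnew q h1 hv hrx.symm hcq).elim
          · rw [Function.update_of_ne hcq]
            exact hpos q p' h1 (by omega) hpF hv hrq
        · simp [hxdef]
  · rintro t₂ s₂ hfr₂ ⟨ht₂, hcnt, -, hkey, -⟩
    have hR₂ : s₂.narr aRow = row := by rw [hfr₂.a _ rfl, hR₁]
    have hC₂ : s₂.narr aCol = col := by rw [hfr₂.a _ rfl, hC₁]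
    have hh₂ : s₂.narr aHead = s₁.narr aHead := hfr₂.a _ rfl
    rw [hR₂, hC₂, hh₂]
    refine ⟨?_, hhead₁, hcnt, fun x y hx hy hvx hvy hr hc => ?_⟩
    · simp at ht₂ ⊢
      omega
    · obtain ⟨q, hq, rfl⟩ := hs.surj hx
      obtain ⟨q', hq', rfl⟩ := hs.surj hy
      exact hkey q q' hq hq' hvx hvy hr hc

/-- Copies to the front, with values diminished by `rT`, the triples whose values exceed `rT`. -/
def filterCmd : Cmd :=
  .setN rE (.lit 0) ;;
  .forN rX rF (.ite (.nlt (.reg rT) (.arr aVal (.reg rX)))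
    (.storeN aRow (.reg rE) (.arr aRow (.reg rX)) ;; .storeN aCol (.reg rE) (.arr aCol (.reg rX)) ;;
      .storeN aVal (.reg rE) (.arr aVal (.reg rX) - .reg rT) ;; .setN rE (.reg rE + .lit 1))
    .skip)

theorem runs_filterCmd {s : State} {F T : ℕ} (hF : s.nreg rF = F) (hT : s.nreg rT = T)
    (hkey : NzKeyed F (s.narr aRow) (s.narr aCol) (s.narr aVal)) (hFM : F ≤ M) (hFW : F ≤ W)
    (hW : 1 ≤ W) :
    Runs M W filterCmd s fun t s' => t ≤ 50 * F + 20 ∧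
      s'.nreg rE = ((Finset.range F).filter fun x => T < s.narr aVal x).card ∧
      (∀ x < s'.nreg rE, ∃ z < F, s'.narr aRow x = s.narr aRow z ∧
        s'.narr aCol x = s.narr aCol z) ∧
      Keyed (s'.nreg rE) (s'.narr aRow) (s'.narr aCol) ∧
      (∑ x ∈ Finset.range (s'.nreg rE), s'.narr aVal x =
        ∑ x ∈ Finset.range F, (s.narr aVal x - T)) ∧
      ∀ i j, cnt (s'.nreg rE) (s'.narr aRow) (s'.narr aCol) (s'.narr aVal) i j =
        cnt F (s.narr aRow) (s.narr aCol) (s.narr aVal) i j - T := by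
  set row := s.narr aRow with hrow
  set col := s.narr aCol with hcol
  set val := s.narr aVal with hval
  unfold filterCmd
  simp only [runs_seq, runs_setN]
  refine ⟨by simp, (Runs.forN (n := F) (f := fun _ => 30) (I := fun k s' =>
    s'.nreg rE ≤ k ∧ s'.nreg rE = ((Finset.range k).filter fun x => T < val x).card ∧
    (∀ x, k ≤ x → s'.narr aRow x = row x ∧ s'.narr aCol x = col x ∧ s'.narr aVal x = val x) ∧
    (∀ x < s'.nreg rE, ∃ z < k, T < val z ∧ s'.narr aRow x = row z ∧ s'.narr aCol x = col z) ∧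
    Keyed (s'.nreg rE) (s'.narr aRow) (s'.narr aCol) ∧
    (∑ x ∈ Finset.range (s'.nreg rE), s'.narr aVal x = ∑ x ∈ Finset.range k, (val x - T)) ∧
    ∀ i j, cnt (s'.nreg rE) (s'.narr aRow) (s'.narr aCol) (s'.narr aVal) i j =
      cnt k row col (fun x => val x - T) i j)
    (by decide) rfl rfl (by simpa using hF) hFW hW ?_ ?_).mono ?_⟩
  · simp [hrow, hcol, hval, Keyed, cnt]
  · rintro k s₁ hk hX hF₁ hfr ⟨hE, hcard, hrest, hsrc, hk1, hsum, hcnt⟩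
    have hT₁ : s₁.nreg rT = T := by rw [hfr.n _ rfl]; simpa using hT
    obtain ⟨hr, hc, hv⟩ := hrest k le_rfl
    refine Runs.ite (by simp [hX]; omega) (fun h => ?_) (fun h => ?_)
    · simp [hX, hT₁, hv] at h
      simp [hX, hT₁, Function.update_apply, hr, hc, hv]
      set e := s₁.nreg rE with he
      refine ⟨by omega, by omega, by omega, ?_, ?_, ?_, ?_, ?_, ?_⟩
      · rw [Finset.range_add_one, Finset.filter_insert, if_pos h,
          Finset.card_insert_of_notMem (by simp)]
        omega
      · intro x hx
        have hxe : x ≠ e := by omega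
        simp only [if_neg hxe]
        exact hrest x (by omega)
      · intro x hx
        by_cases hxe : x = e
        · exact ⟨k, by omega, h, by simp [hxe], by simp [hxe]⟩
        · obtain ⟨z, hz, hz'⟩ := hsrc x (by omega)
          simp only [if_neg hxe]
          exact ⟨z, by omega, hz'⟩
      · -- The new triple differs from the earlier ones, as all of them come from triples with
        -- nonzero values.
        have hnew : ∀ x < e, s₁.narr aRow x = row k → s₁.narr aCol x = col k → False :=
          fun x hx h1 h2 => by
            obtain ⟨z, hz, hzT, hz1, hz2⟩ := hsrc x hx
            have := hkey z k (by omega) hk (by omega) (by omega) (by rw [← hz1, h1])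
              (by rw [← hz2, h2])
            omega
        intro x y hx hy h1 h2
        by_cases hxe : x = e <;> by_cases hye : y = e
        · omega
        · simp only [Function.update_apply, hxe, hye, if_true, if_false] at h1 h2
          exact (hnew y (by omega) h1.symm h2.symm).elim
        · simp only [Function.update_apply, hxe, hye, if_true, if_false] at h1 h2
          exact (hnew x (by omega) h1 h2).elim
        · simp only [Function.update_apply, hxe, hye, if_false] at h1 h2
          exact hk1 x y (by omega) (by omega) h1 h2
      · rw [Finset.sum_range_succ, Finset.sum_range_succ, ← hsum]
        simp only [if_true]
        congr 1
        refine Finset.sum_congr rfl fun x hx => ?_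
        rw [if_neg]
        have := Finset.mem_range.1 hx
        omega
      · intro i j
        rw [cnt_push, cnt_succ, ← hcnt i j]
    · simp [hX, hT₁, hv] at h
      simp
      refine ⟨by omega, ?_, fun x hx => hrest x (by omega), fun x hx => ?_, hk1, ?_, fun i j => ?_⟩
      · rw [Finset.range_add_one, Finset.filter_insert, if_neg (by omega)]
        exact hcard
      · obtain ⟨z, hz, hz'⟩ := hsrc x hx
        exact ⟨z, by omega, hz'⟩
      · rw [Finset.sum_range_succ, hsum]
        omega
      · rw [cnt_succ, hcnt i j]
        have : val k - T = 0 := by omega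
        simp [this]
  · rintro t s₁ - ⟨ht, -, hcard, -, hsrc, hk1, hsum, hcnt⟩
    refine ⟨?_, hcard, fun x hx => ?_, hk1, hsum, fun i j => ?_⟩
    · simp at ht ⊢
      omega
    · obtain ⟨z, hz, -, hz'⟩ := hsrc x hx
      exact ⟨z, hz, hz'⟩
    · rw [hcnt i j]
      -- At most one triple for `(i, j)` has a nonzero value.
      unfold cnt
      by_cases hx : ∃ x < F, row x = i ∧ col x = j ∧ val x ≠ 0
      · obtain ⟨x, hx, rfl, rfl, hvx⟩ := hx
        have huniq : ∀ y ∈ Finset.range F, y ≠ x → row y = row x ∧ col y = col x → val y = 0 :=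
          fun y hy hyx hyy => by
            by_contra hvy
            exact hyx (hkey y x (Finset.mem_range.1 hy) hx hvy hvx hyy.1 hyy.2)
        rw [Finset.sum_eq_single x, Finset.sum_eq_single x]
        · simp
        · intro y hy hyx
          split_ifs with h
          · exact huniq y hy hyx h
          · rfl
        · intro h
          exact absurd (Finset.mem_range.2 hx) h
        · intro y hy hyx
          split_ifs with h
          · simp [huniq y hy hyx h]
          · rfl
        · intro h
          exact absurd (Finset.mem_range.2 hx) h
      · push Not at hx
        rw [Finset.sum_eq_zero, Finset.sum_eq_zero, Nat.zero_sub]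
        · intro y hy
          split_ifs with h
          · exact hx y (Finset.mem_range.1 hy) h.1 h.2
          · rfl
        · intro y hy
          split_ifs with h
          · simp [hx y (Finset.mem_range.1 hy) h.1 h.2]
          · rfl

/-- Subtracts the `2 * rD + 1`-st largest value from all values and removes the triples that are
left without a positive value. For the selection, the values above `rD` need not be distinguished
from each other, because there are at most `rD` of them. -/
def prune : Cmd :=
  .forN rX rF (.storeN aKey (.reg rX)
    (.arr aVal (.reg rX) - (.arr aVal (.reg rX) - (.reg rD + .lit 1)))) ;;
  .setN rG (.reg rD + .lit 2) ;; bucketSort aKey ;;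
  .ite (.nlt (.reg rD + .reg rD) (.reg rF))
    (.setN rT (.arr aKey (.arr aOrd (.reg rF - (.reg rD + .reg rD) - .lit 1))))
    (.setN rT (.lit 0)) ;;
  filterCmd

theorem card_filter_lt_le_of_isSorting {F m p : ℕ} {key ord : ℕ → ℕ} (hs : IsSorting F key ord)
    (hp : p + m + 1 = F) :
    ((Finset.range F).filter fun x => key (ord p) < key x).card ≤ m := by
  have : ((Finset.range F).filter fun x => key (ord p) < key x) ⊆
      (Finset.Ico (p + 1) F).image ord := by
    intro x hx
    rw [Finset.mem_filter, Finset.mem_range] at hx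
    obtain ⟨q, hq, rfl⟩ := hs.surj hx.1
    refine Finset.mem_image_of_mem _ (Finset.mem_Ico.2 ⟨?_, hq⟩)
    by_contra hlt
    have := hs.mono q p (by omega) (by omega)
    omega
  refine (Finset.card_le_card this).trans (Finset.card_image_le.trans ?_)
  rw [Nat.card_Ico]
  omega

theorem lt_card_filter_le_of_isSorting {F m p : ℕ} {key ord : ℕ → ℕ} (hs : IsSorting F key ord)
    (hp : p + m + 1 = F) :
    m < ((Finset.range F).filter fun x => key (ord p) ≤ key x).card := by
  have : (Finset.Ico p F).image ord ⊆
      ((Finset.range F).filter fun x => key (ord p) ≤ key x) := by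
    intro x hx
    obtain ⟨q, hq, rfl⟩ := Finset.mem_image.1 hx
    rw [Finset.mem_Ico] at hq
    exact Finset.mem_filter.2 ⟨Finset.mem_range.2 (hs.lt q hq.2), hs.mono p q hq.1 hq.2⟩
  refine lt_of_lt_of_le ?_ (Finset.card_le_card this)
  rw [Finset.card_image_of_injOn, Nat.card_Ico]
  · omega
  · intro x hx y hy hxy
    simp only [Finset.coe_Ico, Set.mem_Ico] at hx hy
    exact hs.inj x y hx.2 hy.2 hxy

theorem sum_sub_add_mul_le {F m T : ℕ} {val : ℕ → ℕ}
    (h : m ≤ ((Finset.range F).filter fun x => T ≤ val x).card) :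
    ∑ x ∈ Finset.range F, (val x - T) + m * T ≤ ∑ x ∈ Finset.range F, val x := by
  have h1 : m * T ≤ ∑ x ∈ Finset.range F, if T ≤ val x then T else 0 := by
    rw [← Finset.sum_filter, Finset.sum_const, smul_eq_mul]
    exact Nat.mul_le_mul_right _ h
  calc _ ≤ ∑ x ∈ Finset.range F, (val x - T) + ∑ x ∈ Finset.range F, if T ≤ val x then T else 0 :=
        Nat.add_le_add_left h1 _
    _ = ∑ x ∈ Finset.range F, ((val x - T) + if T ≤ val x then T else 0) :=
        Finset.sum_add_distrib.symm
    _ ≤ _ := Finset.sum_le_sum fun x _ => by split_ifs <;> omega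

theorem runs_prune {s : State} {n F D : ℕ} (hF : s.nreg rF = F) (hD : s.nreg rD = D)
    (hkey : NzKeyed F (s.narr aRow) (s.narr aCol) (s.narr aVal))
    (hrow : ∀ x < F, s.narr aRow x < n) (hcol : ∀ x < F, s.narr aCol x < n)
    (hV : ∑ x ∈ Finset.range F, s.narr aVal x ≤ D * D)
    (hhead : ∀ g, s.narr aHead g = 0) (hFM : F ≤ M) (hDM : D + 2 ≤ M) (hFW : F ≤ W)
    (hDW : 2 * D + 2 ≤ W) :
    Runs M W prune s fun t s' => t ≤ 200 * (F + D) + 300 ∧ (∀ g, s'.narr aHead g = 0) ∧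
      s'.nreg rE ≤ 2 * D ∧
      (∀ x < s'.nreg rE, s'.narr aRow x < n) ∧ (∀ x < s'.nreg rE, s'.narr aCol x < n) ∧
      Keyed (s'.nreg rE) (s'.narr aRow) (s'.narr aCol) ∧
      ∃ T, (∑ x ∈ Finset.range (s'.nreg rE), s'.narr aVal x + 2 * D * T ≤
          ∑ x ∈ Finset.range F, s.narr aVal x) ∧
        ∀ i j, cnt (s'.nreg rE) (s'.narr aRow) (s'.narr aCol) (s'.narr aVal) i j =
          cnt F (s.narr aRow) (s.narr aCol) (s.narr aVal) i j - T := by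
  set val := s.narr aVal with hval
  set key : ℕ → ℕ := fun x => val x - (val x - (D + 1)) with hkeydef
  have hkeylt : ∀ x, key x < D + 2 := fun x => by simp only [hkeydef]; omega
  have hkeyle : ∀ x, key x ≤ val x := fun x => Nat.sub_le _ _
  have hkeyT : ∀ x T, T ≤ D → T < val x → T < key x := fun x T h1 h2 => by
    simp only [hkeydef]; omega
  unfold prune
  rw [runs_seq]
  refine (Runs.forN (n := F) (f := fun _ => 20) (I := fun k s' =>
    ∀ x < k, s'.narr aKey x = key x) (by decide) rfl rfl hF hFW (by omega) ?_ ?_).mono ?_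
  · simp
  · rintro k s₁ hk hX hF₁ hfr hI
    have hD₁ : s₁.nreg rD = D := by rw [hfr.n _ rfl, hD]
    have hV₁ : s₁.narr aVal = val := by rw [hfr.a _ rfl]
    simp [hX, hD₁, hV₁]
    refine ⟨⟨by omega, by omega, by omega⟩, fun x hx => ?_⟩
    rcases hx.lt_or_eq with hx | rfl
    · rw [Function.update_of_ne (by omega)]
      exact hI x hx
    · simp [hkeydef]
  rintro t₁ s₁ hfr₁ ⟨ht₁, hk₁⟩
  have hD₁ : s₁.nreg rD = D := by rw [hfr₁.n _ rfl, hD]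
  have hF₁ : s₁.nreg rF = F := by rw [hfr₁.n _ rfl, hF]
  simp only [runs_seq, runs_setN]
  refine ⟨by simp [hD₁]; omega, (runs_bucketSort (F := F) (G := D + 2) (by decide) (by decide)
    (by simpa using hF₁) (by simp [hD₁]) hFM hDM hFW (by omega) (by omega) ?_ ?_).mono ?_⟩
  · intro x hx
    have := hkeylt x
    simpa [hk₁ x hx] using this
  · simpa [hfr₁.a aHead rfl] using hhead
  rintro t₂ s₂ hfr₂ ⟨ht₂, hs, hhead₂⟩
  have hD₂ : s₂.nreg rD = D := by rw [hfr₂.n _ rfl]; simpa using hD₁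
  have hF₂ : s₂.nreg rF = F := by rw [hfr₂.n _ rfl]; simpa using hF₁
  have hk₂ : ∀ x < F, s₂.narr aKey x = key x := by rw [hfr₂.a _ rfl]; simpa using hk₁
  have hR₂ : s₂.narr aRow = s.narr aRow := by rw [hfr₂.a _ rfl]; simp [hfr₁.a aRow rfl]
  have hC₂ : s₂.narr aCol = s.narr aCol := by rw [hfr₂.a _ rfl]; simp [hfr₁.a aCol rfl]
  have hV₂ : s₂.narr aVal = val := by rw [hfr₂.a _ rfl]; simp [hfr₁.a aVal rfl, hval]
  replace hs : IsSorting F key (s₂.narr aOrd) := ⟨hs.lt, hs.inj, fun x y hxy hy => by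
    have := hs.mono x y hxy hy
    simpa [hk₁ _ (hs.lt x (by omega)), hk₁ _ (hs.lt y hy)] using this⟩
  set ord := s₂.narr aOrd with hord
  -- The threshold is at most `D` because the values have sum at most `D ^ 2`.
  have hT : ∃ T, T ≤ D ∧
      ((Finset.range F).filter fun x => T < val x).card ≤ 2 * D ∧
      (∑ x ∈ Finset.range F, (val x - T) + 2 * D * T ≤ ∑ x ∈ Finset.range F, val x) ∧
      (2 * D < F → T = key (ord (F - (D + D) - 1))) ∧ (F ≤ 2 * D → T = 0) := by
    by_cases hFD : 2 * D < F
    · have hp : F - (D + D) - 1 + 2 * D + 1 = F := by omega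
      have h1 := card_filter_lt_le_of_isSorting hs hp
      have h2 := lt_card_filter_le_of_isSorting hs hp
      set T := key (ord (F - (D + D) - 1)) with hTdef
      have h3 : ((Finset.range F).filter fun x => T ≤ key x).card ≤
          ((Finset.range F).filter fun x => T ≤ val x).card := by
        refine Finset.card_le_card fun x hx => ?_
        rw [Finset.mem_filter] at hx ⊢
        exact ⟨hx.1, hx.2.trans (hkeyle x)⟩
      have hsub := sum_sub_add_mul_le (T := T) (h2.le.trans h3)
      have hTD : T ≤ D := by
        by_contra hcon
        have h4 : (2 * D + 1) * T ≤ D * D := by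
          have := sum_sub_add_mul_le (m := 2 * D + 1) (T := T) (lt_of_lt_of_le h2 h3)
          omega
        have h5 : (2 * D + 1) * (D + 1) ≤ (2 * D + 1) * T := Nat.mul_le_mul_left _ (by omega)
        nlinarith
      refine ⟨T, hTD, (Finset.card_le_card fun x hx => ?_).trans h1, hsub,
        fun _ => rfl, fun h => by omega⟩
      rw [Finset.mem_filter] at hx ⊢
      exact ⟨hx.1, hkeyT x T hTD hx.2⟩
    · refine ⟨0, Nat.zero_le _, ?_, by simp, fun h => absurd h hFD, fun _ => rfl⟩
      refine (Finset.card_filter_le _ _).trans ?_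
      rw [Finset.card_range]
      omega
  obtain ⟨T, hTD, hcard, hsum, hT1, hT2⟩ := hT
  have key₃ : ∀ t₃ s₃, t₃ ≤ 30 → s₃.nreg rT = T → s₃.nreg rF = F →
      (∀ y, s₃.narr y = s₂.narr y) → Runs M W filterCmd s₃ fun t' s'' =>
      t₁ + ((NExp.reg rD + NExp.lit 2).cost + 1 + (t₂ + (t₃ + t'))) ≤ 200 * (F + D) + 300 ∧
      (∀ g, s''.narr aHead g = 0) ∧ s''.nreg rE ≤ 2 * D ∧
      (∀ x < s''.nreg rE, s''.narr aRow x < n) ∧ (∀ x < s''.nreg rE, s''.narr aCol x < n) ∧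
      Keyed (s''.nreg rE) (s''.narr aRow) (s''.narr aCol) ∧
      ∃ T, (∑ x ∈ Finset.range (s''.nreg rE), s''.narr aVal x + 2 * D * T ≤
          ∑ x ∈ Finset.range F, val x) ∧
        ∀ i j, cnt (s''.nreg rE) (s''.narr aRow) (s''.narr aCol) (s''.narr aVal) i j =
          cnt F (s.narr aRow) (s.narr aCol) val i j - T := by
    intro t₃ s₃ ht₃ hT₃ hF₃ ha
    refine (runs_filterCmd hF₃ hT₃ (by rw [ha, ha, ha, hR₂, hC₂, hV₂]; exact hkey) hFM hFW
      (by omega)).mono ?_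
    rintro t₄ s₄ hfr₄ ⟨ht₄, hE₄, hsrc, hk₄, hs₄, hc₄⟩
    rw [ha, hV₂] at hs₄ hE₄
    rw [ha, ha, ha, hR₂, hC₂, hV₂] at hc₄
    rw [ha, ha, hR₂, hC₂] at hsrc
    refine ⟨?_, ?_, by omega, fun x hx => ?_, fun x hx => ?_, hk₄, T, by rw [hs₄]; exact hsum, hc₄⟩
    · simp at ht₁ ⊢
      omega
    · rw [hfr₄.a _ rfl, ha]
      exact hhead₂
    · obtain ⟨z, hz, h1, -⟩ := hsrc x hx
      rw [h1]
      exact hrow z hz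
    · obtain ⟨z, hz, -, h1⟩ := hsrc x hx
      rw [h1]
      exact hcol z hz
  refine Runs.ite ?_ (fun h => ?_) (fun h => ?_)
  · simp [hD₂]
    omega
  · simp [hD₂, hF₂] at h
    have hlt := hs.lt (F - (D + D) - 1) (by omega)
    simp only [runs_setN]
    simp only [NExp.eval_arr, NExp.eval_sub, NExp.eval_reg, NExp.eval_add, NExp.eval_lit, hD₂, hF₂,
      ← hord, NExp.ok_arr, NExp.ok_sub, NExp.ok_add, NExp.ok_reg, NExp.ok_lit, hk₂ _ hlt]
    refine ⟨⟨⟨⟨⟨trivial, trivial, trivial, by omega⟩, by omega⟩, by omega⟩, by omega⟩,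
      key₃ _ _ (by simp) ?_ (by simpa using hF₂) (by simp)⟩
    simp [hT1 (by omega)]
  · simp [hD₂, hF₂] at h
    simp only [runs_setN]
    refine ⟨by simp, key₃ _ _ (by simp) ?_ (by simpa using hF₂) (by simp)⟩
    simp [hT2 (by omega)]

end RealRAM

/-! ### Processing one outer product -/

namespace RealRAM

variable {M W : ℕ}

/-- The memory and word limits are large enough for the parameter `D`. -/
structure Limits (n D M W : ℕ) : Prop where
  hD : 16 ≤ D
  hn : n ≤ D
  hM : 20 * D ≤ M
  hW : 100 * (D * D * (D * D)) ≤ W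

theorem Limits.sq {n D M W : ℕ} (h : Limits n D M W) : 16 * D ≤ D * D :=
  Nat.mul_le_mul_right _ h.hD

theorem Limits.quad {n D M W : ℕ} (h : Limits n D M W) : 16 * (D * D) ≤ D * D * (D * D) :=
  Nat.mul_le_mul_right _ (by have := h.sq; have := h.hD; omega)

theorem cast_div_bounds (m : ℕ) {D : ℕ} (hD : 0 < D) :
    ((m / (D * D) : ℕ) : ℝ) * (D : ℝ) ^ 2 ≤ m ∧
      (m : ℝ) ≤ (((m / (D * D) : ℕ) : ℝ) + 1) * (D : ℝ) ^ 2 := by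
  have h1 : ((m / (D * D) * (D * D) : ℕ) : ℝ) ≤ m := by
    exact_mod_cast Nat.div_mul_le_self m (D * D)
  have h2 : (m : ℝ) ≤ ((D * D * (m / (D * D) + 1) : ℕ) : ℝ) := by
    exact_mod_cast (Nat.lt_mul_div_succ m (Nat.mul_pos hD hD)).le
  rw [Nat.cast_mul, Nat.cast_mul D D] at h1
  rw [Nat.cast_mul, Nat.cast_mul D D, Nat.cast_succ, mul_comm] at h2
  rw [sq]
  exact ⟨h1, h2⟩

/-- Rescaling a counter from the unit `N₀ / D ^ 2` to the unit `N₁ / D ^ 2` loses at most two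
units. -/
theorem rescaled_counter_bounds {D c Θ : ℕ} {N₀ N₁ : ℝ} (hD : 0 < D) (hN₁ : 0 < N₁)
    (hc : c ≤ D * D) (h0 : (Θ : ℝ) ≤ N₀ / N₁ * D ^ 2) (h1 : N₀ / N₁ * D ^ 2 < Θ + 1) :
    ((c * Θ / (D * D) : ℕ) : ℝ) * (N₁ / D ^ 2) ≤ c * (N₀ / D ^ 2) ∧
      (c : ℝ) * (N₀ / D ^ 2) ≤ ((c * Θ / (D * D) : ℕ) : ℝ) * (N₁ / D ^ 2) + 2 * (N₁ / D ^ 2) := by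
  have hQ : (0 : ℝ) < (D : ℝ) ^ 2 := by positivity
  set θ := N₀ / N₁ with hθ
  have hN : N₀ = θ * N₁ := by rw [hθ]; field_simp
  have hu : 0 < N₁ / (D : ℝ) ^ 2 := by positivity
  have hu0 : N₀ / (D : ℝ) ^ 2 = θ * (N₁ / D ^ 2) := by rw [hN]; ring
  set u := N₁ / (D : ℝ) ^ 2
  have hcQ : (c : ℝ) ≤ (D : ℝ) ^ 2 := by
    have : (c : ℝ) ≤ ((D * D : ℕ) : ℝ) := by exact_mod_cast hc
    push_cast at this
    linarith [sq (D : ℝ)]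
  obtain ⟨hq0, hq1⟩ := cast_div_bounds (c * Θ) hD
  rw [Nat.cast_mul] at hq0 hq1
  set q : ℝ := ((c * Θ / (D * D) : ℕ) : ℝ)
  have hc0 : (0 : ℝ) ≤ c := Nat.cast_nonneg _
  rw [hu0]
  constructor
  · have : q ≤ c * θ := by
      refine le_of_mul_le_mul_right (hq0.trans ?_) hQ
      nlinarith
    nlinarith
  · have : c * θ ≤ q + 2 := by
      refine le_of_mul_le_mul_right ?_ hQ
      nlinarith
    nlinarith

/-- The counter value of an entry `x * y` of an outer product with mass `sa * sb`, computed from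
quantized factors, is too small by at most `3 * sa * sb / D` and two units. -/
theorem outer_counter_bounds {D l r Θ : ℕ} {x y sa sb N₀ N₁ : ℝ} (hD : 0 < D)
    (hx0 : 0 ≤ x) (hxs : x ≤ sa) (hy0 : 0 ≤ y) (hys : y ≤ sb) (hsa : 0 < sa) (hsb : 0 < sb)
    (hN₁ : 0 < N₁) (hN : N₁ = N₀ + sa * sb)
    (hl : l = ⌊x * D / sa⌋₊) (hr : r = ⌊y * D / sb⌋₊)
    (h0 : (Θ : ℝ) ≤ N₀ / N₁ * D ^ 2) (h1 : N₀ / N₁ * D ^ 2 < Θ + 1) :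
    ((if D ≤ l * r then l * r * (D * D - Θ - 1) / (D * D) else 0 : ℕ) : ℝ) * (N₁ / D ^ 2) ≤ x * y ∧
      x * y ≤ ((if D ≤ l * r then l * r * (D * D - Θ - 1) / (D * D) else 0 : ℕ) : ℝ) *
        (N₁ / D ^ 2) + 3 * (sa * sb) / D + 2 * (N₁ / D ^ 2) := by
  have hDr : (0 : ℝ) < D := by exact_mod_cast hD
  have hQ : (0 : ℝ) < (D : ℝ) ^ 2 := by positivity
  set u := N₁ / (D : ℝ) ^ 2 with hu
  have hu0 : 0 < u := by positivity
  set α := x / sa with hα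
  set β := y / sb with hβ
  have hxα : x = α * sa := by rw [hα]; field_simp
  have hyβ : y = β * sb := by rw [hβ]; field_simp
  have hα0 : 0 ≤ α := by positivity
  have hβ0 : 0 ≤ β := by positivity
  have hα1 : α ≤ 1 := (div_le_one hsa).2 hxs
  have hβ1 : β ≤ 1 := (div_le_one hsb).2 hys
  have hl' : l = ⌊α * D⌋₊ := by rw [hl, hα]; congr 1; ring
  have hr' : r = ⌊β * D⌋₊ := by rw [hr, hβ]; congr 1; ring
  have hl0 : (l : ℝ) ≤ α * D := by rw [hl']; exact Nat.floor_le (by positivity)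
  have hl1 : α * D < l + 1 := by rw [hl']; exact Nat.lt_floor_add_one _
  have hr0 : (r : ℝ) ≤ β * D := by rw [hr']; exact Nat.floor_le (by positivity)
  have hr1 : β * D < r + 1 := by rw [hr']; exact Nat.lt_floor_add_one _
  set φ := sa * sb / N₁ with hφ
  have hφ0 : 0 ≤ φ := by positivity
  have hθφ : N₀ / N₁ = 1 - φ := by rw [hφ, hN]; rw [hN] at hN₁; field_simp; ring
  have hnk : sa * sb = φ * (D : ℝ) ^ 2 * u := by rw [hφ, hu]; field_simp
  rw [hθφ] at h0 h1
  have hDu : 3 * (sa * sb) / D = 3 * φ * D * u := by rw [hnk]; field_simp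
  have hxy : x * y = α * β * φ * (D : ℝ) ^ 2 * u := by
    rw [hxα, hyβ]; linear_combination α * β * hnk
  have hlr0 : (l : ℝ) * r ≤ α * β * (D : ℝ) ^ 2 := by
    have := mul_le_mul hl0 hr0 (Nat.cast_nonneg _) (by positivity)
    linarith
  have hlr1 : α * β * (D : ℝ) ^ 2 ≤ l * r + 2 * D := by
    have h2 : α * D * (β * D - r) ≤ D * 1 :=
      mul_le_mul (by nlinarith) (by linarith) (by linarith) hDr.le
    have h3 : r * (α * D - l) ≤ D * 1 :=
      mul_le_mul (by nlinarith) (by linarith) (by linarith) hDr.le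
    linarith
  rw [hxy, hDu]
  have hαβ1 : α * β ≤ 1 := mul_le_one₀ hα1 hβ0 hβ1
  have hαβ0 : 0 ≤ α * β := by positivity
  split_ifs with hlr
  · set Φ := D * D - Θ - 1 with hΦ
    have hΦ0 : (Φ : ℝ) ≤ φ * (D : ℝ) ^ 2 := by
      by_cases hle : Θ + 1 ≤ D * D
      · have : (Φ : ℝ) + Θ + 1 = D * D := by
          have : Φ + Θ + 1 = D * D := by omega
          exact_mod_cast this
        linarith [sq (D : ℝ)]
      · have : Φ = 0 := by omega
        rw [this]
        push_cast
        positivity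
    have hΦ1 : φ * (D : ℝ) ^ 2 - 1 ≤ Φ := by
      have : (D : ℝ) * D ≤ Φ + Θ + 1 := by
        have : D * D ≤ Φ + Θ + 1 := by omega
        exact_mod_cast this
      linarith [sq (D : ℝ)]
    have hΦn : (0 : ℝ) ≤ Φ := Nat.cast_nonneg _
    obtain ⟨hq0, hq1⟩ := cast_div_bounds (l * r * Φ) hD
    rw [Nat.cast_mul, Nat.cast_mul] at hq0 hq1
    set q : ℝ := ((l * r * Φ / (D * D) : ℕ) : ℝ)
    constructor
    · refine mul_le_mul_of_nonneg_right (le_of_mul_le_mul_right (hq0.trans ?_) hQ) hu0.le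
      calc (l : ℝ) * r * Φ ≤ α * β * (D : ℝ) ^ 2 * (φ * (D : ℝ) ^ 2) :=
            mul_le_mul hlr0 hΦ0 hΦn (by positivity)
        _ = _ := by ring
    · have h2 : α * β * (D : ℝ) ^ 2 * Φ ≤ (l * r + 2 * D) * Φ :=
        mul_le_mul_of_nonneg_right hlr1 hΦn
      have h3 : 2 * D * Φ ≤ 2 * D * (φ * (D : ℝ) ^ 2) :=
        mul_le_mul_of_nonneg_left hΦ0 (by positivity)
      have h4 : α * β * (D : ℝ) ^ 2 * (φ * (D : ℝ) ^ 2 - 1) ≤ α * β * (D : ℝ) ^ 2 * Φ :=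
        mul_le_mul_of_nonneg_left hΦ1 (by positivity)
      have h5 : α * β * (D : ℝ) ^ 2 ≤ (D : ℝ) ^ 2 := mul_le_of_le_one_left hQ.le hαβ1
      have h6 : α * β * φ * (D : ℝ) ^ 2 ≤ q + 2 * φ * D + 2 := by
        refine le_of_mul_le_mul_right ?_ hQ
        linarith
      have h7 : 0 ≤ φ * D * u := by positivity
      linarith [mul_le_mul_of_nonneg_right h6 hu0.le]
  · have hlt : (l : ℝ) * r ≤ D := by
      have : l * r ≤ D := by omega
      exact_mod_cast this
    push_cast
    constructor
    · rw [zero_mul]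
      positivity
    · have h2 : α * β * (D : ℝ) ^ 2 ≤ 3 * D := by linarith
      have h3 : α * β * (D : ℝ) ^ 2 * (φ * u) ≤ 3 * D * (φ * u) :=
        mul_le_mul_of_nonneg_right h2 (by positivity)
      linarith

/-- The state `s` holds a summary of the matrix `C` with nonnegative entries, after `k` outer
products: a list of at most `2 * D` counters in units of `N / D ^ 2`, where `N` is the sum of the
entries of `C`. The counters never overestimate, and the amount `e` that has been pruned from them
is charged to the part of the mass `N` that is no longer counted. The other two error terms are due
to the rounding of the vectors and to the rounding of the counters in the `k` rescalings. -/
structure Summary (n D k : ℕ) (C : ℕ → ℕ → ℝ) (s : State) : Prop where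
  mass : s.rreg fN = ∑ i ∈ Finset.range n, ∑ j ∈ Finset.range n, C i j
  head : ∀ g, s.narr aHead g = 0
  size : s.nreg rE ≤ 2 * D
  row_lt : ∀ x < s.nreg rE, s.narr aRow x < n
  col_lt : ∀ x < s.nreg rE, s.narr aCol x < n
  keyed : Keyed (s.nreg rE) (s.narr aRow) (s.narr aCol)
  sum_le : ∑ x ∈ Finset.range (s.nreg rE), s.narr aVal x ≤ D * D
  upper : ∀ i j, i < n → j < n →
    (cnt (s.nreg rE) (s.narr aRow) (s.narr aCol) (s.narr aVal) i j : ℝ) *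
      (s.rreg fN / D ^ 2) ≤ C i j
  lower : ∃ e : ℝ, 0 ≤ e ∧ 2 * D * e + (∑ x ∈ Finset.range (s.nreg rE), s.narr aVal x : ℕ) *
      (s.rreg fN / D ^ 2) ≤ s.rreg fN ∧ ∀ i j, i < n → j < n →
      C i j ≤ (cnt (s.nreg rE) (s.narr aRow) (s.narr aCol) (s.narr aVal) i j : ℝ) *
        (s.rreg fN / D ^ 2) + e + 3 * s.rreg fN / D + 4 * k * (s.rreg fN / D ^ 2)

theorem cnt_le_sum (E : ℕ) (row col val : ℕ → ℕ) (i j : ℕ) :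
    cnt E row col val i j ≤ ∑ x ∈ Finset.range E, val x :=
  Finset.sum_le_sum fun x _ => by split_ifs <;> omega

/-- Reads the next column of the left matrix and the next row of the right matrix, and adds their
outer product to the summary. -/
def processOuter : Cmd :=
  loadVector false bA fA ;; loadVector true bB fB ;; .setR fM (.reg fN + .reg fA * .reg fB) ;;
  .ite (.not (.rle (.reg fA * .reg fB) .zero))
    (quantize bA fA aA ;; quantize bB fB aB ;; ratioCmd ;; .setR fN (.reg fM) ;; rescale ;;
      .setN rF (.reg rN) ;; .setN rG (.reg rD + .lit 1) ;; bucketSort aB ;; appendOuter ;;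
      dedupe ;; prune)
    .skip

set_option maxHeartbeats 1000000 in
theorem runs_processOuter {n D k : ℕ} {C : ℕ → ℕ → ℝ} {a b : ℕ → ℝ} {ta tb : List ℝ} {s : State}
    (hL : Limits n D M W) (hn : s.nreg rN = n) (hD : s.nreg rD = D) (hT : s.rarr bT D = D)
    (hS : Summary n D k C s) (hC : ∀ i j, i < n → j < n → 0 ≤ C i j)
    (ha : ∀ i < n, 0 ≤ a i) (hb : ∀ i < n, 0 ≤ b i)
    (hta : s.tape false = (List.range n).map a ++ ta)
    (htb : s.tape true = (List.range n).map b ++ tb) :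
    Runs M W processOuter s fun t s' => t ≤ 3000 * D ∧
      Summary n D (k + 1) (fun i j => C i j + a i * b j) s' ∧
      s'.tape false = ta ∧ s'.tape true = tb := by
  obtain ⟨hN, hhead, hsize, hrow, hcol, hkeyed, hsum, hup, hlow⟩ := hS
  have hsq := hL.sq
  have hquad := hL.quad
  have hD16 := hL.hD
  have hnD := hL.hn
  have hM := hL.hM
  have hW := hL.hW
  set sa := ∑ i ∈ Finset.range n, a i with hsa
  set sb := ∑ i ∈ Finset.range n, b i with hsb
  set N₀ := s.rreg fN with hN₀
  have hsa0 : 0 ≤ sa := Finset.sum_nonneg fun i hi => ha i (Finset.mem_range.1 hi)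
  have hsb0 : 0 ≤ sb := Finset.sum_nonneg fun i hi => hb i (Finset.mem_range.1 hi)
  have hale : ∀ i < n, a i ≤ sa := fun i hi => Finset.single_le_sum (f := a)
    (fun j hj => ha j (Finset.mem_range.1 hj)) (Finset.mem_range.2 hi)
  have hble : ∀ i < n, b i ≤ sb := fun i hi => Finset.single_le_sum (f := b)
    (fun j hj => hb j (Finset.mem_range.1 hj)) (Finset.mem_range.2 hi)
  have hN₀0 : 0 ≤ N₀ := by
    rw [hN]
    exact Finset.sum_nonneg fun i hi => Finset.sum_nonneg fun j hj =>
      hC i j (Finset.mem_range.1 hi) (Finset.mem_range.1 hj)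
  have hN₁ : N₀ + sa * sb =
      ∑ i ∈ Finset.range n, ∑ j ∈ Finset.range n, (C i j + a i * b j) := by
    rw [hN, hsa, hsb, Finset.sum_mul_sum]
    simp only [Finset.sum_add_distrib]
  have hDr : (0 : ℝ) < D := by exact_mod_cast (by omega : 0 < D)
  unfold processOuter
  simp only [runs_seq]
  refine (runs_loadVector (by decide) hn hta (by omega) (by omega) (by omega)).mono ?_
  rintro t₁ s₁ hf₁ ⟨ht₁, ha₁, hsa₁, hta₁⟩
  refine (runs_loadVector (d := true) (f := b) (rest := tb) (by decide)
    (by rw [hf₁.n _ rfl, hn]) (by rw [hf₁.t _ rfl, htb]) (by omega) (by omega) (by omega)).mono ?_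
  rintro t₂ s₂ hf₂ ⟨ht₂, hb₂, hsb₂, htb₂⟩
  have hfA₂ : s₂.rreg fA = sa := by rw [hf₂.r _ rfl, hsa₁]
  have hfN₂ : s₂.rreg fN = N₀ := by rw [hf₂.r _ rfl, hf₁.r _ rfl]
  have ha₂ : ∀ i < n, s₂.rarr bA i = a i := by rw [hf₂.b _ rfl]; exact ha₁
  have hn₂ : s₂.nreg rN = n := by rw [hf₂.n _ rfl, hf₁.n _ rfl, hn]
  have hD₂ : s₂.nreg rD = D := by rw [hf₂.n _ rfl, hf₁.n _ rfl, hD]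
  have hE₂ : s₂.nreg rE = s.nreg rE := by rw [hf₂.n _ rfl, hf₁.n _ rfl]
  have hT₂ : s₂.rarr bT D = D := by rw [hf₂.b _ rfl, hf₁.b _ rfl, hT]
  have harr₂ : s₂.narr = s.narr := by
    funext y
    rw [hf₂.a _ rfl, hf₁.a _ rfl]
  have hta₂ : s₂.tape false = ta := by rw [hf₂.t _ rfl, hta₁]
  simp only [runs_setR]
  refine ⟨by simp, Runs.ite (by simp) (fun hp => ?_) (fun hp => ?_)⟩
  swap
  · -- An outer product without mass is zero, and nothing has to be done.
    simp [hfA₂, hsb₂] at hp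
    rw [← hsb] at hp
    have hz : sa * sb = 0 := le_antisymm hp (mul_nonneg hsa0 hsb0)
    have hab : ∀ i j, i < n → j < n → a i * b j = 0 := fun i j hi hj => by
      rcases mul_eq_zero.1 hz with h | h
      · have := le_antisymm (h ▸ hale i hi) (ha i hi)
        rw [this, zero_mul]
      · have := le_antisymm (h ▸ hble j hj) (hb j hj)
        rw [this, mul_zero]
    rw [hz, add_zero] at hN₁
    simp
    refine ⟨by omega, ?_, hta₂, htb₂⟩
    obtain ⟨e, he0, he1, he2⟩ := hlow
    refine ⟨?_, ?_, ?_, ?_, ?_, ?_, ?_, ?_, e, he0, ?_, ?_⟩ <;>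
      simp only [State.nreg_setR, State.narr_setR, State.rreg_setR, harr₂, hE₂, hfN₂,
        show fN ≠ fM by decide, if_false]
    · exact hN₁
    · exact hhead
    · exact hsize
    · exact hrow
    · exact hcol
    · exact hkeyed
    · exact hsum
    · intro i j hi hj
      rw [hab i j hi hj, add_zero]
      exact hup i j hi hj
    · exact he1
    · intro i j hi hj
      rw [hab i j hi hj, add_zero]
      refine (he2 i j hi hj).trans ?_
      have : 0 ≤ N₀ / (D : ℝ) ^ 2 := by positivity
      push_cast
      linarith
  · simp [hfA₂, hsb₂] at hp
    rw [← hsb] at hp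
    have hsa1 : 0 < sa := by
      rcases hsa0.lt_or_eq with h | h
      · exact h
      · rw [← h, zero_mul] at hp
        exact absurd hp (lt_irrefl _)
    have hsb1 : 0 < sb := by
      rcases hsb0.lt_or_eq with h | h
      · exact h
      · rw [← h, mul_zero] at hp
        exact absurd hp (lt_irrefl _)
    set N₁ := N₀ + sa * sb with hN₁def
    have hN₁0 : 0 < N₁ := by linarith
    have hθ0 : 0 ≤ N₀ / N₁ := by positivity
    have hθ1 : N₀ / N₁ ≤ 1 := (div_le_one hN₁0).2 (by linarith)
    set s₃ := s₂.setR fM (RExp.eval s₂ (.reg fN + .reg fA * .reg fB)) with hs₃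
    have hfM₃ : s₃.rreg fM = N₁ := by
      simp [hs₃, hfN₂, hfA₂, hsb₂, ← hsb, hN₁def]
    have hrr₃ : ∀ y, y ≠ fM → s₃.rreg y = s₂.rreg y := fun y hy => by simp [hs₃, hy]
    have hnr₃ : s₃.nreg = s₂.nreg := rfl
    have hna₃ : s₃.narr = s.narr := harr₂
    have hra₃ : s₃.rarr = s₂.rarr := rfl
    have htp₃ : s₃.tape = s₂.tape := rfl
    simp only [runs_seq]
    -- Quantization of the two vectors.
    refine (runs_quantize (n := n) (D := D) (f := a) (by decide) (by rw [hnr₃, hn₂])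
      (by rw [hnr₃, hD₂]) (by rw [hra₃, hT₂]) ha hsa1 (by rw [hra₃]; exact ha₂)
      (by rw [hrr₃ _ (by decide), hfA₂]) (by omega) (by omega) (by omega) (by omega)
      (by omega)).mono ?_
    rintro t₄ s₄ hf₄ ⟨ht₄, hq₄⟩
    refine (runs_quantize (n := n) (D := D) (f := b) (by decide)
      (by rw [hf₄.n _ rfl, hnr₃, hn₂]) (by rw [hf₄.n _ rfl, hnr₃, hD₂])
      (by rw [hf₄.b _ rfl, hra₃, hT₂]) hb hsb1 (by rw [hf₄.b _ rfl, hra₃]; exact hb₂)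
      (by rw [hf₄.r _ rfl, hrr₃ _ (by decide), hsb₂]) (by omega) (by omega) (by omega) (by omega)
      (by omega)).mono ?_
    rintro t₅ s₅ hf₅ ⟨ht₅, hq₅⟩
    have hA₅ : ∀ i < n, s₅.narr aA i = quant n D a i := by rw [hf₅.a _ rfl]; exact hq₄
    have hD₅ : s₅.nreg rD = D := by rw [hf₅.n _ rfl, hf₄.n _ rfl, hnr₃, hD₂]
    have hfM₅ : s₅.rreg fM = N₁ := by rw [hf₅.r _ rfl, hf₄.r _ rfl, hfM₃]
    have hfN₅ : s₅.rreg fN = N₀ := by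
      rw [hf₅.r _ rfl, hf₄.r _ rfl, hrr₃ _ (by decide), hfN₂]
    refine (runs_ratioCmd (D := D) (θ := N₀ / N₁) hD₅ (by rw [hf₅.b _ rfl, hf₄.b _ rfl, hra₃, hT₂])
      (by rw [hfM₅]; exact hN₁0.ne') (by rw [hfM₅, hfN₅]) hθ0 hθ1 (by omega) (by omega)
      (by omega)).mono ?_
    rintro t₆ s₆ hf₆ ⟨ht₆, hΘ0, hΘ1, hΦ⟩
    set Θ := s₆.nreg rTh with hΘ
    have hΘD : Θ ≤ D * D := by
      have : (Θ : ℝ) ≤ D * D := by nlinarith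
      exact_mod_cast this
    simp only [runs_setR]
    refine ⟨by simp, ?_⟩
    have hfM₆ : s₆.rreg fM = N₁ := by rw [hf₆.r _ rfl, hfM₅]
    set s₇ := s₆.setR fN (RExp.eval s₆ (.reg fM)) with hs₇
    have hfN₇ : s₇.rreg fN = N₁ := by simp [hs₇, hfM₆]
    have hn₇ : s₇.nreg = s₆.nreg := rfl
    have ha₇ : s₇.narr = s₆.narr := rfl
    have htp₇ : s₇.tape = s₂.tape := by
      funext y
      change s₆.tape y = _
      rw [hf₆.t _ rfl, hf₅.t _ rfl, hf₄.t _ rfl, htp₃]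
    have hE₇ : s₇.nreg rE = s.nreg rE := by
      rw [hn₇, hf₆.n _ rfl, hf₅.n _ rfl, hf₄.n _ rfl, hnr₃, hE₂]
    have hN₇ : s₇.nreg rN = n := by
      rw [hn₇, hf₆.n _ rfl, hf₅.n _ rfl, hf₄.n _ rfl, hnr₃, hn₂]
    have hD₇ : s₇.nreg rD = D := by rw [hn₇, hf₆.n _ rfl, hD₅]
    have hkeep : ∀ y, y ≠ aA → y ≠ aB → s₇.narr y = s.narr y := fun y h0 h1 => by
      rw [ha₇, hf₆.a _ rfl, hf₅.a _ (by simp [quantize, Cmd.forN, Cmd.wA, floorCmd, h1.symm]),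
        hf₄.a _ (by simp [quantize, Cmd.forN, Cmd.wA, floorCmd, h0.symm]), hna₃]
    have hval₇ : ∀ x < s.nreg rE, s₇.narr aVal x ≤ D * D := fun x hx => by
      rw [hkeep _ (by decide) (by decide)]
      exact (Finset.single_le_sum (f := s.narr aVal) (fun _ _ => Nat.zero_le _)
        (Finset.mem_range.2 hx)).trans hsum
    refine (runs_rescale hE₇ hD₇ (Θ := Θ) rfl (by omega) hval₇ hΘD (by omega) (by omega)
      (by omega)).mono ?_
    rintro t₈ s₈ hf₈ ⟨ht₈, hv₈⟩
    rw [hkeep aVal (by decide) (by decide)] at hv₈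
    have hn₈ : s₈.nreg rN = n := by rw [hf₈.n _ rfl, hN₇]
    have hD₈ : s₈.nreg rD = D := by rw [hf₈.n _ rfl, hD₇]
    have hB₈ : ∀ i < n, s₈.narr aB i = quant n D b i := by
      rw [hf₈.a _ rfl, ha₇, hf₆.a _ rfl]
      exact hq₅
    have hA₈ : ∀ i < n, s₈.narr aA i = quant n D a i := by
      rw [hf₈.a _ rfl, ha₇, hf₆.a _ rfl]
      exact hA₅
    have hh₈ : s₈.narr aHead = s.narr aHead := by
      rw [hf₈.a _ rfl, hkeep _ (by decide) (by decide)]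
    have hr₈ : s₈.narr aRow = s.narr aRow := by
      rw [hf₈.a _ rfl, hkeep _ (by decide) (by decide)]
    have hc₈ : s₈.narr aCol = s.narr aCol := by
      rw [hf₈.a _ rfl, hkeep _ (by decide) (by decide)]
    -- The columns are sorted, and the large entries of the outer product are appended.
    simp only [runs_setN]
    refine ⟨by simp, by simp [hD₈]; omega, (runs_bucketSort (F := n) (G := D + 1) (by decide)
      (by decide) (by simp [hn₈]) (by simp [hD₈]) (by omega) (by omega) (by omega) (by omega)
      (by omega) ?_ ?_).mono ?_⟩
    · intro i hi
      have := quant_le (D := D) hb hsb1 hi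
      simp [hB₈ i hi]
      omega
    · simpa [hh₈] using hhead
    rintro t₉ s₉ hf₉ ⟨ht₉, hs₉, hh₉⟩
    have hn₉ : s₉.nreg rN = n := by rw [hf₉.n _ rfl]; simpa using hn₈
    have hD₉ : s₉.nreg rD = D := by rw [hf₉.n _ rfl]; simpa using hD₈
    have hE₉ : s₉.nreg rE = s.nreg rE := by
      rw [hf₉.n _ rfl]
      simpa [hf₈.n rE rfl] using hE₇
    have hΦ₉ : s₉.nreg rPh = D * D - Θ - 1 := by
      rw [hf₉.n _ rfl]
      simpa [hf₈.n rPh rfl, hn₇] using hΦ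
    have hB₉ : s₉.narr aB = s₈.narr aB := by rw [hf₉.a _ rfl]; simp
    have hA₉ : s₉.narr aA = s₈.narr aA := by rw [hf₉.a _ rfl]; simp
    have hr₉ : s₉.narr aRow = s.narr aRow := by rw [hf₉.a _ rfl]; simpa using hr₈
    have hc₉ : s₉.narr aCol = s.narr aCol := by rw [hf₉.a _ rfl]; simpa using hc₈
    have hv₉ : s₉.narr aVal = s₈.narr aVal := by rw [hf₉.a _ rfl]; simp
    refine (runs_appendOuter (n := n) (E := s.nreg rE) (D := D) (Φ := D * D - Θ - 1)
      (l := quant n D a) (r := quant n D b) hn₉ hE₉ hD₉ hΦ₉ (by omega) (by rw [hA₉]; exact hA₈)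
      (by rw [hB₉]; exact hB₈) (by rw [hB₉]; simpa using hs₉) (sum_quant_le ha hsa1)
      (sum_quant_le hb hsb1) (by omega) (by rw [hr₉]; exact hrow) (by rw [hc₉]; exact hcol)
      (by omega) (by omega) (by omega) (by omega) (by omega)).mono ?_
    rintro t₁₀ s₁₀ hf₁₀ ⟨ht₁₀, hF₁₀, hr₁₀, hc₁₀, hcnt₁₀⟩
    set F := s₁₀.nreg rF with hF
    rw [hr₉, hc₉, hv₉] at hcnt₁₀
    set c₀ := cnt (s.nreg rE) (s.narr aRow) (s.narr aCol) (s.narr aVal) with hc₀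
    set c₁ := cnt F (s₁₀.narr aRow) (s₁₀.narr aCol) (s₁₀.narr aVal) with hc₁
    have hc₁eq : ∀ i j, i < n → j < n → c₁ i j = c₀ i j * Θ / (D * D) +
        if D ≤ quant n D a i * quant n D b j
        then quant n D a i * quant n D b j * (D * D - Θ - 1) / (D * D) else 0 :=
      fun i j hi hj => by
        rw [hcnt₁₀ i j hi hj]
        congr 1
        exact hkeyed.cnt_map (fun v => v * Θ / (D * D)) (by simp) hv₈ i j
    have hold := fun i j => rescaled_counter_bounds (D := D) (c := c₀ i j) (by omega) hN₁0
      ((cnt_le_sum _ _ _ _ _ _).trans hsum) hΘ0 hΘ1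
    have hnew := fun i j (hi : i < n) (hj : j < n) => outer_counter_bounds (D := D) (by omega)
      (ha i hi) (hale i hi) (hb j hj) (hble j hj) hsa1 hsb1 hN₁0 hN₁def
      (l := quant n D a i) (r := quant n D b j) rfl rfl hΘ0 hΘ1
    set u₀ := N₀ / (D : ℝ) ^ 2 with hu₀
    set u₁ := N₁ / (D : ℝ) ^ 2 with hu₁
    have hu₁0 : 0 < u₁ := by positivity
    have hu₀₁ : u₀ ≤ u₁ := by
      rw [hu₀, hu₁]
      gcongr
      linarith
    have hup₁ : ∀ i j, i < n → j < n → (c₁ i j : ℝ) * u₁ ≤ c₀ i j * u₀ + a i * b j :=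
      fun i j hi hj => by
        rw [hc₁eq i j hi hj, Nat.cast_add, add_mul]
        exact add_le_add (hold i j).1 (hnew i j hi hj).1
    have hlow₁ : ∀ i j, i < n → j < n → (c₀ i j : ℝ) * u₀ + a i * b j ≤
        c₁ i j * u₁ + 3 * (sa * sb) / D + 4 * u₁ := fun i j hi hj => by
      rw [hc₁eq i j hi hj, Nat.cast_add, add_mul]
      linarith [(hold i j).2, (hnew i j hi hj).2]
    set V₀ := ∑ x ∈ Finset.range (s.nreg rE), s.narr aVal x with hV₀
    set V₁ := ∑ x ∈ Finset.range F, s₁₀.narr aVal x with hV₁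
    have hV₁c : (V₁ : ℝ) = ∑ i ∈ Finset.range n, ∑ j ∈ Finset.range n, (c₁ i j : ℝ) := by
      rw [hV₁, ← sum_cnt hr₁₀ hc₁₀]
      push_cast
      rfl
    have hV₀c : (V₀ : ℝ) = ∑ i ∈ Finset.range n, ∑ j ∈ Finset.range n, (c₀ i j : ℝ) := by
      rw [hV₀, ← sum_cnt hrow hcol]
      push_cast
      rfl
    have hVle : (V₁ : ℝ) * u₁ ≤ V₀ * u₀ + sa * sb := by
      rw [hV₁c, hV₀c, hsa, hsb, Finset.sum_mul_sum, Finset.sum_mul, Finset.sum_mul,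
        ← Finset.sum_add_distrib]
      refine Finset.sum_le_sum fun i hi => ?_
      rw [Finset.sum_mul, Finset.sum_mul, ← Finset.sum_add_distrib]
      exact Finset.sum_le_sum fun j hj =>
        hup₁ i j (Finset.mem_range.1 hi) (Finset.mem_range.1 hj)
    obtain ⟨e, he0, he1, he2⟩ := hlow
    have hV₁D : V₁ ≤ D * D := by
      have h1 : (V₁ : ℝ) * u₁ ≤ N₁ := by
        have : 0 ≤ 2 * D * e := by positivity
        linarith
      have h2 : N₁ = (D * D) * u₁ := by rw [hu₁]; field_simp
      rw [h2] at h1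
      have := le_of_mul_le_mul_right h1 hu₁0
      exact_mod_cast this
    have hF3 : F ≤ 3 * D := by omega
    -- Duplicates are merged, and small counters are removed.
    refine (runs_dedupe (n := n) (F := F) (V := V₁) (by rw [hf₁₀.n _ rfl, hn₉]) rfl hr₁₀ hc₁₀ rfl
      (by rw [hf₁₀.a _ rfl]; exact hh₉) (by omega) (by omega) (by omega) (by omega) (by omega)
      (by omega)).mono ?_
    rintro t₁₁ s₁₁ hf₁₁ ⟨ht₁₁, hh₁₁, hcnt₁₁, hnz₁₁⟩
    have hr₁₁ : s₁₁.narr aRow = s₁₀.narr aRow := hf₁₁.a _ rfl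
    have hc₁₁ : s₁₁.narr aCol = s₁₀.narr aCol := hf₁₁.a _ rfl
    have hV₁₁ : ∑ x ∈ Finset.range F, s₁₁.narr aVal x = V₁ := by
      rw [hV₁, ← sum_cnt (n := n) (row := s₁₁.narr aRow) (col := s₁₁.narr aCol)
        (by rw [hr₁₁]; exact hr₁₀) (by rw [hc₁₁]; exact hc₁₀), ← sum_cnt hr₁₀ hc₁₀]
      simp only [hcnt₁₁]
    refine (runs_prune (n := n) (F := F) (D := D) (by rw [hf₁₁.n _ rfl])
      (by rw [hf₁₁.n _ rfl, hf₁₀.n _ rfl, hD₉]) hnz₁₁ (by rw [hr₁₁]; exact hr₁₀)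
      (by rw [hc₁₁]; exact hc₁₀) (by rw [hV₁₁]; exact hV₁D) hh₁₁ (by omega) (by omega) (by omega)
      (by omega)).mono ?_
    rintro t₁₂ s₁₂ hf₁₂ ⟨ht₁₂, hh₁₂, hE₁₂, hr₁₂, hc₁₂, hk₁₂, T, hVT, hcT⟩
    have htp₁₂ : ∀ y, s₁₂.tape y = s₂.tape y := fun y => by
      rw [hf₁₂.t _ rfl, hf₁₁.t _ rfl, hf₁₀.t _ rfl, hf₉.t _ rfl]
      simp only [State.tape_setN]
      rw [hf₈.t _ rfl, htp₇]
    have hfN₁₂ : s₁₂.rreg fN = N₁ := by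
      rw [hf₁₂.r _ rfl, hf₁₁.r _ rfl, hf₁₀.r _ rfl, hf₉.r _ rfl]
      simp only [State.rreg_setN]
      rw [hf₈.r _ rfl, hfN₇]
    rw [hV₁₁] at hVT
    have hcT' : ∀ i j, cnt (s₁₂.nreg rE) (s₁₂.narr aRow) (s₁₂.narr aCol) (s₁₂.narr aVal) i j =
        c₁ i j - T := fun i j => by rw [hcT, hcnt₁₁]
    refine ⟨?_, ⟨?_, hh₁₂, hE₁₂, hr₁₂, hc₁₂, hk₁₂, by omega, ?_, e + T * u₁, by positivity, ?_, ?_⟩,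
      by rw [htp₁₂, hta₂], by rw [htp₁₂, htb₂]⟩
    · simp at ht₁₂ ⊢
      omega
    · rw [hfN₁₂, hN₁]
    · intro i j hi hj
      rw [hcT' i j, hfN₁₂]
      have h1 : ((c₁ i j - T : ℕ) : ℝ) ≤ c₁ i j := by exact_mod_cast Nat.sub_le _ _
      have h2 := mul_le_mul_of_nonneg_right h1 hu₁0.le
      linarith [hup₁ i j hi hj, hup i j hi hj]
    · rw [hfN₁₂, ← hu₁]
      set V₂ := ∑ x ∈ Finset.range (s₁₂.nreg rE), s₁₂.narr aVal x
      have h1 : (V₂ : ℝ) + 2 * D * T ≤ V₁ := by exact_mod_cast hVT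
      have h2 := mul_le_mul_of_nonneg_right h1 hu₁0.le
      linarith
    · intro i j hi hj
      rw [hcT' i j, hfN₁₂, ← hu₁]
      have h1 : (c₁ i j : ℝ) ≤ ((c₁ i j - T : ℕ) : ℝ) + T := by
        have : c₁ i j ≤ c₁ i j - T + T := by omega
        exact_mod_cast this
      have h2 := mul_le_mul_of_nonneg_right h1 hu₁0.le
      have h3 : 3 * N₁ / D = 3 * N₀ / D + 3 * (sa * sb) / D := by rw [hN₁def]; ring
      have h4 : 4 * (k : ℝ) * u₀ ≤ 4 * k * u₁ := by gcongr
      have h5 := hlow₁ i j hi hj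
      have h6 := he2 i j hi hj
      push_cast
      linarith

end RealRAM

/-! ### A family of hash functions -/

namespace RealRAM

/-- The hash function with multiplier `a` into `m` values, for keys below the prime `p`. -/
def hash (p m a x : ℕ) : ℕ := a * x % p % m

/-- For two different keys, at most `2 * (p - 1) / m` multipliers lead to a collision: the
difference of the residues of `a * x` and `a * y` determines `a`, and in case of a collision it is
a nonzero multiple of `m`. -/
theorem card_collision_mul_le {p m x y : ℕ} (hp : p.Prime) (hm : 0 < m) (hx : x < p) (hy : y < p)
    (hxy : x ≠ y) :
    ((Finset.Ico 1 p).filter fun a => hash p m a x = hash p m a y).card * m ≤ 2 * (p - 1) := by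
  have := Fact.mk hp
  have hxyZ : (x : ZMod p) - y ≠ 0 := by
    rw [sub_ne_zero]
    intro h
    rw [ZMod.natCast_eq_natCast_iff'] at h
    rw [Nat.mod_eq_of_lt hx, Nat.mod_eq_of_lt hy] at h
    exact hxy h
  have hmZ : (0 : ℤ) < m := by exact_mod_cast hm
  set d : ℕ → ℤ := fun a => ((a * x % p : ℕ) : ℤ) - ((a * y % p : ℕ) : ℤ) with hd
  have hcast : ∀ a, ((d a : ℤ) : ZMod p) = a * ((x : ZMod p) - y) := fun a => by
    simp only [hd, Int.cast_sub, Int.cast_natCast, ZMod.natCast_mod, Nat.cast_mul]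
    ring
  set q : ℤ := ((p - 1 : ℕ) : ℤ) / m with hq
  have hq0 : 0 ≤ q := Int.ediv_nonneg (Int.natCast_nonneg _) hmZ.le
  have hdvd : ∀ a, hash p m a x = hash p m a y → (m : ℤ) ∣ d a := fun a h =>
    (Nat.modEq_iff_dvd (n := m) (a := a * y % p) (b := a * x % p)).1 h.symm
  have hcard : ((Finset.Ico 1 p).filter fun a => hash p m a x = hash p m a y).card ≤
      ((Finset.Icc (-q) q).erase 0).card := by
    refine Finset.card_le_card_of_injOn (fun a => d a / m) ?_ ?_
    · intro a ha
      rw [Finset.mem_coe, Finset.mem_filter, Finset.mem_Ico] at ha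
      obtain ⟨⟨ha1, hap⟩, hh⟩ := ha
      obtain ⟨k, hk⟩ := hdvd a hh
      have hlt1 : a * x % p < p := Nat.mod_lt _ hp.pos
      have hlt2 : a * y % p < p := Nat.mod_lt _ hp.pos
      have hdiv : d a / m = k := by rw [hk]; exact Int.mul_ediv_cancel_left _ hmZ.ne'
      change d a / m ∈ ((((Finset.Icc (-q) q).erase 0 : Finset ℤ)) : Set ℤ)
      rw [Finset.mem_coe, hdiv, Finset.mem_erase, Finset.mem_Icc]
      refine ⟨?_, ?_, ?_⟩
      · rintro rfl
        have h0 := hcast a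
        rw [hk, mul_zero, Int.cast_zero, eq_comm, mul_eq_zero] at h0
        rcases h0 with h0 | h0
        · rw [ZMod.natCast_eq_zero_iff] at h0
          exact absurd (Nat.le_of_dvd ha1 h0) (by omega)
        · exact hxyZ h0
      · have : -k ≤ q := by
          rw [hq, Int.le_ediv_iff_mul_le hmZ]
          have : -k * m = -d a := by rw [hk]; ring
          rw [this]
          simp only [hd]
          omega
        omega
      · rw [hq, Int.le_ediv_iff_mul_le hmZ]
        have : k * m = d a := by rw [hk]; ring
        rw [this]
        simp only [hd]
        omega
    · intro a ha a' ha' haa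
      rw [Finset.mem_coe, Finset.mem_filter, Finset.mem_Ico] at ha ha'
      have h1 : d a = d a' := by
        rw [← Int.ediv_mul_cancel (hdvd a ha.2), ← Int.ediv_mul_cancel (hdvd a' ha'.2)]
        simp only at haa
        rw [haa]
      have h2 := hcast a
      rw [h1, hcast a'] at h2
      have h3 := mul_right_cancel₀ hxyZ h2
      rw [ZMod.natCast_eq_natCast_iff', Nat.mod_eq_of_lt ha.1.2, Nat.mod_eq_of_lt ha'.1.2] at h3
      exact h3.symm
  rw [Finset.card_erase_of_mem (Finset.mem_Icc.2 ⟨by omega, hq0⟩), Int.card_Icc] at hcard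
  have hqm : q * m ≤ (p - 1 : ℕ) := Int.ediv_mul_le _ hmZ.ne'
  have hc' : (((Finset.Ico 1 p).filter fun a => hash p m a x = hash p m a y).card : ℤ) ≤ 2 * q := by
    omega
  have h4 := mul_le_mul_of_nonneg_right hc' hmZ.le
  have h5 : (((Finset.Ico 1 p).filter fun a => hash p m a x = hash p m a y).card : ℤ) * m ≤
      2 * (p - 1 : ℕ) := by linarith
  exact_mod_cast h5

/-- The number of colliding pairs among the first `L` terms of the sequence `h`. -/
def collisions (h : ℕ → ℕ) (L : ℕ) : ℕ :=
  ∑ z ∈ Finset.range L, ((Finset.range z).filter fun y => h y = h z).card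

theorem collisions_le (h : ℕ → ℕ) (L : ℕ) : collisions h L ≤ L * L := by
  have : collisions h L ≤ ∑ _z ∈ Finset.range L, L := by
    refine Finset.sum_le_sum fun z hz => (Finset.card_filter_le _ _).trans ?_
    rw [Finset.card_range]
    exact (Finset.mem_range.1 hz).le
  simpa using this

/-- Some multiplier has at most the average number of collisions. -/
theorem exists_multiplier {p m L : ℕ} {κ : ℕ → ℕ} (hp : p.Prime) (hm : 0 < m)
    (hκ : ∀ z < L, κ z < p) (hinj : ∀ y z, y < L → z < L → κ y = κ z → y = z) :
    ∃ a, 1 ≤ a ∧ a < p ∧ collisions (fun z => hash p m a (κ z)) L * m ≤ L * (L - 1) := by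
  have hne : (Finset.Ico 1 p).Nonempty := ⟨1, Finset.mem_Ico.2 ⟨le_rfl, hp.one_lt⟩⟩
  have hsum : ∑ a ∈ Finset.Ico 1 p, collisions (fun z => hash p m a (κ z)) L * m ≤
      ∑ _a ∈ Finset.Ico 1 p, L * (L - 1) := by
    rw [Finset.sum_const, Nat.card_Ico, smul_eq_mul, ← Finset.sum_mul]
    simp only [collisions, Finset.card_filter]
    rw [Finset.sum_comm, Finset.sum_congr rfl fun z _ => Finset.sum_comm]
    simp only [← Finset.card_filter]
    calc _ ≤ ∑ z ∈ Finset.range L, ∑ y ∈ Finset.range z, 2 * (p - 1) := by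
          rw [Finset.sum_mul]
          refine Finset.sum_le_sum fun z hz => ?_
          rw [Finset.sum_mul]
          refine Finset.sum_le_sum fun y hy => ?_
          have hz := Finset.mem_range.1 hz
          have hy := Finset.mem_range.1 hy
          exact card_collision_mul_le hp hm (hκ y (by omega)) (hκ z hz)
            fun h => absurd (hinj y z (by omega) hz h) (by omega)
      _ = (p - 1) * (L * (L - 1)) := by
          simp only [Finset.sum_const, Finset.card_range, smul_eq_mul]
          rw [← Finset.sum_mul, ← Finset.sum_range_id_mul_two]
          ring
  obtain ⟨a, ha, hle⟩ := Finset.exists_le_of_sum_le hne hsum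
  rw [Finset.mem_Ico] at ha
  exact ⟨a, ha.1, ha.2, hle⟩

/-- The number of ordered pairs of equal terms among the first `q` terms of the sequence `g`. -/
def pairCount (q : ℕ) (g : ℕ → ℕ) : ℕ :=
  ∑ x ∈ Finset.range q, ∑ y ∈ Finset.range q, if g x = g y then 1 else 0

theorem pairCount_congr {q : ℕ} {g g' : ℕ → ℕ} (h : ∀ x < q, g x = g' x) :
    pairCount q g = pairCount q g' := by
  refine Finset.sum_congr rfl fun x hx => Finset.sum_congr rfl fun y hy => ?_
  rw [h x (Finset.mem_range.1 hx), h y (Finset.mem_range.1 hy)]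

theorem pairCount_mono {q q' : ℕ} {g : ℕ → ℕ} (h : q ≤ q') : pairCount q g ≤ pairCount q' g := by
  unfold pairCount
  refine (Finset.sum_le_sum_of_subset (Finset.range_mono h)).trans ?_
  exact Finset.sum_le_sum fun x _ => Finset.sum_le_sum_of_subset (Finset.range_mono h)

/-- Appending a block whose terms are different from all the earlier ones. -/
theorem pairCount_add {q L : ℕ} {g : ℕ → ℕ} (h : ∀ x y, x < q → y < L → g x ≠ g (q + y)) :
    pairCount (q + L) g = pairCount q g + pairCount L fun z => g (q + z) := by
  unfold pairCount
  rw [Finset.sum_range_add]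
  congr 1
  · refine Finset.sum_congr rfl fun x hx => ?_
    rw [Finset.sum_range_add, Finset.sum_eq_zero (s := Finset.range L), add_zero]
    intro y hy
    rw [if_neg (h x y (Finset.mem_range.1 hx) (Finset.mem_range.1 hy))]
  · refine Finset.sum_congr rfl fun x hx => ?_
    rw [Finset.sum_range_add, Finset.sum_eq_zero (s := Finset.range q), zero_add]
    intro y hy
    rw [if_neg (h y x (Finset.mem_range.1 hy) (Finset.mem_range.1 hx)).symm]

theorem pairCount_const {L g₀ : ℕ} {g : ℕ → ℕ} (h : ∀ z < L, g z = g₀) :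
    pairCount L g = L * L := by
  rw [pairCount_congr h]
  simp [pairCount]

theorem pairCount_eq (L : ℕ) (h : ℕ → ℕ) : pairCount L h = L + 2 * collisions h L := by
  induction L with
  | zero => simp [pairCount, collisions]
  | succ L ih =>
    have h1 : pairCount (L + 1) h =
        pairCount L h + 2 * ((Finset.range L).filter fun y => h y = h L).card + 1 := by
      unfold pairCount
      rw [Finset.sum_range_succ, Finset.sum_congr rfl fun x _ => Finset.sum_range_succ _ L,
        Finset.sum_add_distrib, Finset.sum_range_succ, Finset.card_filter]
      simp only [eq_comm (a := h L), if_true]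
      ring
    rw [h1, ih, collisions, collisions, Finset.sum_range_succ]
    ring

theorem IsSorting.sum_comp {F : ℕ} {key ord : ℕ → ℕ} (h : IsSorting F key ord) (f : ℕ → ℕ) :
    ∑ z ∈ Finset.range F, f (ord z) = ∑ x ∈ Finset.range F, f x := by
  refine Finset.sum_nbij ord ?_ ?_ ?_ fun _ _ => rfl
  · intro z hz
    exact Finset.mem_range.2 (h.lt z (Finset.mem_range.1 hz))
  · intro x hx y hy hxy
    exact h.inj x y (by simpa using hx) (by simpa using hy) hxy
  · intro x hx
    obtain ⟨z, hz, rfl⟩ := h.surj (show x < F by simpa using hx)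
    exact ⟨z, by simpa using hz, rfl⟩

theorem IsSorting.pairCount_comp {F : ℕ} {key ord : ℕ → ℕ} (h : IsSorting F key ord)
    (g : ℕ → ℕ) : pairCount F (fun z => g (ord z)) = pairCount F g := by
  unfold pairCount
  rw [h.sum_comp (f := fun x => ∑ y ∈ Finset.range F, if g x = g (ord y) then 1 else 0)]
  refine Finset.sum_congr rfl fun x _ => ?_
  exact h.sum_comp (f := fun y => if g x = g y then 1 else 0)

end RealRAM

/-! ### Perfect hashing -/

namespace RealRAM

variable {M W : ℕ}

/-- The hash value of the key in position `rQ + rX` of the sorted list. -/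
def hashE : NExp :=
  .reg rA * .arr aCol (.arr aOrd (.reg rQ + .reg rX)) % .reg rP % .reg rS

theorem cost_hashE : hashE.cost = 11 := rfl

theorem eval_hashE {s : State} {a q p m x : ℕ} (hA : s.nreg rA = a) (hQ : s.nreg rQ = q)
    (hP : s.nreg rP = p) (hS : s.nreg rS = m) (hX : s.nreg rX = x) :
    hashE.eval s = hash p m a (s.narr aCol (s.narr aOrd (q + x))) := by
  simp [hashE, hash, hA, hQ, hP, hS, hX]

theorem ok_hashE {s : State} {a q p m x : ℕ} (hA : s.nreg rA = a) (hQ : s.nreg rQ = q)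
    (hP : s.nreg rP = p) (hS : s.nreg rS = m) (hX : s.nreg rX = x) (hap : a ≤ p) (hm : 0 < m)
    (hp : 0 < p) (hk : s.narr aCol (s.narr aOrd (q + x)) ≤ p) (hpW : p * p ≤ W)
    (ho : s.narr aOrd (q + x) < M) (hqM : q + x < M) (hqW : q + x ≤ W) :
    hashE.Ok M W s := by
  have := Nat.mul_le_mul hap hk
  simp [hashE, hA, hQ, hP, hS, hX]
  omega

/-- Counts in `rU` the collisions among the `rL` keys from position `rQ` on, under the hash
function with multiplier `rA` into `rS` values. -/
def countCollisions : Cmd :=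
  .setN rU (.lit 0) ;;
  .forN rX rL (.setN rH hashE ;; .setN rU (.reg rU + .arr aCnt (.reg rH)) ;;
    .storeN aCnt (.reg rH) (.arr aCnt (.reg rH) + .lit 1)) ;;
  .forN rX rL (.storeN aCnt hashE (.lit 0))

theorem runs_countCollisions {s : State} {a q p m L : ℕ} {κ : ℕ → ℕ} (hA : s.nreg rA = a)
    (hQ : s.nreg rQ = q) (hP : s.nreg rP = p) (hS : s.nreg rS = m) (hL : s.nreg rL = L)
    (hκ : ∀ z < L, s.narr aCol (s.narr aOrd (q + z)) = κ z) (hκp : ∀ z < L, κ z < p)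
    (ho : ∀ z < L, s.narr aOrd (q + z) < M) (hap : a ≤ p) (hm : 0 < m) (hp : 0 < p)
    (hpW : p * p ≤ W) (hmM : m ≤ M) (hqM : q + L ≤ M) (hqW : q + L ≤ W) (hLW : L * L + 1 ≤ W)
    (hcnt : ∀ v, s.narr aCnt v = 0) :
    Runs M W countCollisions s fun t s' => t ≤ 70 * L + 20 ∧
      s'.nreg rU = collisions (fun z => hash p m a (κ z)) L ∧ ∀ v, s'.narr aCnt v = 0 := by
  set h : ℕ → ℕ := fun z => hash p m a (κ z) with hh
  have hlt : ∀ z, h z < m := fun z => Nat.mod_lt _ hm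
  unfold countCollisions
  simp only [runs_seq, runs_setN]
  refine ⟨by simp, (Runs.forN (n := L) (f := fun _ => 25) (I := fun k s' =>
    s'.nreg rU = collisions h k ∧
      ∀ v, s'.narr aCnt v = ((Finset.range k).filter fun y => h y = v).card)
    (by decide) rfl rfl (by simpa using hL) (by omega) (by omega) ?_ ?_).mono ?_⟩
  · simpa [collisions] using hcnt
  · rintro k s₁ hk hX - hf ⟨hU, hc⟩
    have hA₁ : s₁.nreg rA = a := by rw [hf.n _ rfl]; simpa using hA
    have hQ₁ : s₁.nreg rQ = q := by rw [hf.n _ rfl]; simpa using hQ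
    have hP₁ : s₁.nreg rP = p := by rw [hf.n _ rfl]; simpa using hP
    have hS₁ : s₁.nreg rS = m := by rw [hf.n _ rfl]; simpa using hS
    have ho₁ : s₁.narr aOrd = s.narr aOrd := by rw [hf.a _ rfl]; simp
    have hκ₁ : s₁.narr aCol (s₁.narr aOrd (q + k)) = κ k := by
      rw [ho₁, hf.a aCol rfl]; simpa using hκ k hk
    have hev : hashE.eval s₁ = h k := by rw [eval_hashE hA₁ hQ₁ hP₁ hS₁ hX, hκ₁]
    have hok : hashE.Ok M W s₁ := ok_hashE hA₁ hQ₁ hP₁ hS₁ hX hap hm hp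
      (by rw [hκ₁]; exact (hκp k hk).le) hpW (by rw [ho₁]; exact ho k hk) (by omega) (by omega)
    have hltk := hlt k
    have hU1 : collisions h (k + 1) ≤ L * L := (collisions_le h (k + 1)).trans
      (Nat.mul_le_mul (by omega) (by omega))
    have hcs : collisions h (k + 1) =
        collisions h k + ((Finset.range k).filter fun y => h y = h k).card :=
      Finset.sum_range_succ _ _
    have hck := hc (h k)
    have hcard : ((Finset.range k).filter fun y => h y = h k).card ≤ k := by
      refine (Finset.card_filter_le _ _).trans ?_
      rw [Finset.card_range]
    simp [hev, hok, cost_hashE, hU, hck]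
    refine ⟨⟨by omega, by omega⟩, ⟨by omega, by omega⟩, by omega, fun v => ?_⟩
    rw [Finset.range_add_one, Finset.filter_insert]
    by_cases hv : h k = v
    · subst hv
      rw [if_pos rfl, Function.update_self, Finset.card_insert_of_notMem (by simp)]
    · rw [if_neg hv, Function.update_of_ne (Ne.symm hv), hc]
  rintro t₁ s₁ hf₁ ⟨ht₁, hU₁, hc₁⟩
  have hA₁ : s₁.nreg rA = a := by rw [hf₁.n _ rfl]; simpa using hA
  have hQ₁ : s₁.nreg rQ = q := by rw [hf₁.n _ rfl]; simpa using hQ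
  have hP₁ : s₁.nreg rP = p := by rw [hf₁.n _ rfl]; simpa using hP
  have hS₁ : s₁.nreg rS = m := by rw [hf₁.n _ rfl]; simpa using hS
  have hL₁ : s₁.nreg rL = L := by rw [hf₁.n _ rfl]; simpa using hL
  have ho₁ : s₁.narr aOrd = s.narr aOrd := by rw [hf₁.a _ rfl]; simp
  have hκ₁ : ∀ z < L, s₁.narr aCol (s₁.narr aOrd (q + z)) = κ z := by
    rw [ho₁, hf₁.a aCol rfl]; simpa using hκ
  -- Only the cells that were used are cleared.
  refine (Runs.forN (n := L) (f := fun _ => 15) (I := fun k s' =>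
    ∀ v, (∀ y, k ≤ y → y < L → h y ≠ v) → s'.narr aCnt v = 0)
    (by decide) rfl rfl hL₁ (by omega) (by omega) ?_ ?_).mono ?_
  · intro v hv
    simp only [State.narr_setN]
    rw [hc₁, Finset.card_eq_zero, Finset.filter_eq_empty_iff]
    intro y hy
    exact hv y (Nat.zero_le _) (Finset.mem_range.1 hy)
  · rintro k s₂ hk hX - hf hc
    have hA₂ : s₂.nreg rA = a := by rw [hf.n _ rfl, hA₁]
    have hQ₂ : s₂.nreg rQ = q := by rw [hf.n _ rfl, hQ₁]
    have hP₂ : s₂.nreg rP = p := by rw [hf.n _ rfl, hP₁]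
    have hS₂ : s₂.nreg rS = m := by rw [hf.n _ rfl, hS₁]
    have ho₂ : s₂.narr aOrd = s.narr aOrd := by rw [hf.a _ rfl, ho₁]
    have hκ₂ : s₂.narr aCol (s₂.narr aOrd (q + k)) = κ k := by
      rw [ho₂, hf.a aCol rfl, ← ho₁]; exact hκ₁ k hk
    have hev : hashE.eval s₂ = h k := by rw [eval_hashE hA₂ hQ₂ hP₂ hS₂ hX, hκ₂]
    have hok : hashE.Ok M W s₂ := ok_hashE hA₂ hQ₂ hP₂ hS₂ hX hap hm hp
      (by rw [hκ₂]; exact (hκp k hk).le) hpW (by rw [ho₂]; exact ho k hk) (by omega) (by omega)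
    have hltk := hlt k
    simp [hev, hok, cost_hashE]
    refine ⟨by omega, fun v hv => ?_⟩
    by_cases hvk : v = h k
    · subst hvk
      simp
    · rw [Function.update_of_ne hvk]
      refine hc v fun y hy hyL => ?_
      rcases hy.lt_or_eq with hy | rfl
      · exact hv y hy hyL
      · exact Ne.symm hvk
  · rintro t₂ s₂ hf₂ ⟨ht₂, hc₂⟩
    refine ⟨?_, ?_, fun v => hc₂ v fun y h1 h2 => by omega⟩
    · simp at ht₁ ht₂ ⊢
      omega
    · rw [hf₂.n _ rfl, hU₁]

/-- Puts into `rA` the first multiplier with at most the average number of collisions. -/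
def findMultiplier : Cmd :=
  .setN rA (.lit 0) ;; .setN rU (.reg rL * .reg rL + .lit 1) ;;
  .loop (.not (.nle (.reg rU * .reg rS) (.reg rL * (.reg rL - .lit 1))))
    (.setN rA (.reg rA + .lit 1) ;; countCollisions)

theorem runs_findMultiplier {s : State} {q p m L : ℕ} {κ : ℕ → ℕ} (hprime : p.Prime)
    (hQ : s.nreg rQ = q) (hP : s.nreg rP = p) (hS : s.nreg rS = m) (hL : s.nreg rL = L)
    (hκ : ∀ z < L, s.narr aCol (s.narr aOrd (q + z)) = κ z) (hκp : ∀ z < L, κ z < p)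
    (hinj : ∀ y z, y < L → z < L → κ y = κ z → y = z)
    (ho : ∀ z < L, s.narr aOrd (q + z) < M) (hm : 0 < m)
    (hpW : p * p ≤ W) (hmM : m ≤ M) (hqM : q + L ≤ M) (hqW : q + L ≤ W)
    (hLW : (L * L + 1) * m ≤ W) (hcnt : ∀ v, s.narr aCnt v = 0) :
    Runs M W findMultiplier s fun t s' => t ≤ p * (70 * L + 50) + 30 ∧ 1 ≤ s'.nreg rA ∧
      s'.nreg rA < p ∧
      collisions (fun z => hash p m (s'.nreg rA) (κ z)) L * m ≤ L * (L - 1) ∧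
      ∀ v, s'.narr aCnt v = 0 := by
  obtain ⟨a₀, ha₀1, ha₀p, ha₀⟩ := exists_multiplier (L := L) hprime hm hκp hinj
  have hp2 := hprime.two_le
  have hLW' : L * L + 1 ≤ W := (Nat.le_mul_of_pos_right _ hm).trans hLW
  have hLL : L * (L - 1) ≤ L * L := Nat.mul_le_mul_left _ (Nat.sub_le _ _)
  have hpp : p ≤ p * p := Nat.le_mul_of_pos_right _ hprime.pos
  have hLLm : L * L + 1 ≤ (L * L + 1) * m := Nat.le_mul_of_pos_right _ hm
  unfold findMultiplier
  simp only [runs_seq, runs_setN]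
  refine ⟨by simp, by simp [hL]; omega, (Runs.loop (I := fun s' => s'.nreg rA < p ∧
    (∀ v, s'.narr aCnt v = 0) ∧
    (∀ a', 1 ≤ a' → a' < s'.nreg rA →
      ¬ collisions (fun z => hash p m a' (κ z)) L * m ≤ L * (L - 1)) ∧
    ((s'.nreg rA = 0 ∧ s'.nreg rU = L * L + 1) ∨
      (1 ≤ s'.nreg rA ∧ s'.nreg rU = collisions (fun z => hash p m (s'.nreg rA) (κ z)) L)))
    (Φ := fun s' => (p - s'.nreg rA) * (70 * L + 50)) ?_ ?_).mono ?_⟩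
  · simp [hL, hprime.pos]
    exact hcnt
  · rintro s₁ hf ⟨hap, hc, hbad, hU⟩
    have hQ₁ : s₁.nreg rQ = q := by rw [hf.n _ rfl]; simpa using hQ
    have hP₁ : s₁.nreg rP = p := by rw [hf.n _ rfl]; simpa using hP
    have hS₁ : s₁.nreg rS = m := by rw [hf.n _ rfl]; simpa using hS
    have hL₁ : s₁.nreg rL = L := by rw [hf.n _ rfl]; simpa using hL
    have ho₁ : s₁.narr aOrd = s.narr aOrd := by rw [hf.a _ rfl]; simp
    have hκ₁ : ∀ z < L, s₁.narr aCol (s₁.narr aOrd (q + z)) = κ z := by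
      rw [ho₁, hf.a aCol rfl]; simpa using hκ
    have hUle : s₁.nreg rU ≤ L * L + 1 := by
      rcases hU with ⟨-, h⟩ | ⟨-, h⟩
      · omega
      · rw [h]
        exact (collisions_le _ _).trans (Nat.le_succ _)
    have hUm : s₁.nreg rU * m ≤ W := (Nat.mul_le_mul_right _ hUle).trans hLW
    refine ⟨?_, fun hcond => ?_⟩
    · simp [hS₁, hL₁]
      omega
    · simp [hS₁, hL₁] at hcond
      have hbad' : ∀ a', 1 ≤ a' → a' < s₁.nreg rA + 1 →
          ¬ collisions (fun z => hash p m a' (κ z)) L * m ≤ L * (L - 1) := fun a' h1 h2 => by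
        rcases (Nat.lt_succ_iff_lt_or_eq.1 h2) with h | rfl
        · exact hbad a' h1 h
        · rcases hU with ⟨h, -⟩ | ⟨-, h⟩
          · omega
          · rw [← h]
            omega
      have hlt : s₁.nreg rA + 1 < p := by
        by_contra hge
        exact hbad' a₀ ha₀1 (by omega) ha₀
      simp only [runs_seq, runs_setN]
      refine ⟨by simp; omega, (runs_countCollisions (a := s₁.nreg rA + 1) (q := q) (p := p) (m := m)
        (L := L) (κ := κ) (by simp) (by simpa using hQ₁) (by simpa using hP₁) (by simpa using hS₁)
        (by simpa using hL₁) (by simpa using hκ₁) hκp (by simpa [ho₁] using ho) hlt.le hm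
        hprime.pos hpW hmM hqM hqW hLW' (by simpa using hc)).mono ?_⟩
      rintro t₂ s₂ hf₂ ⟨ht₂, hU₂, hc₂⟩
      have hA₂ : s₂.nreg rA = s₁.nreg rA + 1 := by rw [hf₂.n _ rfl]; simp
      rw [hA₂]
      refine ⟨⟨hlt, hc₂, hbad', Or.inr ⟨by omega, hU₂⟩⟩, ?_⟩
      obtain ⟨d, hd⟩ : ∃ d, p - s₁.nreg rA = d + 1 := ⟨p - s₁.nreg rA - 1, by omega⟩
      have hd' : p - (s₁.nreg rA + 1) = d := by omega
      rw [hd, hd', add_mul, one_mul]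
      simp
      omega
  · rintro t₁ s₁ hf₁ ⟨⟨hap, hc, -, hU⟩, hcond, ht, -⟩
    have hS₁ : s₁.nreg rS = m := by rw [hf₁.n _ rfl]; simpa using hS
    have hL₁ : s₁.nreg rL = L := by rw [hf₁.n _ rfl]; simpa using hL
    simp [hS₁, hL₁] at hcond
    rcases hU with ⟨-, h⟩ | ⟨h1, h⟩
    · -- The initial value of `rU` is larger than any number of collisions.
      rw [h] at hcond
      omega
    · refine ⟨?_, h1, hap, by rw [← h]; exact hcond, hc⟩
      simp at ht ⊢
      omega

end RealRAM

/-! ### One level of the dictionary -/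

namespace RealRAM

variable {M W : ℕ}

theorem collisions_eq_zero {h : ℕ → ℕ} {L : ℕ} (h0 : collisions h L = 0) :
    ∀ y z, y < L → z < L → h y = h z → y = z := by
  have key : ∀ y z, y < z → z < L → h y ≠ h z := fun y z hyz hz heq => by
    have h1 := (Finset.sum_eq_zero_iff.1 h0) z (Finset.mem_range.2 hz)
    rw [Finset.card_eq_zero, Finset.filter_eq_empty_iff] at h1
    exact h1 (Finset.mem_range.2 hyz) heq
  intro y z hy hz heq
  rcases lt_trichotomy y z with h1 | h1 | h1
  · exact (key y z h1 hz heq).elim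
  · exact h1
  · exact (key z y h1 hy heq.symm).elim

/-- The size of the hash table for `L` keys is one more than this number. -/
def tableSize (sq : Bool) (L : ℕ) : ℕ := if sq then L * L else L

/-- The size of the hash table for `rL` keys. -/
def sizeE (sq : Bool) : NExp :=
  if sq then .reg rL * .reg rL + .lit 1 else .reg rL + .lit 1

theorem eval_sizeE (sq : Bool) (s : State) :
    (sizeE sq).eval s = tableSize sq (s.nreg rL) + 1 := by
  cases sq <;> rfl

theorem cost_sizeE_le (sq : Bool) : (sizeE sq).cost ≤ 5 := by
  cases sq <;> decide

theorem ok_sizeE {sq : Bool} {s : State} (h : s.nreg rL * s.nreg rL + 1 ≤ W)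
    (h' : s.nreg rL + 1 ≤ W) : (sizeE sq).Ok M W s := by
  cases sq <;> simp [sizeE] <;> omega

theorem le_tableSize (sq : Bool) (L : ℕ) : L ≤ tableSize sq L := by
  cases sq
  · exact le_rfl
  · exact Nat.le_mul_self L

theorem tableSize_le (sq : Bool) (L : ℕ) : tableSize sq L ≤ L * L := by
  cases sq
  · exact Nat.le_mul_self L
  · exact le_rfl

/-- One level of the dictionary. The entries `x < E` with column `col x` are divided into the
groups `γ x` with numbers in `[g₀, g₁)`. Every group `g` gets a hash table that occupies the
numbers from `base g` to `base g + mod g - 1`, and `γ'` gives the cells of the entries. The cells,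
with numbers in `[g₁, B)`, are the groups of the next level; at a level with tables of quadratic
size no two entries share a cell. -/
structure IsLayer (sq : Bool) (E p g₀ g₁ B : ℕ) (col γ γ' mul mod base : ℕ → ℕ) : Prop where
  le : g₁ ≤ B
  le_cap : B ≤ g₁ + (g₁ - g₀) + if sq then pairCount E γ else E
  pairs : pairCount E γ' ≤ 3 * E
  inj : sq = true → ∀ x y, x < E → y < E → γ' x = γ' y → x = y
  refines : ∀ x y, x < E → y < E → γ' x = γ' y → γ x = γ y
  range : ∀ x < E, g₁ ≤ γ' x ∧ γ' x < B
  eq : ∀ x < E, γ' x = base (γ x) + hash p (mod (γ x)) (mul (γ x)) (col x)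
  tables : ∀ g, g₀ ≤ g → g < g₁ → 0 < mod g ∧ g₁ ≤ base g ∧ base g + mod g ≤ B ∧ mul g < p

/-- Builds the hash tables for the groups `rI, …, rG - 1` of the entries given by `aGid`, with
cells from `rG` on, and replaces the group of every entry by its cell. At the end `rB` is the first
unused number. -/
def layer (sq : Bool) : Cmd :=
  .setN rF (.reg rE) ;; bucketSort aGid ;; .setN rB (.reg rG) ;; .setN rQ (.lit 0) ;;
  .loop (.nlt (.reg rI) (.reg rG))
    (.setN rY (.reg rQ) ;;
      .loop (.and (.nlt (.reg rY) (.reg rE)) (.neq (.arr aGid (.arr aOrd (.reg rY))) (.reg rI)))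
        (.setN rY (.reg rY + .lit 1)) ;;
      .setN rL (.reg rY - .reg rQ) ;; .setN rS (sizeE sq) ;; findMultiplier ;;
      .storeN aMul (.reg rI) (.reg rA) ;; .storeN aMod (.reg rI) (.reg rS) ;;
      .storeN aBase (.reg rI) (.reg rB) ;;
      .forN rX rL (.storeN aGid (.arr aOrd (.reg rQ + .reg rX)) (.reg rB + hashE)) ;;
      .setN rB (.reg rB + .reg rS) ;; .setN rQ (.reg rY) ;; .setN rI (.reg rI + .lit 1))

/-- What the loop of `layer` has achieved when the groups up to `g` are finished; they fill the
first `q` positions in the sorted order. -/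
structure LayerInv (sq : Bool) (E p g₀ g₁ : ℕ) (col γ ord : ℕ → ℕ) (s₀ s : State)
    (g q B : ℕ) : Prop where
  g₀_le : g₀ ≤ g
  g_le : g ≤ g₁
  q_le : q ≤ E
  done : ∀ z < q, γ (ord z) < g
  todo : ∀ z, q ≤ z → z < E → g ≤ γ (ord z) ∧ s.narr aGid (ord z) = γ (ord z)
  le : g₁ ≤ B
  le_cap : B ≤ g₁ + (g - g₀) + if sq then pairCount q (fun z => γ (ord z)) else q
  pairs : pairCount q (fun z => s.narr aGid (ord z)) ≤ 3 * q
  inj : sq = true → ∀ y z, y < q → z < q → s.narr aGid (ord y) = s.narr aGid (ord z) → y = z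
  refines : ∀ y z, y < q → z < q → s.narr aGid (ord y) = s.narr aGid (ord z) →
    γ (ord y) = γ (ord z)
  range : ∀ z < q, g₁ ≤ s.narr aGid (ord z) ∧ s.narr aGid (ord z) < B
  eq : ∀ z < q, s.narr aGid (ord z) = s.narr aBase (γ (ord z)) +
    hash p (s.narr aMod (γ (ord z))) (s.narr aMul (γ (ord z))) (col (ord z))
  tables : ∀ g', g₀ ≤ g' → g' < g → 0 < s.narr aMod g' ∧ g₁ ≤ s.narr aBase g' ∧
    s.narr aBase g' + s.narr aMod g' ≤ B ∧ s.narr aMul g' < p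
  old : ∀ g' < g₀, s.narr aMod g' = s₀.narr aMod g' ∧ s.narr aMul g' = s₀.narr aMul g' ∧
    s.narr aBase g' = s₀.narr aBase g'
  cnt : ∀ v, s.narr aCnt v = 0

/-- Finishing one more group, which fills the positions from `q` to `q + L - 1`. -/
theorem LayerInv.step {sq : Bool} {E p g₀ g₁ g q B L a : ℕ} {key col γ ord : ℕ → ℕ}
    {s₀ s s' : State} (h : LayerInv sq E p g₀ g₁ col γ ord s₀ s g q B)
    (hs : IsSorting E key ord) (hg : g < g₁) (hqL : q + L ≤ E) (hap : a < p)
    (hblock : ∀ z < L, γ (ord (q + z)) = g)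
    (hrest : ∀ z, q + L ≤ z → z < E → g + 1 ≤ γ (ord z))
    (hcoll : collisions (fun z => hash p (tableSize sq L + 1) a (col (ord (q + z)))) L *
      (tableSize sq L + 1) ≤ L * (L - 1))
    (hnew : ∀ z < L, s'.narr aGid (ord (q + z)) =
      B + hash p (tableSize sq L + 1) a (col (ord (q + z))))
    (hold : ∀ x, (∀ z < L, x ≠ ord (q + z)) → s'.narr aGid x = s.narr aGid x)
    (hmul : s'.narr aMul = Function.update (s.narr aMul) g a)
    (hmod : s'.narr aMod = Function.update (s.narr aMod) g (tableSize sq L + 1))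
    (hbase : s'.narr aBase = Function.update (s.narr aBase) g B)
    (hcnt : ∀ v, s'.narr aCnt v = 0) :
    LayerInv sq E p g₀ g₁ col γ ord s₀ s' (g + 1) (q + L) (B + (tableSize sq L + 1)) := by
  set m := tableSize sq L + 1 with hm
  set κ : ℕ → ℕ := fun z => hash p m a (col (ord (q + z))) with hκ
  have hκm : ∀ z, κ z < m := fun z => Nat.mod_lt _ (by omega)
  have hg0 := h.g₀_le
  have hle := h.le
  have hpos : ∀ z < q, s'.narr aGid (ord z) = s.narr aGid (ord z) := fun z hz =>
    hold _ fun y hy hzy => by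
      have := hs.inj z (q + y) (by omega) (by omega) hzy
      omega
  have hsplit : ∀ z < q + L, z < q ∨ ∃ y < L, z = q + y := fun z hz => by
    by_cases hzq : z < q
    · exact Or.inl hzq
    · exact Or.inr ⟨z - q, by omega, by omega⟩
  have hcross : ∀ x y, x < q → y < L → s'.narr aGid (ord x) ≠ s'.narr aGid (ord (q + y)) :=
    fun x y hx hy => by
      rw [hpos x hx, hnew y hy]
      have := (h.range x hx).2
      omega
  have hLle := le_tableSize sq L
  have hcoll1 : collisions κ L ≤ L := by
    by_contra hcon
    have h1 : (L + 1) * (L + 1) ≤ collisions κ L * m := Nat.mul_le_mul (by omega) (by omega)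
    have h2 : L * (L - 1) ≤ L * L := Nat.mul_le_mul_left _ (Nat.sub_le _ _)
    have h3 : L * L < (L + 1) * (L + 1) := Nat.mul_lt_mul'' (by omega) (by omega)
    omega
  have hcoll0 : sq = true → collisions κ L = 0 := fun hsq => by
    by_contra hcon
    have h1 : 1 * m ≤ collisions κ L * m := Nat.mul_le_mul_right _ (by omega)
    have h2 : L * (L - 1) ≤ L * L := Nat.mul_le_mul_left _ (Nat.sub_le _ _)
    have h3 : m = L * L + 1 := by rw [hm, tableSize, if_pos hsq]
    omega
  have hpc : pairCount L (fun z => s'.narr aGid (ord (q + z))) = L + 2 * collisions κ L := by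
    rw [pairCount_congr (g' := fun z => B + κ z) hnew, ← pairCount_eq]
    simp [pairCount]
  refine ⟨by omega, by omega, hqL, fun z hz => ?_, fun z hz hzE => ?_, by omega, ?_, ?_, ?_, ?_,
    fun z hz => ?_, fun z hz => ?_, fun g' h0 h1 => ?_, fun g' h0 => ?_, hcnt⟩
  · rcases hsplit z hz with h1 | ⟨y, hy, rfl⟩
    · have := h.done z h1
      omega
    · rw [hblock y hy]
      omega
  · refine ⟨hrest z hz hzE, ?_⟩
    rw [hold _ fun y hy hzy => ?_]
    · exact (h.todo z (by omega) hzE).2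
    · have := hs.inj z (q + y) hzE (by omega) hzy
      omega
  · have h1 := h.le_cap
    rw [pairCount_add (q := q) (L := L), pairCount_const hblock]
    · cases sq
      · simp [hm, tableSize] at h1 ⊢
        omega
      · simp [hm, tableSize] at h1 ⊢
        omega
    · intro x y hx hy
      rw [hblock y hy]
      exact (h.done x hx).ne
  · rw [pairCount_add hcross, hpc, pairCount_congr hpos]
    have := h.pairs
    omega
  · intro hsq y z hy hz hyz
    rcases hsplit y hy with h1 | ⟨y, hy', rfl⟩ <;> rcases hsplit z hz with h2 | ⟨z, hz', rfl⟩
    · rw [hpos y h1, hpos z h2] at hyz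
      exact h.inj hsq y z h1 h2 hyz
    · exact (hcross y z h1 hz' hyz).elim
    · exact (hcross z y h2 hy' hyz.symm).elim
    · rw [hnew y hy', hnew z hz'] at hyz
      rw [collisions_eq_zero (hcoll0 hsq) y z hy' hz' (Nat.add_left_cancel hyz)]
  · intro y z hy hz hyz
    rcases hsplit y hy with h1 | ⟨y, hy', rfl⟩ <;> rcases hsplit z hz with h2 | ⟨z, hz', rfl⟩
    · rw [hpos y h1, hpos z h2] at hyz
      exact h.refines y z h1 h2 hyz
    · exact (hcross y z h1 hz' hyz).elim
    · exact (hcross z y h2 hy' hyz.symm).elim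
    · rw [hblock y hy', hblock z hz']
  · rcases hsplit z hz with h1 | ⟨y, hy, rfl⟩
    · rw [hpos z h1]
      have := h.range z h1
      omega
    · rw [hnew y hy]
      have : κ y < m := hκm y
      simp only [hκ] at this
      omega
  · rw [hmul, hmod, hbase]
    rcases hsplit z hz with h1 | ⟨y, hy, rfl⟩
    · have hne : γ (ord z) ≠ g := (h.done z h1).ne
      rw [hpos z h1, Function.update_of_ne hne, Function.update_of_ne hne,
        Function.update_of_ne hne]
      exact h.eq z h1
    · rw [hnew y hy, hblock y hy, Function.update_self, Function.update_self, Function.update_self]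
  · rw [hmul, hmod, hbase]
    by_cases hgg : g' = g
    · subst hgg
      rw [Function.update_self, Function.update_self, Function.update_self]
      omega
    · rw [Function.update_of_ne hgg, Function.update_of_ne hgg, Function.update_of_ne hgg]
      have := h.tables g' h0 (by omega)
      omega
  · have hne : g' ≠ g := by omega
    rw [hmul, hmod, hbase, Function.update_of_ne hne, Function.update_of_ne hne,
      Function.update_of_ne hne]
    exact h.old g' h0

set_option maxHeartbeats 1000000 in
/-- The cost of the search for multipliers adds up to `O(p)` per group and per entry, because the
search for a group of `L` entries takes time `O(p * (L + 1))`. -/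
theorem runs_layer {sq : Bool} {s : State} {n D E p g₀ g₁ : ℕ} (hLim : Limits n D M W)
    (hI : s.nreg rI = g₀) (hG : s.nreg rG = g₁) (hE : s.nreg rE = E) (hP : s.nreg rP = p)
    (hprime : p.Prime) (hpD : p ≤ 2 * D) (hED : E ≤ 2 * D) (hg : g₀ ≤ g₁)
    (hγ : ∀ x < E, g₀ ≤ s.narr aGid x ∧ s.narr aGid x < g₁)
    (hcolp : ∀ x < E, s.narr aCol x < p)
    (hkey : ∀ x y, x < E → y < E → s.narr aGid x = s.narr aGid y → s.narr aCol x = s.narr aCol y →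
      x = y)
    (hcap : g₁ + (g₁ - g₀) + (if sq then pairCount E (s.narr aGid) else E) ≤ 20 * D)
    (hhead : ∀ g, s.narr aHead g = 0) (hcnt : ∀ v, s.narr aCnt v = 0) :
    Runs M W (layer sq) s fun t s' =>
      t ≤ (g₁ - g₀) * (50 * p + 300) + E * (70 * p + 300) + 60 * (E + g₁) + 200 ∧
      IsLayer sq E p g₀ g₁ (s'.nreg rB) (s.narr aCol) (s.narr aGid) (s'.narr aGid) (s'.narr aMul)
        (s'.narr aMod) (s'.narr aBase) ∧
      (∀ g < g₀, s'.narr aMod g = s.narr aMod g ∧ s'.narr aMul g = s.narr aMul g ∧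
        s'.narr aBase g = s.narr aBase g) ∧
      s'.nreg rI = g₁ ∧ (∀ g, s'.narr aHead g = 0) ∧ ∀ v, s'.narr aCnt v = 0 := by
  have hsq := hLim.sq
  have hquad := hLim.quad
  have hD16 := hLim.hD
  have hM := hLim.hM
  have hW := hLim.hW
  set γ := s.narr aGid with hγdef
  set col := s.narr aCol with hcoldef
  have hEE : E * E ≤ 4 * (D * D) := (Nat.mul_le_mul hED hED).trans (by nlinarith)
  have hpp : p * p ≤ 4 * (D * D) := (Nat.mul_le_mul hpD hpD).trans (by nlinarith)
  have hg1D : g₁ ≤ 20 * D := by omega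
  unfold layer
  simp only [runs_seq, runs_setN]
  refine ⟨by simp, (runs_bucketSort (F := E) (G := g₁) (by decide) (by decide) (by simp [hE])
    (by simpa using hG) (by omega) (by omega) (by omega) (by omega) (by omega)
    (fun x hx => by simpa using (hγ x hx).2) (by simpa using hhead)).mono ?_⟩
  rintro t₁ s₁ hf₁ ⟨ht₁, hs, hhead₁⟩
  replace hs : IsSorting E γ (s₁.narr aOrd) := by simpa [hγdef] using hs
  set ord := s₁.narr aOrd with hord
  have hI₁ : s₁.nreg rI = g₀ := by rw [hf₁.n _ rfl]; simpa using hI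
  have hG₁ : s₁.nreg rG = g₁ := by rw [hf₁.n _ rfl]; simpa using hG
  have hE₁ : s₁.nreg rE = E := by rw [hf₁.n _ rfl]; simpa using hE
  have hP₁ : s₁.nreg rP = p := by rw [hf₁.n _ rfl]; simpa using hP
  have harr₁ : ∀ y, y ≠ aHead → y ≠ aNext → y ≠ aOrd → s₁.narr y = s.narr y := fun y h1 h2 h3 => by
    rw [hf₁.a y (by simp [bucketSort, Cmd.forN, Cmd.wA, h1.symm, h2.symm, h3.symm])]
    simp
  have hcol₁ : s₁.narr aCol = col := harr₁ _ (by decide) (by decide) (by decide)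
  have hgid₁ : s₁.narr aGid = γ := harr₁ _ (by decide) (by decide) (by decide)
  refine ⟨by simp, by simp, (Runs.loop (I := fun s' => LayerInv sq E p g₀ g₁ col γ ord s s'
      (s'.nreg rI) (s'.nreg rQ) (s'.nreg rB))
    (Φ := fun s' => (g₁ - s'.nreg rI) * (50 * p + 200) + (E - s'.nreg rQ) * (70 * p + 200))
    ?_ ?_).mono ?_⟩
  · simp only [NExp.eval_reg, State.nreg_setN, NExp.eval_lit]
    norm_num
    rw [hI₁, hG₁]
    refine ⟨le_rfl, hg, Nat.zero_le _, by simp, fun z _ hz => ?_, le_rfl, by omega, by simp [pairCount],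
      by simp, by simp, by simp, by simp, fun g' h0 h1 => by omega, fun g' _ => ?_, fun v => ?_⟩
    · simp [hgid₁]
      exact (hγ _ (hs.lt z hz)).1
    · simp [harr₁]
    · simpa [harr₁] using hcnt v
  · rintro s₂ hf₂ hinv
    have hG₂ : s₂.nreg rG = g₁ := by rw [hf₂.n _ (by cases sq <;> rfl)]; simpa using hG₁
    have hE₂ : s₂.nreg rE = E := by rw [hf₂.n _ (by cases sq <;> rfl)]; simpa using hE₁
    have hP₂ : s₂.nreg rP = p := by rw [hf₂.n _ (by cases sq <;> rfl)]; simpa using hP₁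
    have ho₂ : s₂.narr aOrd = ord := by rw [hf₂.a _ (by cases sq <;> rfl)]; simp [hord]
    have hcol₂ : s₂.narr aCol = col := by rw [hf₂.a _ (by cases sq <;> rfl)]; simpa using hcol₁
    set g := s₂.nreg rI with hgdef
    set q := s₂.nreg rQ with hqdef
    set B := s₂.nreg rB with hBdef
    have hqE := hinv.q_le
    have hg0g := hinv.g₀_le
    refine ⟨by simp, fun hcond => ?_⟩
    simp [hG₂, ← hgdef] at hcond
    simp only [runs_seq, runs_setN]
    -- The group consists of the following positions up to `rY`.
    refine ⟨by simp, (Runs.loop (I := fun s' => q ≤ s'.nreg rY ∧ s'.nreg rY ≤ E ∧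
      ∀ z, q ≤ z → z < s'.nreg rY → γ (ord z) = g) (Φ := fun s' => 30 * (E - s'.nreg rY))
      ?_ ?_).mono ?_⟩
    · simp [← hqdef]
      exact ⟨hqE, fun z h1 h2 => by omega⟩
    · rintro s₃ hf₃ ⟨hqY, hYE, hz⟩
      have hE₃ : s₃.nreg rE = E := by rw [hf₃.n _ rfl]; simpa using hE₂
      have hI₃ : s₃.nreg rI = g := by rw [hf₃.n _ rfl]; simp [hgdef]
      have ho₃ : s₃.narr aOrd = ord := by rw [hf₃.a _ rfl]; simpa using ho₂
      have hgid₃ : s₃.narr aGid = s₂.narr aGid := by rw [hf₃.a _ rfl]; simp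
      refine ⟨?_, fun hc => ?_⟩
      · simp [hE₃, ho₃]
        intro hlt
        have := hs.lt _ hlt
        omega
      · simp [hE₃, hI₃, ho₃, hgid₃] at hc
        have h1 := (hinv.todo _ hqY hc.1).2
        simp
        refine ⟨by omega, ⟨by omega, by omega, fun z h2 h3 => ?_⟩, by omega⟩
        rcases h3.lt_or_eq with h3 | rfl
        · exact hz z h2 h3
        · rw [← h1]
          omega
    rintro t₃ s₃ hf₃ ⟨⟨hqY, hYE, hblock⟩, hc₃, ht₃, -⟩
    have hE₃ : s₃.nreg rE = E := by rw [hf₃.n _ rfl]; simpa using hE₂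
    have hI₃ : s₃.nreg rI = g := by rw [hf₃.n _ rfl]; simp [hgdef]
    have hQ₃ : s₃.nreg rQ = q := by rw [hf₃.n _ rfl]; simp [hqdef]
    have hB₃ : s₃.nreg rB = B := by rw [hf₃.n _ rfl]; simp [hBdef]
    have hP₃ : s₃.nreg rP = p := by rw [hf₃.n _ rfl]; simpa using hP₂
    have harr₃ : s₃.narr = s₂.narr := by funext y; rw [hf₃.a _ rfl]; simp
    obtain ⟨L, hL⟩ : ∃ L, s₃.nreg rY = q + L := ⟨s₃.nreg rY - q, by omega⟩
    rw [hL] at hYE hblock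
    have hrest : ∀ z, q + L ≤ z → z < E → g + 1 ≤ γ (ord z) := fun z h1 h2 => by
      simp [hE₃, hI₃, harr₃, ho₂, hL] at hc₃
      have h3 := hinv.todo (q + L) (by omega) (by omega)
      have h4 := hs.mono (q + L) z h1 h2
      by_contra hcon
      exact absurd (hc₃ (by omega) (by omega)) (by omega)
    have hblock' : ∀ z < L, γ (ord (q + z)) = g := fun z hz => hblock _ (by omega) (by omega)
    set m := tableSize sq L + 1 with hm
    have hLE : L ≤ E := by omega
    have hLL : L * L ≤ 4 * (D * D) := (Nat.mul_le_mul hLE hLE).trans hEE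
    have htL := tableSize_le sq L
    -- The new table fits because the numbers of pairs, or of positions, add up.
    have hBm : B + m ≤ 20 * D := by
      have h1 := hinv.le_cap
      have h2 : pairCount q (fun z => γ (ord z)) + L * L ≤ pairCount E γ := by
        rw [← hs.pairCount_comp γ, ← pairCount_const hblock', ← pairCount_add]
        · exact pairCount_mono hYE
        · intro x y hx hy
          rw [hblock' y hy]
          exact (hinv.done x hx).ne
      cases sq
      · simp [hm, tableSize] at h1 hcap ⊢
        omega
      · simp [hm, tableSize] at h1 hcap ⊢
        omega
    set κ : ℕ → ℕ := fun z => col (ord (q + z)) with hκ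
    have hU : (L * L + 1) * m ≤ W := by
      have h1 : (L * L + 1) * m ≤ (4 * (D * D) + 1) * (4 * (D * D) + 1) :=
        Nat.mul_le_mul (by omega) (by omega)
      nlinarith
    refine ⟨by simp, ok_sizeE (by simp [hL, hQ₃]; omega) (by simp [hL, hQ₃]; omega), ?_⟩
    have hevS : (sizeE sq).eval (s₃.setN rL ((NExp.reg rY - .reg rQ).eval s₃)) = m := by
      rw [eval_sizeE]
      simp [hL, hQ₃, hm]
    rw [hevS]
    refine (runs_findMultiplier (q := q) (p := p) (m := m) (L := L) (κ := κ) hprime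
      (by simpa using hQ₃) (by simpa using hP₃) (by simp) (by simp [hL, hQ₃])
      (by simp [harr₃, ho₂, hcol₂, hκ]) (fun z hz => hcolp _ (hs.lt _ (by omega)))
      (fun y z hy hz hyz => ?_) (fun z hz => ?_) (by omega) (by omega) (by omega) (by omega)
      (by omega) hU (by simpa [harr₃] using hinv.cnt)).mono ?_
    · have := hs.inj (q + y) (q + z) (by omega) (by omega)
        (hkey _ _ (hs.lt _ (by omega)) (hs.lt _ (by omega))
          (by rw [hblock' y hy, hblock' z hz]) hyz)
      omega
    · have := hs.lt (q + z) (by omega)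
      simp [harr₃, ho₂]
      omega
    rintro t₄ s₄ hf₄ ⟨ht₄, hA1, hAp, hcoll, hcnt₄⟩
    set a := s₄.nreg rA with ha
    have hI₄ : s₄.nreg rI = g := by rw [hf₄.n _ rfl]; simpa using hI₃
    have hQ₄ : s₄.nreg rQ = q := by rw [hf₄.n _ rfl]; simpa using hQ₃
    have hB₄ : s₄.nreg rB = B := by rw [hf₄.n _ rfl]; simpa using hB₃
    have hP₄ : s₄.nreg rP = p := by rw [hf₄.n _ rfl]; simpa using hP₃
    have hS₄ : s₄.nreg rS = m := by rw [hf₄.n _ rfl]; simp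
    have hL₄ : s₄.nreg rL = L := by rw [hf₄.n _ rfl]; simp [hL, hQ₃]
    have hY₄ : s₄.nreg rY = q + L := by rw [hf₄.n _ rfl]; simpa using hL
    have harr₄ : ∀ y, y ≠ aCnt → s₄.narr y = s₂.narr y := fun y hy => by
      rw [hf₄.a y (by simp [findMultiplier, countCollisions, Cmd.forN, Cmd.wA, hy.symm])]
      simp [harr₃]
    simp only [runs_storeN]
    refine ⟨⟨by simp, by simp [hI₄]; omega, by simp⟩, ⟨by simp, by simp [hI₄]; omega, by simp⟩,
      ⟨by simp, by simp [hI₄]; omega, by simp⟩, ?_⟩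
    refine (Runs.forN (n := L) (f := fun _ => 40) (I := fun k s' =>
      (∀ z < k, s'.narr aGid (ord (q + z)) = B + hash p m a (κ z)) ∧
      ∀ x, (∀ z < k, x ≠ ord (q + z)) → s'.narr aGid x = s₂.narr aGid x)
      (by decide) rfl rfl (by simpa using hL₄) (by omega) (by omega) ?_ ?_).mono ?_
    · simp [harr₄]
    · rintro k s₅ hk hX - hf₅ ⟨hnew, hold⟩
      have hA₅ : s₅.nreg rA = a := by rw [hf₅.n _ rfl]; simp [ha]
      have hQ₅ : s₅.nreg rQ = q := by rw [hf₅.n _ rfl]; simpa using hQ₄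
      have hB₅ : s₅.nreg rB = B := by rw [hf₅.n _ rfl]; simpa using hB₄
      have hP₅ : s₅.nreg rP = p := by rw [hf₅.n _ rfl]; simpa using hP₄
      have hS₅ : s₅.nreg rS = m := by rw [hf₅.n _ rfl]; simpa using hS₄
      have ho₅ : s₅.narr aOrd = ord := by rw [hf₅.a _ rfl]; simp [harr₄, ho₂]
      have hcol₅ : s₅.narr aCol = col := by rw [hf₅.a _ rfl]; simp [harr₄, hcol₂]
      have hok := hs.lt (q + k) (by omega)
      have hκ₅ : s₅.narr aCol (s₅.narr aOrd (q + k)) = κ k := by rw [ho₅, hcol₅]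
      have hev : hashE.eval s₅ = hash p m a (κ k) := by
        rw [eval_hashE hA₅ hQ₅ hP₅ hS₅ hX, hκ₅]
      have hlt : hash p m a (κ k) < m := Nat.mod_lt _ (by omega)
      have hOk : hashE.Ok M W s₅ := ok_hashE hA₅ hQ₅ hP₅ hS₅ hX hAp.le (by omega) hprime.pos
        (by rw [hκ₅]; exact (hcolp _ hok).le) (by omega) (by rw [ho₅]; omega) (by omega)
        (by omega)
      simp [hev, hOk, cost_hashE, hX, hQ₅, hB₅, ho₅]
      refine ⟨⟨by omega, by omega, by omega⟩, fun z hz => ?_, fun x hx => ?_⟩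
      · rcases hz.lt_or_eq with hz | rfl
        · rw [Function.update_of_ne]
          · exact hnew z hz
          · intro h
            have := hs.inj (q + z) (q + k) (by omega) (by omega) h
            omega
        · simp
      · rw [Function.update_of_ne (hx k le_rfl)]
        exact hold x fun z hz => hx z hz.le
    rintro t₅ s₅ hf₅ ⟨ht₅, hnew, hold⟩
    have hI₅ : s₅.nreg rI = g := by rw [hf₅.n _ rfl]; simpa using hI₄
    have hB₅ : s₅.nreg rB = B := by rw [hf₅.n _ rfl]; simpa using hB₄
    have hS₅ : s₅.nreg rS = m := by rw [hf₅.n _ rfl]; simpa using hS₄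
    have hY₅ : s₅.nreg rY = q + L := by rw [hf₅.n _ rfl]; simpa using hY₄
    simp [hI₅, hB₅, hS₅, hY₅]
    refine ⟨by omega, by omega, ?_, ?_⟩
    · refine hinv.step (a := a) hs hcond hYE hAp hblock' hrest hcoll (by simpa using hnew)
        (by simpa using hold) ?_ ?_ ?_ ?_
      · simp [hf₅.a aMul rfl, hI₄, harr₄, ha]
      · simp [hf₅.a aMod rfl, hI₄, harr₄, hS₄, hm]
      · simp [hf₅.a aBase rfl, hI₄, harr₄, hB₄]
      · simpa [hf₅.a aCnt rfl] using hcnt₄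
    · have hcs := cost_sizeE_le sq
      obtain ⟨d, hd⟩ : ∃ d, g₁ - g = d + 1 := ⟨g₁ - g - 1, by omega⟩
      have hd' : g₁ - (g + 1) = d := by omega
      obtain ⟨e, he⟩ : ∃ e, E = q + L + e := ⟨E - (q + L), by omega⟩
      have he' : E - (q + L) = e := by omega
      have he'' : E - q = L + e := by omega
      have h1 : p * (70 * L + 50) = L * (70 * p) + 50 * p := by ring
      have h2 : (L + e) * (70 * p + 200) = L * (70 * p) + 200 * L + e * (70 * p + 200) := by ring
      have h3 : (d + 1) * (50 * p + 200) = d * (50 * p + 200) + 50 * p + 200 := by ring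
      rw [hd, hd', he', he'', h2, h3]
      rw [h1] at ht₄
      simp [hL, he', ← hqdef, he''] at ht₃ ht₅ ⊢
      omega
  · rintro t₂ s₂ hf₂ ⟨hinv, hcond, ht₂, -⟩
    have hG₂ : s₂.nreg rG = g₁ := by rw [hf₂.n _ (by cases sq <;> rfl)]; simpa using hG₁
    have hh₂ : s₂.narr aHead = s₁.narr aHead := by rw [hf₂.a _ (by cases sq <;> rfl)]; simp
    simp [hG₂] at hcond
    have hgg : s₂.nreg rI = g₁ := le_antisymm hinv.g_le hcond
    have hqE : s₂.nreg rQ = E := by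
      by_contra hne
      have hq := hinv.q_le
      have h1 := (hinv.todo (s₂.nreg rQ) le_rfl (by omega)).1
      have h2 := (hγ _ (hs.lt (s₂.nreg rQ) (by omega))).2
      omega
    rw [hgg, hqE] at hinv
    refine ⟨?_, ⟨hinv.le, ?_, ?_, fun hsq x y hx hy hxy => ?_, fun x y hx hy hxy => ?_,
      fun x hx => ?_, fun x hx => ?_, hinv.tables⟩, fun g h => hinv.old g h, hgg,
      by rw [hh₂]; exact hhead₁, hinv.cnt⟩
    · simp [hI₁] at ht₂ ⊢
      have h1 : (g₁ - g₀) * (50 * p + 200) ≤ (g₁ - g₀) * (50 * p + 300) :=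
        Nat.mul_le_mul_left _ (by omega)
      have h2 : E * (70 * p + 200) ≤ E * (70 * p + 300) := Nat.mul_le_mul_left _ (by omega)
      omega
    · have := hinv.le_cap
      rwa [hs.pairCount_comp γ] at this
    · have := hinv.pairs
      rwa [hs.pairCount_comp] at this
    · obtain ⟨z, hz, rfl⟩ := hs.surj hx
      obtain ⟨z', hz', rfl⟩ := hs.surj hy
      rw [hinv.inj hsq z z' hz hz' hxy]
    · obtain ⟨z, hz, rfl⟩ := hs.surj hx
      obtain ⟨z', hz', rfl⟩ := hs.surj hy
      exact hinv.refines z z' hz hz' hxy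
    · obtain ⟨z, hz, rfl⟩ := hs.surj hx
      exact hinv.range z hz
    · obtain ⟨z, hz, rfl⟩ := hs.surj hx
      exact hinv.eq z hz

end RealRAM

/-! ### Reading the input -/

namespace RealRAM

variable {M W : ℕ}

/-- Stores the size of the matrices, the number of counters `rD`, and the table `bT` that turns
integers up to `rD` into real numbers. -/
def setup : Cmd :=
  .setN rN (.reg 0) ;; .setN rD (.lit 8 * (.reg 0 + .reg 1)) ;; .setN rF (.reg rD + .lit 1) ;;
  .setR fY .zero ;;
  .forN rX rF (.storeR bT (.reg rX) (.reg fY) ;; .setR fY (.reg fY + .one))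

theorem runs_setup {s : State} {n b D : ℕ} (h0 : s.nreg 0 = n) (h1 : s.nreg 1 = b)
    (hD : D = 8 * (n + b)) (hL : Limits n D M W) :
    Runs M W setup s fun t s' => t ≤ 50 * D + 50 ∧ s'.nreg rN = n ∧ s'.nreg rD = D ∧
      ∀ x ≤ D, s'.rarr bT x = x := by
  have hsq := hL.sq
  have hquad := hL.quad
  have hD16 := hL.hD
  have hM := hL.hM
  have hW := hL.hW
  unfold setup
  simp only [runs_seq, runs_setN, runs_setR]
  refine ⟨by simp, by simp [h0, h1]; omega, by simp [h0, h1]; omega, by simp, ?_⟩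
  refine (Runs.forN (n := D + 1) (f := fun _ => 20) (I := fun k s' => s'.rreg fY = k ∧
    ∀ x < k, s'.rarr bT x = x) (by decide) rfl rfl (by simp [h0, h1, hD]) (by omega) (by omega)
    ?_ ?_).mono ?_
  · simp
  · rintro k s₁ hk hX - - ⟨hY, hx⟩
    simp only [runs_seq, runs_storeR, runs_setR]
    simp [hX, hY]
    refine ⟨by omega, fun x hxk => ?_⟩
    rcases hxk.lt_or_eq with h | rfl
    · rw [Function.update_of_ne (by omega)]
      exact hx x h
    · simp
  · rintro t s₁ hf ⟨ht, -, hx⟩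
    refine ⟨?_, ?_, ?_, fun x h => hx x (by omega)⟩
    · simp at ht ⊢
      omega
    · rw [hf.n _ rfl]
      simp [h0]
    · rw [hf.n _ rfl]
      simp [h0, h1, hD]

theorem Summary.setN {n D k : ℕ} {C : ℕ → ℕ → ℝ} {s : State} (h : Summary n D k C s) {x : ℕ}
    (hx : x ≠ rE) (v : ℕ) : Summary n D k C (s.setN x v) := by
  obtain ⟨h1, h2, h3, h4, h5, h6, h7, h8, h9⟩ := h
  have hE : (s.setN x v).nreg rE = s.nreg rE := by simp [hx.symm]
  constructor <;> (try rw [hE]) <;> assumption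

theorem Summary.zero {n D : ℕ} {s : State} (hE : s.nreg rE = 0) (hN : s.rreg fN = 0)
    (hhead : ∀ g, s.narr aHead g = 0) : Summary n D 0 (fun _ _ => 0) s := by
  constructor <;> simp [hE, hN, hhead, Keyed, cnt]
  exact ⟨0, by simp⟩

/-- Processes all columns of the left and all rows of the right matrix. -/
def stream : Cmd := .forN rK rN processOuter

theorem runs_stream {s : State} {n D : ℕ} {a b : ℕ → ℕ → ℝ} (hL : Limits n D M W)
    (hn : s.nreg rN = n) (hD : s.nreg rD = D) (hT : s.rarr bT D = D)
    (hE : s.nreg rE = 0) (hN : s.rreg fN = 0) (hhead : ∀ g, s.narr aHead g = 0)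
    (ha : ∀ k i, 0 ≤ a k i) (hb : ∀ k i, 0 ≤ b k i)
    (hta : s.tape false = (List.range n).flatMap fun k => (List.range n).map (a k))
    (htb : s.tape true = (List.range n).flatMap fun k => (List.range n).map (b k)) :
    Runs M W stream s fun t s' => t ≤ n * (3000 * D + 9) + 7 ∧
      Summary n D n (fun i j => ∑ k ∈ Finset.range n, a k i * b k j) s' := by
  have hsq := hL.sq
  have hquad := hL.quad
  have hD16 := hL.hD
  have hnD := hL.hn
  have hW := hL.hW
  refine (Runs.forN (n := n) (f := fun _ => 3000 * D) (I := fun k s' =>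
    Summary n D k (fun i j => ∑ k' ∈ Finset.range k, a k' i * b k' j) s' ∧
    (s'.tape false = (List.range' k (n - k)).flatMap fun k => (List.range n).map (a k)) ∧
    s'.tape true = (List.range' k (n - k)).flatMap fun k => (List.range n).map (b k))
    (by decide) (by decide) (by decide) hn (by omega) (by omega) ?_ ?_).mono ?_
  · refine ⟨?_, ?_, ?_⟩
    · simpa using Summary.zero (by simpa using hE) (by simpa using hN) (by simpa using hhead)
    · simpa [List.range_eq_range'] using hta
    · simpa [List.range_eq_range'] using htb
  · rintro k s₁ hk hK - hf ⟨hS, hA, hB⟩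
    have hn₁ : s₁.nreg rN = n := by rw [hf.n _ (by decide)]; exact hn
    have hD₁ : s₁.nreg rD = D := by rw [hf.n _ (by decide)]; exact hD
    have hT₁ : s₁.rarr bT D = D := by rw [hf.b _ (by decide)]; exact hT
    have hsub : n - k = n - (k + 1) + 1 := by omega
    rw [hsub, List.range'_succ, List.flatMap_cons] at hA hB
    refine (runs_processOuter hL hn₁ hD₁ hT₁ hS (fun i j _ _ => Finset.sum_nonneg fun k' _ =>
      mul_nonneg (ha _ _) (hb _ _)) (fun i _ => ha k i) (fun i _ => hb k i) hA hB).mono ?_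
    rintro t s₂ - ⟨ht, hS₂, hA₂, hB₂⟩
    refine ⟨ht, ?_, hA₂, hB₂⟩
    simp only [Finset.sum_range_succ]
    exact hS₂.setN (by decide) _
  · rintro t s₁ - ⟨ht, hS, -⟩
    refine ⟨?_, hS⟩
    simpa using ht

/-- The square matrix `A`, extended by zero. -/
def extend {n : ℕ} (A : Matrix (Fin n) (Fin n) ℝ) (i j : ℕ) : ℝ :=
  if h : i < n ∧ j < n then A ⟨i, h.1⟩ ⟨j, h.2⟩ else 0

theorem extend_coe {n : ℕ} (A : Matrix (Fin n) (Fin n) ℝ) (i j : Fin n) :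
    extend A i j = A i j := by
  simp [extend]

theorem extend_nonneg {n : ℕ} {A : Matrix (Fin n) (Fin n) ℝ} (hA : ∀ i j, 0 ≤ A i j) (i j : ℕ) :
    0 ≤ extend A i j := by
  unfold extend
  split_ifs
  · exact hA _ _
  · exact le_rfl

theorem rowMajor_eq {n : ℕ} (B : Matrix (Fin n) (Fin n) ℝ) :
    rowMajor B = (List.range n).flatMap fun k => (List.range n).map (extend B k) := by
  simp only [← List.map_coe_finRange_eq_range, List.flatMap_map, List.map_map, rowMajor]
  congr 1
  funext i
  congr 1
  funext j
  exact (extend_coe B i j).symm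

theorem colMajor_eq {n : ℕ} (A : Matrix (Fin n) (Fin n) ℝ) :
    colMajor A =
      (List.range n).flatMap fun k => (List.range n).map fun i => extend A i k := by
  simp only [← List.map_coe_finRange_eq_range, List.flatMap_map, List.map_map, colMajor]
  congr 1
  funext j
  congr 1
  funext i
  exact (extend_coe A i j).symm

theorem mul_apply_extend {n : ℕ} (A B : Matrix (Fin n) (Fin n) ℝ) (i j : Fin n) :
    (A * B) i j = ∑ k ∈ Finset.range n, extend A i k * extend B k j := by
  rw [Matrix.mul_apply, Finset.sum_range]
  simp only [extend_coe]

theorem entrywiseL1_mul {n : ℕ} {A B : Matrix (Fin n) (Fin n) ℝ} (hA : ∀ i j, 0 ≤ A i j)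
    (hB : ∀ i j, 0 ≤ B i j) :
    entrywiseL1 (A * B) = ∑ i ∈ Finset.range n, ∑ j ∈ Finset.range n,
      ∑ k ∈ Finset.range n, extend A i k * extend B k j := by
  rw [entrywiseL1, Finset.sum_range]
  refine Finset.sum_congr rfl fun i _ => ?_
  rw [Finset.sum_range]
  refine Finset.sum_congr rfl fun j _ => ?_
  rw [← mul_apply_extend, abs_of_nonneg]
  rw [Matrix.mul_apply]
  exact Finset.sum_nonneg fun k _ => mul_nonneg (hA _ _) (hB _ _)

end RealRAM

/-! ### The dictionary -/

namespace RealRAM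

variable {M W : ℕ}

/-- Finds a prime number between `rN` and `2 * rN` by trial division. -/
def findPrime : Cmd :=
  .setN rP (.reg rN + .lit 1) ;; .setN rJ (.lit 2) ;;
  .loop (.nlt (.reg rJ) (.reg rP))
    (.ite (.neq (.reg rP % .reg rJ) (.lit 0))
      (.setN rP (.reg rP + .lit 1) ;; .setN rJ (.lit 2)) (.setN rJ (.reg rJ + .lit 1)))

theorem runs_findPrime {s : State} {n : ℕ} (hn : s.nreg rN = n) (hn0 : 1 ≤ n) (hW : 2 * n + 1 ≤ W) :
    Runs M W findPrime s fun t s' => t ≤ 300 * (n * n) + 50 ∧ (s'.nreg rP).Prime ∧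
      n < s'.nreg rP ∧ s'.nreg rP ≤ 2 * n := by
  obtain ⟨q, hq, hnq, hq2⟩ := Nat.exists_prime_lt_and_le_two_mul n (by omega)
  unfold findPrime
  simp only [runs_seq, runs_setN]
  refine ⟨by simp [hn]; omega, by simp; omega, (Runs.loop (I := fun s' => n < s'.nreg rP ∧
    s'.nreg rP ≤ q ∧ 2 ≤ s'.nreg rJ ∧ s'.nreg rJ ≤ s'.nreg rP ∧
    ∀ d, 2 ≤ d → d < s'.nreg rJ → ¬ d ∣ s'.nreg rP)
    (Φ := fun s' => (q - s'.nreg rP) * (30 * (q + 1)) + 30 * (s'.nreg rP - s'.nreg rJ))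
    ?_ ?_).mono ?_⟩
  · simp [hn]
    exact ⟨by omega, by omega, fun d h1 h2 => by omega⟩
  · rintro s₁ - ⟨h1, h2, h3, h4, h5⟩
    refine ⟨by simp, fun hc => ?_⟩
    simp at hc
    refine Runs.ite (by simp; omega) (fun h => ?_) (fun h => ?_)
    · simp at h
      have hdvd : s₁.nreg rJ ∣ s₁.nreg rP := Nat.dvd_of_mod_eq_zero h
      have hne : s₁.nreg rP ≠ q := fun heq => by
        rw [heq] at hdvd
        rcases (Nat.dvd_prime hq).1 hdvd with h6 | h6 <;> omega
      simp only [runs_seq, runs_setN]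
      simp
      obtain ⟨e, he⟩ : ∃ e, q = s₁.nreg rP + 1 + e := ⟨q - (s₁.nreg rP + 1), by omega⟩
      have e1 : q - s₁.nreg rP = e + 1 := by omega
      have e2 : q - (s₁.nreg rP + 1) = e := by omega
      rw [e1, e2, add_mul e 1]
      refine ⟨by omega, by omega, ⟨by omega, by omega, by omega, fun d h6 h7 => by omega⟩, by omega⟩
    · simp at h
      simp only [runs_setN]
      simp
      refine ⟨by omega, ⟨h1, h2, by omega, by omega, fun d h6 h7 => ?_⟩, by omega⟩
      rcases h7.lt_or_eq with h8 | rfl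
      · exact h5 d h6 h8
      · intro hdvd
        exact absurd (Nat.mod_eq_zero_of_dvd hdvd) (by omega)
  · rintro t s₁ - ⟨⟨h1, h2, h3, h4, h5⟩, hc, ht, -⟩
    simp at hc
    refine ⟨?_, ?_, h1, by omega⟩
    · simp [hn] at ht ⊢
      have h6 : (q - (n + 1)) * (30 * (q + 1)) ≤ n * (30 * (3 * n)) :=
        Nat.mul_le_mul (by omega) (by omega)
      have h7 : n * (30 * (3 * n)) = 90 * (n * n) := by ring
      have h8 : n ≤ n * n := Nat.le_mul_self n
      omega
    · rw [Nat.prime_def_lt']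
      exact ⟨by omega, fun d h6 h7 => h5 d h6 (by omega)⟩

/-- The cell to which the table of group `g` sends the column `j`. -/
def cell (p : ℕ) (mul mod base : ℕ → ℕ) (g j : ℕ) : ℕ := base g + hash p (mod g) (mul g) j

/-- The tables in the state `s` form a dictionary for the first `E` triples: the table of the row
sends the column to a number that is again the number of a table, this table sends the column to a
cell, and the cells of triples point back to the triples. -/
structure IsDictionary (n D E : ℕ) (s : State) : Prop where
  prime : (s.nreg rP).Prime
  prime_le : s.nreg rP ≤ 2 * D
  first : ∀ i < n, 0 < s.narr aMod i ∧ s.narr aMul i < s.nreg rP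
  second : ∀ i j, i < n →
    cell (s.nreg rP) (s.narr aMul) (s.narr aMod) (s.narr aBase) i j < 20 * D ∧
    0 < s.narr aMod (cell (s.nreg rP) (s.narr aMul) (s.narr aMod) (s.narr aBase) i j) ∧
    s.narr aMul (cell (s.nreg rP) (s.narr aMul) (s.narr aMod) (s.narr aBase) i j) < s.nreg rP
  third : ∀ i j, i < n → cell (s.nreg rP) (s.narr aMul) (s.narr aMod) (s.narr aBase)
    (cell (s.nreg rP) (s.narr aMul) (s.narr aMod) (s.narr aBase) i j) j < 20 * D
  link : ∀ x < E, s.narr aLink (cell (s.nreg rP) (s.narr aMul) (s.narr aMod) (s.narr aBase)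
    (cell (s.nreg rP) (s.narr aMul) (s.narr aMod) (s.narr aBase) (s.narr aRow x) (s.narr aCol x))
    (s.narr aCol x)) = x

/-- Builds the dictionary: a first level with linear tables for the rows, a second level with
quadratic tables for the cells of the first level, and the links from the cells of the second level
to the triples. -/
def buildDictionary : Cmd :=
  findPrime ;; .forN rX rE (.storeN aGid (.reg rX) (.arr aRow (.reg rX))) ;;
  .setN rI (.lit 0) ;; .setN rG (.reg rN) ;; layer false ;; .setN rG (.reg rB) ;; layer true ;;
  .forN rX rE (.storeN aLink (.arr aGid (.reg rX)) (.reg rX))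

set_option maxHeartbeats 1000000 in
theorem runs_buildDictionary {s : State} {n D E : ℕ} (hL : Limits n D M W) (hn0 : 1 ≤ n)
    (hnD : 8 * n ≤ D)
    (hn : s.nreg rN = n) (hE : s.nreg rE = E) (hED : E ≤ 2 * D)
    (hrow : ∀ x < E, s.narr aRow x < n) (hcol : ∀ x < E, s.narr aCol x < n)
    (hkeyed : Keyed E (s.narr aRow) (s.narr aCol)) (hhead : ∀ g, s.narr aHead g = 0)
    (hcnt : ∀ v, s.narr aCnt v = 0) :
    Runs M W buildDictionary s fun t s' => t ≤ 5000 * (n * D) ∧ IsDictionary n D E s' := by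
  have hsq := hL.sq
  have hquad := hL.quad
  have hD16 := hL.hD
  have hM := hL.hM
  have hW := hL.hW
  set row := s.narr aRow with hrowdef
  set col := s.narr aCol with hcoldef
  unfold buildDictionary
  simp only [runs_seq]
  refine (runs_findPrime hn hn0 (by omega)).mono ?_
  rintro t₁ s₁ hf₁ ⟨ht₁, hprime, hnp, hp2⟩
  set p := s₁.nreg rP with hp
  have hn₁ : s₁.nreg rN = n := by rw [hf₁.n _ rfl]; exact hn
  have hE₁ : s₁.nreg rE = E := by rw [hf₁.n _ rfl]; exact hE
  have harr₁ : s₁.narr = s.narr := by funext y; rw [hf₁.a _ rfl]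
  refine (Runs.forN (n := E) (f := fun _ => 10) (I := fun k s' => ∀ x < k, s'.narr aGid x = row x)
    (by decide) rfl rfl hE₁ (by omega) (by omega) ?_ ?_).mono ?_
  · simp
  · rintro k s₂ hk hX - hf₂ hx
    have hrow₂ : s₂.narr aRow = row := by rw [hf₂.a _ rfl, harr₁]
    simp [hX, hrow₂]
    refine ⟨by omega, fun x hxk => ?_⟩
    rcases hxk.lt_or_eq with h | rfl
    · rw [Function.update_of_ne (by omega)]
      exact hx x h
    · simp
  rintro t₂ s₂ hf₂ ⟨ht₂, hgid₂⟩
  have hn₂ : s₂.nreg rN = n := by rw [hf₂.n _ rfl]; exact hn₁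
  have hE₂ : s₂.nreg rE = E := by rw [hf₂.n _ rfl]; exact hE₁
  have hP₂ : s₂.nreg rP = p := by rw [hf₂.n _ rfl]
  have hrow₂ : s₂.narr aRow = row := by rw [hf₂.a _ rfl, harr₁]
  have hcol₂ : s₂.narr aCol = col := by rw [hf₂.a _ rfl, harr₁]
  have hhead₂ : ∀ g, s₂.narr aHead g = 0 := by rw [hf₂.a _ rfl, harr₁]; exact hhead
  have hcnt₂ : ∀ g, s₂.narr aCnt g = 0 := by rw [hf₂.a _ rfl, harr₁]; exact hcnt
  simp only [runs_setN]
  refine ⟨by simp, by simp, ?_⟩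
  refine (runs_layer (sq := false) (g₀ := 0) (g₁ := n) (E := E) (p := p) hL (by simp)
    (by simp [hn₂]) (by simp [hE₂]) (by simp [hP₂]) hprime (by omega) hED (by omega)
    (fun x hx => ?_) (fun x hx => ?_) (fun x y hx hy => ?_) ?_ (by simpa using hhead₂)
    (by simpa using hcnt₂)).mono ?_
  · simp [hgid₂ x hx]
    exact hrow x hx
  · simp [hcol₂]
    exact (hcol x hx).trans hnp
  · simp only [State.narr_setN, hcol₂, hgid₂ x hx, hgid₂ y hy]
    exact hkeyed x y hx hy
  · simp
    omega
  rintro t₃ s₃ hf₃ ⟨ht₃, hlay₃, -, hI₃, hhead₃, hcnt₃⟩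
  set B := s₃.nreg rB with hB
  have hn₃ : s₃.nreg rN = n := by rw [hf₃.n _ (by decide)]; simpa using hn₂
  have hE₃ : s₃.nreg rE = E := by rw [hf₃.n _ (by decide)]; simpa using hE₂
  have hP₃ : s₃.nreg rP = p := by rw [hf₃.n _ (by decide)]; simpa using hP₂
  have hrow₃ : s₃.narr aRow = row := by rw [hf₃.a _ (by decide)]; simpa using hrow₂
  have hcol₃ : s₃.narr aCol = col := by rw [hf₃.a _ (by decide)]; simpa using hcol₂
  simp only [State.narr_setN, hcol₂] at hlay₃
  have hBn := hlay₃.le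
  have hBcap := hlay₃.le_cap
  have hpairs := hlay₃.pairs
  simp at hBcap
  refine ⟨by simp, ?_⟩
  refine (runs_layer (sq := true) (g₀ := n) (g₁ := B) (E := E) (p := p) hL (by simpa using hI₃)
    (by simp [hB]) (by simpa using hE₃) (by simpa using hP₃) hprime (by omega) hED hBn
    (fun x hx => by simpa using hlay₃.range x hx) (fun x hx => ?_) (fun x y hx hy h1 h2 => ?_) ?_
    (by simpa using hhead₃) (by simpa using hcnt₃)).mono ?_
  · simp [hcol₃]
    exact (hcol x hx).trans hnp
  · simp only [State.narr_setN, hcol₃] at h1 h2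
    have h3 := hlay₃.refines x y hx hy h1
    rw [hgid₂ x hx, hgid₂ y hy] at h3
    exact hkeyed x y hx hy h3 h2
  · simp
    omega
  rintro t₄ s₄ hf₄ ⟨ht₄, hlay₄, hold, -⟩
  have hE₄ : s₄.nreg rE = E := by rw [hf₄.n _ (by decide)]; simpa using hE₃
  have hP₄ : s₄.nreg rP = p := by rw [hf₄.n _ (by decide)]; simpa using hP₃
  have hrow₄ : s₄.narr aRow = row := by rw [hf₄.a _ (by decide)]; simpa using hrow₃
  have hcol₄ : s₄.narr aCol = col := by rw [hf₄.a _ (by decide)]; simpa using hcol₃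
  simp only [State.narr_setN, hcol₃] at hlay₄ hold
  have hBcap' := hlay₄.le_cap
  have hBn' := hlay₄.le
  simp only [if_true] at hBcap'
  set B' := s₄.nreg rB with hB'
  have hB'D : B' ≤ 20 * D := by omega
  refine (Runs.forN (n := E) (f := fun _ => 10)
    (I := fun k s' => ∀ x < k, s'.narr aLink (s₄.narr aGid x) = x)
    (by decide) rfl rfl hE₄ (by omega) (by omega) ?_ ?_).mono ?_
  · simp
  · rintro k s₅ hk hX - hf₅ hx
    have hgid₅ : s₅.narr aGid = s₄.narr aGid := by rw [hf₅.a _ rfl]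
    have h1 := (hlay₄.range k hk).2
    simp [hX, hgid₅]
    refine ⟨⟨by omega, by omega⟩, fun x hxk => ?_⟩
    rcases hxk.lt_or_eq with h | rfl
    · rw [Function.update_of_ne]
      · exact hx x h
      · intro heq
        have := hlay₄.inj rfl x k (by omega) hk heq
        omega
    · simp
  rintro t₅ s₅ hf₅ ⟨ht₅, hlink⟩
  have hP₅ : s₅.nreg rP = p := by rw [hf₅.n _ rfl, hP₄]
  have hrow₅ : s₅.narr aRow = row := by rw [hf₅.a _ rfl, hrow₄]
  have hcol₅ : s₅.narr aCol = col := by rw [hf₅.a _ rfl, hcol₄]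
  have hmul₅ : s₅.narr aMul = s₄.narr aMul := by rw [hf₅.a _ rfl]
  have hmod₅ : s₅.narr aMod = s₄.narr aMod := by rw [hf₅.a _ rfl]
  have hbase₅ : s₅.narr aBase = s₄.narr aBase := by rw [hf₅.a _ rfl]
  have hfirst : ∀ i < n, 0 < s₄.narr aMod i ∧ s₄.narr aMul i < p ∧
      n ≤ s₄.narr aBase i ∧ s₄.narr aBase i + s₄.narr aMod i ≤ B := fun i hi => by
    obtain ⟨h1, h2, h3⟩ := hold i hi
    obtain ⟨h4, h5, h6, h7⟩ := hlay₃.tables i (Nat.zero_le _) hi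
    rw [h1, h2, h3]
    exact ⟨h4, h7, h5, h6⟩
  have hcell : ∀ i j, i < n → n ≤ cell p (s₄.narr aMul) (s₄.narr aMod) (s₄.narr aBase) i j ∧
      cell p (s₄.narr aMul) (s₄.narr aMod) (s₄.narr aBase) i j < B := fun i j hi => by
    obtain ⟨h1, h2, h3, h4⟩ := hfirst i hi
    have h5 : hash p (s₄.narr aMod i) (s₄.narr aMul i) j < s₄.narr aMod i := Nat.mod_lt _ h1
    unfold cell
    omega
  refine ⟨?_, ⟨?_, ?_, fun i hi => ?_, fun i j hi => ?_, fun i j hi => ?_, fun x hx => ?_⟩⟩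
  · have e1 : n * (50 * p + 300) ≤ n * (50 * D) := Nat.mul_le_mul_left _ (by omega)
    have e2 : E * (70 * p + 300) ≤ 2 * D * (440 * n) := Nat.mul_le_mul hED (by omega)
    have e3 : (B - n) * (50 * p + 300) ≤ 3 * D * (400 * n) := Nat.mul_le_mul (by omega) (by omega)
    have e4 : n * (50 * D) = 50 * (n * D) := by ring
    have e5 : 2 * D * (440 * n) = 880 * (n * D) := by ring
    have e6 : 3 * D * (400 * n) = 1200 * (n * D) := by ring
    have e7 : D ≤ n * D := Nat.le_mul_of_pos_left _ hn0
    have e8 : n * n ≤ n * D := Nat.mul_le_mul_left _ (by omega)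
    simp at ht₂ ht₅ ht₃ ⊢
    omega
  · rwa [hP₅]
  · rw [hP₅]
    omega
  · rw [hP₅, hmod₅, hmul₅]
    exact ⟨(hfirst i hi).1, (hfirst i hi).2.1⟩
  · rw [hP₅, hmod₅, hmul₅, hbase₅]
    obtain ⟨h1, h2⟩ := hcell i j hi
    obtain ⟨h3, h4, h5, h6⟩ := hlay₄.tables _ h1 h2
    exact ⟨by omega, h3, h6⟩
  · rw [hP₅, hmod₅, hmul₅, hbase₅]
    obtain ⟨h1, h2⟩ := hcell i j hi
    obtain ⟨h3, h4, h5, h6⟩ := hlay₄.tables _ h1 h2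
    have h7 : ∀ m a, 0 < m → hash p m a j < m := fun m a hm => Nat.mod_lt _ hm
    have h8 := h7 _ (s₄.narr aMul
      (cell p (s₄.narr aMul) (s₄.narr aMod) (s₄.narr aBase) i j)) h3
    conv_lhs => unfold cell
    change s₄.narr aBase (cell p (s₄.narr aMul) (s₄.narr aMod) (s₄.narr aBase) i j) + _ < _
    exact (Nat.add_lt_add_left h8 _).trans_le (by omega)
  · rw [hP₅, hmod₅, hmul₅, hbase₅, hrow₅, hcol₅]
    have h1 := hlay₃.eq x hx
    rw [hgid₂ x hx] at h1
    obtain ⟨h2, h3, h4⟩ := hold _ (hrow x hx)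
    have h5 : cell p (s₄.narr aMul) (s₄.narr aMod) (s₄.narr aBase) (row x) (col x) =
        s₃.narr aGid x := by
      rw [h1]
      unfold cell
      rw [h2, h3, h4]
    rw [h5]
    have h6 := hlay₄.eq x hx
    change s₅.narr aLink (s₄.narr aBase _ + hash _ _ _ _) = x
    rw [← h6]
    exact hlink x hx

end RealRAM

/-! ### Queries -/

namespace RealRAM

variable {M W : ℕ}

/-- Goes from the table with number `rG` to the number that this table assigns to the column. -/
def lookup : Cmd :=
  .setN rG (.arr aBase (.reg rG) +
    (.arr aMul (.reg rG) * .reg 1 % .reg rP) % .arr aMod (.reg rG))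

/-- Looks up the counter of the queried entry and converts it to a real number, with the table `bT`
applied to its two digits in base `rD`. -/
def queryCmd : Cmd :=
  .setN rG (.reg 0) ;; lookup ;; lookup ;; .setN rX (.arr aLink (.reg rG)) ;;
  .ite (.and (.nlt (.reg rX) (.reg rE))
      (.and (.neq (.arr aRow (.reg rX)) (.reg 0)) (.neq (.arr aCol (.reg rX)) (.reg 1))))
    (.setR 0 ((.arr bT (.arr aVal (.reg rX) / .reg rD) * .arr bT (.reg rD) +
      .arr bT (.arr aVal (.reg rX) % .reg rD)) *
      (.reg fN / (.arr bT (.reg rD) * .arr bT (.reg rD)))))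
    (.setR 0 .zero)

/-- A state in which queries can be answered: a summary with a dictionary for its counters. -/
structure Ready (n D : ℕ) (s : State) : Prop where
  nreg_rD : s.nreg rD = D
  table : ∀ x ≤ D, s.rarr bT x = x
  size : s.nreg rE ≤ 2 * D
  keyed : Keyed (s.nreg rE) (s.narr aRow) (s.narr aCol)
  val_le : ∀ x < s.nreg rE, s.narr aVal x ≤ D * D
  dictionary : IsDictionary n D (s.nreg rE) s

/-- The answer to the query for the entry `(i, j)` in the state `s`. -/
noncomputable def State.answer (s : State) (D i j : ℕ) : ℝ :=
  cnt (s.nreg rE) (s.narr aRow) (s.narr aCol) (s.narr aVal) i j * (s.rreg fN / D ^ 2)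

theorem runs_lookup {s : State} {p g j : ℕ} (hg : s.nreg rG = g) (hj : s.nreg 1 = j)
    (hp : s.nreg rP = p) (hp0 : 0 < p) (hgM : g < M) (hmul : s.narr aMul g * j ≤ W)
    (hmod : 0 < s.narr aMod g)
    (hcell : cell p (s.narr aMul) (s.narr aMod) (s.narr aBase) g j ≤ W) :
    Runs M W lookup s fun t s' => t ≤ 20 ∧
      s' = s.setN rG (cell p (s.narr aMul) (s.narr aMod) (s.narr aBase) g j) := by
  unfold lookup
  simp only [runs_setN]
  unfold cell hash at *
  simp only [NExp.ok_add, NExp.ok_arr, NExp.ok_mod, NExp.ok_mul, NExp.ok_reg, NExp.eval_add,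
    NExp.eval_arr, NExp.eval_mod, NExp.eval_mul, NExp.eval_reg, hg, hj, hp]
  exact ⟨⟨⟨trivial, hgM⟩, ⟨⟨⟨⟨trivial, hgM⟩, trivial, hmul⟩, trivial, by omega⟩, ⟨trivial, hgM⟩,
    by omega⟩, hcell⟩, by decide, trivial⟩

theorem runs_queryCmd {s : State} {n D i j : ℕ} (hL : Limits n D M W) (hs : Ready n D s)
    (hi : i < n) (hj : j < n) :
    Runs M W queryCmd (s.withQuery i j) fun t s' => t ≤ 200 ∧ s'.rreg 0 = s.answer D i j ∧
      Ready n D s' ∧ s'.answer D = s.answer D := by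
  have hsq := hL.sq
  have hquad := hL.quad
  have hD16 := hL.hD
  have hnD := hL.hn
  have hM := hL.hM
  have hW := hL.hW
  obtain ⟨hD, htab, hE, hkeyed, hval, hprime, hpD, hfirst, hsecond, hthird, hlink⟩ := hs
  set p := s.nreg rP with hp
  set row := s.narr aRow with hrow
  set col := s.narr aCol with hcol
  set val := s.narr aVal with hvaldef
  set E := s.nreg rE with hEdef
  set mul := s.narr aMul with hmul
  set mod := s.narr aMod with hmod
  set base := s.narr aBase with hbase
  set u := s.withQuery i j with hu
  have hu0 : u.nreg 0 = i := by simp [hu, State.withQuery]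
  have hu1 : u.nreg 1 = j := by simp [hu, State.withQuery]
  have hun : ∀ x, x ≠ 0 → x ≠ 1 → u.nreg x = s.nreg x := fun x h0 h1 => by
    simp [hu, State.withQuery, h0, h1]
  have hur : u.rreg = s.rreg := rfl
  have hua : u.narr = s.narr := rfl
  have hub : u.rarr = s.rarr := rfl
  have hpW : ∀ m, m < p → m * j ≤ W := fun m hm => by
    have h1 : m * j ≤ 2 * D * D := Nat.mul_le_mul (by omega) (by omega)
    have h2 : 2 * D * D = 2 * (D * D) := by ring
    omega
  -- Whatever the final instruction is, the state stays ready, because only registers for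
  -- intermediate results change.
  have key : ∀ s' : State, Frame queryCmd u s' → Ready n D s' ∧ s'.answer D = s.answer D := by
    intro s' hf
    have hn : ∀ x, x ≠ 0 → x ≠ 1 → queryCmd.wN x = false → s'.nreg x = s.nreg x :=
      fun x h0 h1 h2 => (hf.n x h2).trans (hun x h0 h1)
    have ha : s'.narr = s.narr := funext fun y => hf.a y rfl
    have hb : s'.rarr = s.rarr := funext fun y => hf.b y rfl
    have hP' := hn rP (by decide) (by decide) rfl
    have hE' := hn rE (by decide) (by decide) rfl
    have hD' := hn rD (by decide) (by decide) rfl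
    refine ⟨⟨by rw [hD', hD], by rwa [hb], by rwa [hE'], by rwa [hE', ha], by rwa [hE', ha], ?_⟩, ?_⟩
    · rw [hE']
      refine ⟨?_, ?_, ?_, ?_, ?_, ?_⟩ <;> rw [hP'] <;> (try rw [ha]) <;> assumption
    · funext i j
      unfold State.answer
      rw [hE', ha, hf.r _ rfl, hur]
  unfold queryCmd
  simp only [runs_seq, runs_setN]
  refine ⟨by simp, ?_⟩
  obtain ⟨hm1, hm2⟩ := hfirst i hi
  obtain ⟨hc1, hc2, hc3⟩ := hsecond i j hi
  have hc4 := hthird i j hi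
  set c := cell p mul mod base i j with hc
  set c' := cell p mul mod base c j with hc'
  refine (runs_lookup (g := i) (j := j) (p := p) (by simp [hu0]) (by simp [hu1])
    (by simp [hun]; rfl) hprime.pos (by omega) (by exact hpW _ hm2) (by exact hm1) (by
      change c ≤ W
      omega)).mono ?_
  rintro t₁ s₁ hf₁ ⟨ht₁, hs₁⟩
  replace hs₁ : s₁ = (u.setN rG i).setN rG c := by
    rw [hs₁]
    simp only [NExp.eval_reg, hu0, State.narr_setN, hua]
    rfl
  refine (runs_lookup (g := c) (j := j) (p := p) (by simp [hs₁]) (by simp [hs₁, hu1])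
    (by simp [hs₁, hun]; rfl) hprime.pos (by omega) (by simpa [hs₁, hua] using hpW _ hc3)
    (by simpa [hs₁, hua] using hc2) (by
      rw [hs₁]
      change c' ≤ W
      omega)).mono ?_
  rintro t₂ s₂ hf₂ ⟨ht₂, hs₂⟩
  replace hs₂ : s₂ = ((u.setN rG i).setN rG c).setN rG c' := by
    rw [hs₂, hs₁]
    rfl
  set x := s.narr aLink c' with hx
  refine ⟨by simp [hs₂]; omega, ?_⟩
  have hX : (s₂.setN rX ((NExp.arr aLink (.reg rG)).eval s₂)).nreg rX = x := by
    simp [hs₂, hua, hx]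
  set s₃ := s₂.setN rX ((NExp.arr aLink (.reg rG)).eval s₂) with hs₃
  have h0₃ : s₃.nreg 0 = i := by simp [hs₃, hs₂, hu0]
  have h1₃ : s₃.nreg 1 = j := by simp [hs₃, hs₂, hu1]
  have hE₃ : s₃.nreg rE = E := by simp [hs₃, hs₂, hun, hEdef]
  have hD₃ : s₃.nreg rD = D := by simp [hs₃, hs₂, hun, hD]
  have ha₃ : s₃.narr = s.narr := by simp [hs₃, hs₂, hua]
  have hb₃ : s₃.rarr = s.rarr := by simp [hs₃, hs₂, hub]
  have hr₃ : s₃.rreg = s.rreg := by simp [hs₃, hs₂, hur]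
  have hfr : ∀ v : ℝ, Frame queryCmd u (s₃.setR 0 v) := fun v => by
    refine ⟨fun y hy => ?_, fun y hy => ?_, fun y _ => ?_, fun y _ => ?_, fun y _ => ?_⟩
    · simp only [queryCmd, lookup, Cmd.wN, Bool.or_false, Bool.or_eq_false_iff,
        decide_eq_false_iff_not] at hy
      simp [hs₃, hs₂, Ne.symm hy.1, Ne.symm hy.2.2.2]
    · simp only [queryCmd, lookup, Cmd.wR, Bool.false_or, Bool.or_self,
        decide_eq_false_iff_not] at hy
      simp [hr₃, Ne.symm hy, hur]
    · simp [ha₃, hua]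
    · simp [hb₃, hub]
    · simp [hs₃, hs₂]
  have hD0 : (D : ℝ) ≠ 0 := by
    have : D ≠ 0 := by omega
    exact_mod_cast this
  refine Runs.ite ?_ (fun h => ?_) (fun h => ?_)
  · simp [hX, hE₃]
    intro h
    have : x < M := by omega
    exact ⟨⟨this, fun _ => this⟩, fun _ _ => ⟨this, fun _ => this⟩⟩
  · simp [hX, hE₃, h0₃, h1₃, ha₃, ← hrow, ← hcol] at h
    obtain ⟨hxE, ⟨hr1, hr2⟩, hc1, hc2⟩ := h
    have hv := hval x hxE
    have hv1 : val x / D ≤ D := Nat.div_le_of_le_mul hv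
    have hv2 : val x % D < D := Nat.mod_lt _ (by omega)
    have hrx : row x = i := le_antisymm hr1 hr2
    have hcx : col x = j := le_antisymm hc1 hc2
    simp only [runs_setR]
    refine ⟨?_, ?_, ?_, key _ (hfr _)⟩
    · simp [hX, hD₃, ha₃, ← hvaldef, hb₃, htab, hD0]
      omega
    · simp
      omega
    · unfold State.answer
      rw [← hEdef, ← hrow, ← hcol, ← hvaldef, ← hrx, ← hcx, hkeyed.cnt_eq hxE]
      simp only [State.rreg_setR, if_true, RExp.eval_mul, RExp.eval_add, RExp.eval_div,
        RExp.eval_arr, RExp.eval_reg, NExp.eval_div, NExp.eval_mod, NExp.eval_arr, NExp.eval_reg,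
        hX, hD₃, ha₃, hb₃, hr₃, ← hvaldef, htab _ hv1, htab _ hv2.le, htab _ le_rfl]
      have h3 : ((val x : ℕ) : ℝ) = ((val x / D : ℕ) : ℝ) * D + ((val x % D : ℕ) : ℝ) := by
        exact_mod_cast (Nat.div_add_mod' (val x) D).symm
      rw [h3, sq]
  · simp [hX, hE₃, h0₃, h1₃, ha₃, ← hrow, ← hcol] at h
    simp only [runs_setR]
    refine ⟨by simp, ?_, ?_, key _ (hfr _)⟩
    · simp
      omega
    · unfold State.answer
      rw [← hEdef, ← hrow, ← hcol, ← hvaldef, cnt_eq_zero]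
      · simp
      · rintro y hy hry hcy
        have h4 := hlink y hy
        rw [hry, hcy] at h4
        have h5 : x = y := h4
        rw [h5] at h
        have := h hy
        omega

theorem Ready.answersQueries {n D T : ℕ} (hL : Limits n D M W) (hT : 200 ≤ T)
    (qs : List (Fin n × Fin n)) : ∀ s : State, Ready n D s →
      AnswersQueries M W T queryCmd (fun i j : Fin n => s.answer D i j) s qs := by
  induction qs with
  | nil => exact fun _ _ => trivial
  | cons q qs ih =>
    intro s hs
    obtain ⟨t, s', hex, ht, hans, hs', heq⟩ := runs_queryCmd hL hs q.1.2 q.2.2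
    refine ⟨t, s', hex, ht.trans hT, hans, ?_⟩
    rw [← heq]
    exact ih s' hs'

/-! ### The streaming algorithm -/

/-- Reads the matrices and prepares the answers to queries. -/
def buildCmd : Cmd := setup ;; stream ;; buildDictionary

theorem runs_buildCmd {n b D : ℕ} {A B : Matrix (Fin n) (Fin n) ℝ} (hn : 1 ≤ n)
    (hA : ∀ i j, 0 ≤ A i j) (hB : ∀ i j, 0 ≤ B i j)
    (hD : D = 8 * (n + b)) (hL : Limits n D M W) :
    Runs M W buildCmd (productStart n b A B) fun t s =>
      t ≤ 9000 * (n * D) ∧ Ready n D s ∧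
      s.rreg fN = entrywiseL1 (A * B) ∧
      ∀ i j : Fin n, s.answer D i j ≤ (A * B) i j ∧
        (A * B) i j ≤ s.answer D i j + 4 * entrywiseL1 (A * B) / D := by
  have hD16 := hL.hD
  unfold buildCmd
  simp only [runs_seq]
  refine (runs_setup (n := n) (b := b) rfl rfl hD hL).mono ?_
  rintro t₁ s₁ hf₁ ⟨ht₁, hn₁, hD₁, htab₁⟩
  refine (runs_stream (a := fun k i => extend A i k) (b := fun k j => extend B k j) hL hn₁ hD₁
    (htab₁ D le_rfl) (by rw [hf₁.n _ rfl]; rfl) (by rw [hf₁.r _ rfl]; rfl)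
    (by rw [hf₁.a _ rfl]; exact fun _ => rfl) (fun k i => extend_nonneg hA i k)
    (fun k j => extend_nonneg hB k j) (by rw [hf₁.t _ rfl]; exact colMajor_eq A)
    (by rw [hf₁.t _ rfl]; exact rowMajor_eq B)).mono ?_
  rintro t₂ s₂ hf₂ ⟨ht₂, hS⟩
  obtain ⟨hmass, hhead, hsize, hrow, hcol, hkeyed, hsum, hup, e, he, hcharge, hlow⟩ := hS
  have hn₂ : s₂.nreg rN = n := by rw [hf₂.n _ (by decide)]; exact hn₁
  have hD₂ : s₂.nreg rD = D := by rw [hf₂.n _ (by decide)]; exact hD₁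
  have hb₂ : s₂.rarr bT = s₁.rarr bT := hf₂.b _ (by decide)
  have hcnt₂ : ∀ v, s₂.narr aCnt v = 0 := by
    rw [hf₂.a _ (by decide), hf₁.a _ rfl]
    exact fun _ => rfl
  rw [← entrywiseL1_mul hA hB] at hmass
  refine (runs_buildDictionary hL hn (by omega) hn₂ rfl hsize hrow hcol hkeyed hhead hcnt₂).mono ?_
  rintro t₃ s₃ hf₃ ⟨ht₃, hdict⟩
  have hD₃ : s₃.nreg rD = D := by rw [hf₃.n _ (by decide)]; exact hD₂
  have hE₃ : s₃.nreg rE = s₂.nreg rE := hf₃.n _ (by decide)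
  have hrow₃ : s₃.narr aRow = s₂.narr aRow := hf₃.a _ (by decide)
  have hcol₃ : s₃.narr aCol = s₂.narr aCol := hf₃.a _ (by decide)
  have hval₃ : s₃.narr aVal = s₂.narr aVal := hf₃.a _ (by decide)
  have hN₃ : s₃.rreg fN = s₂.rreg fN := hf₃.r _ (by decide)
  have hb₃ : s₃.rarr bT = s₂.rarr bT := hf₃.b _ (by decide)
  rw [hmass] at hup hcharge hlow hN₃
  have hans : ∀ i j, s₃.answer D i j =
      (cnt (s₂.nreg rE) (s₂.narr aRow) (s₂.narr aCol) (s₂.narr aVal) i j : ℝ) *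
        (entrywiseL1 (A * B) / D ^ 2) := fun i j => by
    unfold State.answer
    rw [hE₃, hrow₃, hcol₃, hval₃, hN₃]
  refine ⟨?_, ⟨hD₃, by rw [hb₃, hb₂]; exact htab₁, by rwa [hE₃], by rwa [hE₃, hrow₃, hcol₃],
    fun x hx => ?_, by rwa [hE₃]⟩, hN₃, fun i j => ⟨?_, ?_⟩⟩
  · have h1 : n * (3000 * D + 9) = 3000 * (n * D) + 9 * n := by ring
    have h2 : D ≤ n * D := Nat.le_mul_of_pos_left _ hn
    have h3 : n ≤ D := hL.hn
    omega
  · rw [hE₃] at hx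
    rw [hval₃]
    exact (Finset.single_le_sum (f := s₂.narr aVal) (fun _ _ => Nat.zero_le _)
      (Finset.mem_range.2 hx)).trans hsum
  · rw [hans, mul_apply_extend]
    exact hup i j i.2 j.2
  · rw [hans, mul_apply_extend]
    have h1 := hlow i j i.2 j.2
    set N := entrywiseL1 (A * B) with hN
    have hN0 : 0 ≤ N := Finset.sum_nonneg fun _ _ => Finset.sum_nonneg fun _ _ => abs_nonneg _
    have hDpos : (0 : ℝ) < D := by
      have : 0 < D := by omega
      exact_mod_cast this
    have hn8 : 8 * (n : ℝ) ≤ D := by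
      have : 8 * n ≤ D := by omega
      exact_mod_cast this
    -- The pruned amount is at most `N / (2 * D)`.
    have h2 : e ≤ N / (2 * D) := by
      rw [le_div_iff₀ (by positivity)]
      have : 0 ≤ ((∑ x ∈ Finset.range (s₂.nreg rE), s₂.narr aVal x : ℕ) : ℝ) * (N / D ^ 2) := by
        positivity
      linarith
    -- The rounding errors of `n` steps are at most `N / (2 * D)` because of `8 * n ≤ D`.
    have h3 : 4 * (n : ℝ) * (N / D ^ 2) ≤ N / (2 * D) := by
      have h4 : N / (2 * D) - 4 * (n : ℝ) * (N / D ^ 2) = (D - 8 * n) * (N / (2 * D ^ 2)) := by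
        field_simp
        ring
      have h5 : 0 ≤ (D - 8 * (n : ℝ)) * (N / (2 * D ^ 2)) :=
        mul_nonneg (by linarith) (by positivity)
      linarith
    have h6 : N / (2 * D) + N / (2 * D) + 3 * N / D = 4 * N / D := by
      field_simp
      ring
    linarith

end RealRAM

theorem mainTheorem1
    (sortTime : ℕ → ℕ) (hlin : ∀ k, k ≤ sortTime k)
    (sorter : RealRAM.Cmd) (hsorter : RealRAM.IsLinearSpaceSorter sorter sortTime) :
    ∃ (build query : RealRAM.Cmd) (K : ℕ),
      ∀ (n b : ℕ), 1 ≤ n → 1 ≤ b →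
      ∀ (A B : Matrix (Fin n) (Fin n) ℝ), (∀ i j, 0 ≤ A i j) → (∀ i j, 0 ≤ B i j) →
      ∃ (t : ℕ) (s : RealRAM.State),
        RealRAM.Exec (K * (b + n)) ((b + n) ^ K) build (RealRAM.productStart n b A B) t s ∧
        t ≤ K * (n * b + n * sortTime n) ∧
        ∃ est : Matrix (Fin n) (Fin n) ℝ,
          (∀ i j, max ((A * B) i j - entrywiseL1 (A * B) / b) 0 ≤ est i j ∧
            est i j ≤ (A * B) i j) ∧
          ∀ qs : List (Fin n × Fin n),
            RealRAM.AnswersQueries (K * (b + n)) ((b + n) ^ K) K query est s qs := by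
  -- `buildCmd` takes at most `9000 * n * D` steps with `D = 8 * (n + b)`, hence the constant.
  obtain ⟨K, hK⟩ : ∃ K, 72000 ≤ K := ⟨_, le_rfl⟩
  refine ⟨RealRAM.buildCmd, RealRAM.queryCmd, K, fun n b hn hb A B hA hB => ?_⟩
  have hL : RealRAM.Limits n (8 * (n + b)) (K * (b + n)) ((b + n) ^ K) := by
    refine ⟨by omega, by omega, ?_, ?_⟩
    · calc 20 * (8 * (n + b)) = 160 * (b + n) := by ring
        _ ≤ K * (b + n) := Nat.mul_le_mul_right _ (by omega)
    · have h2 : 2 ≤ b + n := by omega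
      calc 100 * (8 * (n + b) * (8 * (n + b)) * (8 * (n + b) * (8 * (n + b))))
          = 409600 * (b + n) ^ 4 := by ring
        _ ≤ 2 ^ 19 * (b + n) ^ 4 := Nat.mul_le_mul_right _ (by norm_num)
        _ ≤ (b + n) ^ 19 * (b + n) ^ 4 := Nat.mul_le_mul_right _ (Nat.pow_le_pow_left h2 _)
        _ = (b + n) ^ 23 := by ring
        _ ≤ (b + n) ^ K := Nat.pow_le_pow_right (by omega) (by omega)
  obtain ⟨t, s, hex, ht, hready, hN, hans⟩ := RealRAM.runs_buildCmd hn hA hB rfl hL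
  refine ⟨t, s, hex, ?_, fun i j => s.answer (8 * (n + b)) i j, fun i j => ⟨?_, (hans i j).1⟩,
    fun qs => hready.answersQueries hL (by omega) qs s⟩
  · -- Reading the input already takes time proportional to `n * n ≤ n * sortTime n`.
    calc t ≤ 9000 * (n * (8 * (n + b))) := ht
      _ = 72000 * (n * b + n * n) := by ring
      _ ≤ K * (n * b + n * sortTime n) :=
        Nat.mul_le_mul hK (Nat.add_le_add_left (Nat.mul_le_mul_left _ (hlin n)) _)
  · have hN0 : 0 ≤ entrywiseL1 (A * B) :=
      Finset.sum_nonneg fun _ _ => Finset.sum_nonneg fun _ _ => abs_nonneg _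
    refine max_le ?_ ?_
    · have h1 := (hans i j).2
      have hb0 : (0 : ℝ) < b := by exact_mod_cast hb
      have h2 : 4 * entrywiseL1 (A * B) / ((8 * (n + b) : ℕ) : ℝ) ≤ entrywiseL1 (A * B) / b := by
        have h3 : 4 * (b : ℝ) ≤ ((8 * (n + b) : ℕ) : ℝ) := by
          have : 4 * b ≤ 8 * (n + b) := by omega
          exact_mod_cast this
        rw [div_le_div_iff₀ (by linarith) hb0]
        nlinarith
      linarith
    · unfold RealRAM.State.answer
      rw [hN]
      positivity
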